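/- Let $\tilde{\mathcal A}=\{\sum_{\nu\ge 0}P_\nu(a)\,b^\nu : P_\nu\in\mathbb C[x]\}$ be the $\mathbb C$-algebra with $ab-ba=b^2$ and with left and right multiplication by $a$ continuous for the $b$-adic topology. For $\lambda\in\mathbb Q\cap\,]0,1]$ put $\Xi_\lambda^{(N)}=\bigoplus_{j=0}^N\mathbb C[[s]]\,s^{\lambda-1}(\mathrm{Log}\,s)^j$, where $a$ acts as multiplication by $s$ and $b$ as the primitive in $s$ without constant, and $\Xi_\Lambda^{(N)}=\bigoplus_{\lambda\in\Lambda}\Xi_\lambda^{(N)}$ for $\Lambda$ finite. *Definitions.* A *fresco* is a left $\tilde{\mathcal A}$-module isomorphic to a submodule $\tilde{\mathcal A}\varphi\subset\Xi_\Lambda^{(N)}\otimes V$, with $V$ a finite dimensional complex vector space. An *(a,b)-module* is an $\tilde{\mathcal A}$-module that is free of finite rank over $\mathbb C[[b]]$; it has a *simple pole* if $aE\subset bE$, and it is *regular* if it embeds in a simple pole (a,b)-module; its *saturation* is the minimal such embedding $E\subset E^\sharp$, and its *Bernstein polynomial* is the minimal polynomial of $-b^{-1}a$ on $E^\sharp/bE^\sharp$.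 A regular $E$ is *$[\lambda]$-primitive* if all roots of its Bernstein polynomial lie in $-\lambda+\mathbb Z$, and *semi-simple* if it is a submodule of a finite direct sum of regular (a,b)-modules of rank $1$. A submodule $F\subset E$ is *normal* if $F\cap bE=bF$. Put $E_\mu=\tilde{\mathcal A}/\tilde{\mathcal A}(a-\mu b)$. The *principal Jordan-Hölder sequence* of a $[\lambda]$-primitive fresco $E$ of rank $r$ is its unique sequence of normal submodules $0=F_0\subset F_1\subset\dots\subset F_r=E$ with $F_j/F_{j-1}\simeq E_{\lambda_j}$ and $\lambda_j+j$ non-decreasing in $j$; then $(\lambda_1,\dots,\lambda_r)$ are the *fundamental invariants* of $E$. Fix $\lambda\in\mathbb Q\cap\,]0,1]$. For $r\ge 2$ and rational numbers $\lambda_1,\dots,\lambda_r$ with $\lambda_{j+1}=\lambda_j+p_j-1$ for integers $p_j\ge1$ ($1\le j\le r-1$), let $\mathcal F_0(\lambda_1,\dots,\lambda_r)$ be the set of isomorphism classes of $[\lambda]$-primitive frescos $E$ with fundamental invariants $(\lambda_1,\dots,\lambda_r)$ such that $F_{r-1}$ and $E/F_1$ are semi-simple. A function $f:\mathcal F_0(\lambda_1,\dots,\lambda_r)\to\mathbb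 C$ is *polynomial* if there is a polynomial $Q$ in (finitely many of) the variables $s_{j,i}$, $1\le j\le r$, $i\ge1$, such that, with $S_j(s)=1+\sum_{i\ge1}s_{j,i}b^i$ and $$E(s)=\tilde{\mathcal A}\big/\tilde{\mathcal A}\,(a-\lambda_1b)S_1(s)^{-1}\cdots(a-\lambda_rb)S_r(s)^{-1},$$ one has $f([E(s)])=Q(s)$ for every value of $s$ for which $[E(s)]\in\mathcal F_0(\lambda_1,\dots,\lambda_r)$. **Theorem.** There is a unique family of functions $\alpha:\mathcal F_0(\lambda_1,\dots,\lambda_r)\to\mathbb C$, one for each $r\ge2$ and each tuple $(\lambda_1,\dots,\lambda_r)$ as above, such that each of them is polynomial and: i) for $[E]\in\mathcal F_0(\lambda_1,\dots,\lambda_r)$, $\alpha([E])=0$ if and only if $E$ is semi-simple; ii) if $r\ge3$, $[E]\in\mathcal F_0(\lambda_1,\dots,\lambda_r)$ and $e$ is a generator of $E$ such that $(a-\lambda_{r-1}b)(a-\lambda_rb)e\in F_{r-2}$, then the submodule $G_{r-1}=\tilde{\mathcal A}\,(a-(\lambda_{r-1}-1)b)\,e$ satisfies $[G_{r-1}]\in\mathcal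 F_0(\lambda_1,\dots,\lambda_{r-2},\lambda_r+1)$ and $\alpha([E])=\alpha([G_{r-1}])$; iii) if $r=2$, $[E]\in\mathcal F_0(\lambda_1,\lambda_2)$ and $E\simeq\tilde{\mathcal A}/\tilde{\mathcal A}\,(a-\lambda_1b)(1+x\,b^{p_1})^{-1}(a-\lambda_2b)$ with $x\in\mathbb C$, then $\alpha([E])=x$. -/

import Mathlib

open Polynomial

noncomputable section

/-! ### Sequences with two operators -/

/-- Two operators on a space of sequences (coefficients of a formal expansion) such that
`A B - B A = B ^ 2`, `A` respects the filtration by the order of vanishing and `B` raises it. -/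
structure IsABPair {V : Type*} [AddCommGroup V] [Module ℂ V]
    (A B : Module.End ℂ (ℕ → V)) : Prop where
  comm : A * B = B * A + B * B
  filA : ∀ (n : ℕ) (y : ℕ → V), (∀ m < n, y m = 0) → ∀ m < n, A y m = 0
  filB : ∀ (n : ℕ) (y : ℕ → V), (∀ m < n, y m = 0) → ∀ m < n + 1, B y m = 0

/-- The operator `y ↦ ∑ ν, B ^ ν (u ν)(A) y`; if `B` raises the order of vanishing, only the
terms `ν ≤ m` contribute to the coefficient of index `m`. -/
def seriesAct {V : Type*} [AddCommGroup V] [Module ℂ V] (A B : Module.End ℂ (ℕ → V))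
    (u : ℕ → ℂ[X]) : Module.End ℂ (ℕ → V) where
  toFun y m := ∑ ν ∈ Finset.range (m + 1), (B ^ ν) (aeval A (u ν) y) m
  map_add' y z := by
    funext m; simp [Finset.sum_add_distrib]
  map_smul' c y := by
    funext m; simp [Finset.smul_sum]

theorem IsABPair.pow_fil {V : Type*} [AddCommGroup V] [Module ℂ V]
    {A B : Module.End ℂ (ℕ → V)} (h : IsABPair A B) (ν : ℕ) (y : ℕ → V) :
    ∀ m < ν, (B ^ ν) y m = 0 := by
  induction ν with
  | zero => intro m hm; omega
  | succ n ih =>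
    intro m hm
    rw [pow_succ']
    exact h.filB n _ ih m hm

theorem IsABPair.seriesAct_apply {V : Type*} [AddCommGroup V] [Module ℂ V]
    {A B : Module.End ℂ (ℕ → V)} (h : IsABPair A B) (u : ℕ → ℂ[X]) (y : ℕ → V) {m n : ℕ}
    (hmn : m < n) :
    seriesAct A B u y m = (∑ ν ∈ Finset.range n, (B ^ ν) (aeval A (u ν) y)) m := by
  rw [Finset.sum_apply]
  have hs : Finset.range (m + 1) ⊆ Finset.range n := by
    intro i hi
    rw [Finset.mem_range] at hi ⊢
    omega
  change ∑ ν ∈ Finset.range (m + 1), (B ^ ν) (aeval A (u ν) y) m =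
    ∑ ν ∈ Finset.range n, (B ^ ν) (aeval A (u ν) y) m
  refine Finset.sum_subset hs ?_
  intro ν _ hν
  refine h.pow_fil ν _ m ?_
  rw [Finset.mem_range] at hν
  omega

theorem IsABPair.comm_pow {V : Type*} [AddCommGroup V] [Module ℂ V]
    {A B : Module.End ℂ (ℕ → V)} (h : IsABPair A B) (ν : ℕ) :
    A * B ^ ν = B ^ ν * A + (ν : ℂ) • B ^ (ν + 1) := by
  induction ν with
  | zero => simp
  | succ n ih =>
    rw [pow_succ, ← mul_assoc, ih, add_mul, mul_assoc, h.comm, mul_add, smul_mul_assoc,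
      ← pow_succ]
    simp only [← mul_assoc, ← pow_succ]
    push_cast
    rw [add_smul, one_smul]
    abel

/-- Left multiplication by `a` on series `∑ b ^ ν Q_ν(a)`. -/
def leftA : Module.End ℂ (ℕ → ℂ[X]) where
  toFun u m := X * u m + ((m - 1 : ℕ) : ℂ) • u (m - 1)
  map_add' u v := by funext m; simp [mul_add]; abel
  map_smul' c u := by
    funext m
    simp [smul_comm c]

/-- Left multiplication by `b` on series `∑ b ^ ν Q_ν(a)`. -/
def leftB : Module.End ℂ (ℕ → ℂ[X]) where
  toFun u m := if m = 0 then 0 else u (m - 1)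
  map_add' u v := by funext m; by_cases h : m = 0 <;> simp [h]
  map_smul' c u := by funext m; by_cases h : m = 0 <;> simp [h]

theorem isABPair_left : IsABPair leftA leftB where
  comm := by
    refine LinearMap.ext fun u => funext fun m => ?_
    rcases m with _ | _ | m
    · simp [leftA, leftB]
    · simp [leftA, leftB]
    · simp [leftA, leftB, add_smul]
      abel
  filA n y hy m hm := by
    simp [leftA, hy m hm, hy (m - 1) (by omega)]
  filB n y hy m hm := by
    rcases m with _ | m
    · simp [leftB]
    · simpa [leftB] using hy m (by omega)

theorem IsABPair.act_leftB {V : Type*} [AddCommGroup V] [Module ℂ V]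
    {A B : Module.End ℂ (ℕ → V)} (h : IsABPair A B) (u : ℕ → ℂ[X]) :
    seriesAct A B (leftB u) = B * seriesAct A B u := by
  refine LinearMap.ext fun y => funext fun m => ?_
  have key : B (seriesAct A B u y - ∑ ν ∈ Finset.range m, (B ^ ν) (aeval A (u ν) y)) m = 0 := by
    refine h.filB m _ (fun i hi => ?_) m (by omega)
    rw [Pi.sub_apply, h.seriesAct_apply u y hi, sub_self]
  rw [map_sub, Pi.sub_apply, sub_eq_zero] at key
  rw [Module.End.mul_apply, key, h.seriesAct_apply _ y (Nat.lt_succ_self m),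
    Finset.sum_range_succ', map_sum]
  simp [leftB, pow_succ']

theorem IsABPair.act_leftA {V : Type*} [AddCommGroup V] [Module ℂ V]
    {A B : Module.End ℂ (ℕ → V)} (h : IsABPair A B) (u : ℕ → ℂ[X]) :
    seriesAct A B (leftA u) = A * seriesAct A B u := by
  refine LinearMap.ext fun y => funext fun m => ?_
  have key : A (seriesAct A B u y -
      ∑ ν ∈ Finset.range (m + 1), (B ^ ν) (aeval A (u ν) y)) m = 0 := by
    refine h.filA (m + 1) _ (fun i hi => ?_) m (by omega)
    rw [Pi.sub_apply, h.seriesAct_apply u y hi, sub_self]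
  rw [map_sub, Pi.sub_apply, sub_eq_zero] at key
  rw [Module.End.mul_apply, key, h.seriesAct_apply _ y (Nat.lt_succ_self m), map_sum]
  have e1 : ∀ ν, A ((B ^ ν) (aeval A (u ν) y)) =
      (B ^ ν) (A (aeval A (u ν) y)) + (ν : ℂ) • (B ^ (ν + 1)) (aeval A (u ν) y) := by
    intro ν
    have := congrArg (fun T => T (aeval A (u ν) y)) (h.comm_pow ν)
    simpa using this
  have e2 : ∀ ν, (B ^ ν) (aeval A (leftA u ν) y) =
      (B ^ ν) (A (aeval A (u ν) y)) +
        ((ν - 1 : ℕ) : ℂ) • (B ^ ν) (aeval A (u (ν - 1)) y) := by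
    intro ν
    simp [leftA]
  simp only [e1, e2, Finset.sum_add_distrib, Pi.add_apply]
  congr 1
  rw [Finset.sum_range_succ', Finset.sum_range_succ]
  have := h.pow_fil (m + 1) (aeval A (u m) y) m (by omega)
  simp [this]

theorem seriesAct_add {V : Type*} [AddCommGroup V] [Module ℂ V] (A B : Module.End ℂ (ℕ → V))
    (u v : ℕ → ℂ[X]) : seriesAct A B (u + v) = seriesAct A B u + seriesAct A B v := by
  refine LinearMap.ext fun y => funext fun m => ?_
  simp [seriesAct, Finset.sum_add_distrib]

theorem seriesAct_smul {V : Type*} [AddCommGroup V] [Module ℂ V] (A B : Module.End ℂ (ℕ → V))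
    (c : ℂ) (u : ℕ → ℂ[X]) : seriesAct A B (c • u) = c • seriesAct A B u := by
  refine LinearMap.ext fun y => funext fun m => ?_
  simp [seriesAct, Finset.smul_sum]

theorem IsABPair.act_aeval {V : Type*} [AddCommGroup V] [Module ℂ V]
    {A B : Module.End ℂ (ℕ → V)} (h : IsABPair A B) (q : ℂ[X]) (u : ℕ → ℂ[X]) :
    seriesAct A B (aeval leftA q u) = aeval A q * seriesAct A B u := by
  induction q using Polynomial.induction_on' with
  | add p q hp hq => simp [seriesAct_add, hp, hq, add_mul]
  | monomial n c =>
    have : ∀ n : ℕ, seriesAct A B ((leftA ^ n) u) = A ^ n * seriesAct A B u := by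
      intro n
      induction n with
      | zero => simp
      | succ n ih => rw [pow_succ', Module.End.mul_apply, h.act_leftA, ih, pow_succ', mul_assoc]
    simp [aeval_monomial, seriesAct_smul, this, Algebra.algebraMap_eq_smul_one]

theorem IsABPair.act_pow {V : Type*} [AddCommGroup V] [Module ℂ V]
    {A B : Module.End ℂ (ℕ → V)} (h : IsABPair A B) (n : ℕ) (u : ℕ → ℂ[X]) :
    seriesAct A B ((leftB ^ n) u) = B ^ n * seriesAct A B u := by
  induction n with
  | zero => simp
  | succ n ih => rw [pow_succ', Module.End.mul_apply, h.act_leftB, ih, pow_succ', mul_assoc]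

theorem IsABPair.act_act {V : Type*} [AddCommGroup V] [Module ℂ V]
    {A B : Module.End ℂ (ℕ → V)} (h : IsABPair A B) (u v : ℕ → ℂ[X]) :
    seriesAct A B (seriesAct leftA leftB u v) = seriesAct A B u * seriesAct A B v := by
  refine LinearMap.ext fun y => funext fun m => ?_
  have h1 : seriesAct A B (seriesAct leftA leftB u v) y m =
      seriesAct A B (∑ ν ∈ Finset.range (m + 1), (leftB ^ ν) (aeval leftA (u ν) v)) y m := by
    change ∑ i ∈ Finset.range (m + 1),
        (B ^ i) (aeval A (seriesAct leftA leftB u v i) y) m =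
      ∑ i ∈ Finset.range (m + 1), (B ^ i) (aeval A
        ((∑ ν ∈ Finset.range (m + 1), (leftB ^ ν) (aeval leftA (u ν) v)) i) y) m
    refine Finset.sum_congr rfl fun i hi => ?_
    rw [isABPair_left.seriesAct_apply u v (Finset.mem_range.mp hi)]
  have h2 : ∀ s : Finset ℕ,
      seriesAct A B (∑ ν ∈ s, (leftB ^ ν) (aeval leftA (u ν) v)) y =
        ∑ ν ∈ s, (B ^ ν) (aeval A (u ν) (seriesAct A B v y)) := by
    intro s
    induction s using Finset.induction_on with
    | empty =>
      rw [Finset.sum_empty, Finset.sum_empty]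
      funext i
      simp [seriesAct]
    | insert a s ha ih =>
      rw [Finset.sum_insert ha, Finset.sum_insert ha, seriesAct_add, LinearMap.add_apply, ih,
        h.act_pow, h.act_aeval]
      rfl
  rw [h1, h2, Module.End.mul_apply, h.seriesAct_apply u _ (Nat.lt_succ_self m)]

/-! ### The algebra `Ã` -/

/-- The algebra `Ã`. The sequence `Q` stands for the formal series `∑ ν, b ^ ν Q_ν(a)`. Since
`a b ^ ν = b ^ ν a + ν b ^ (ν + 1)`, moving the powers of `b` to the other side is possible and
involves finite sums only in each degree in `b`, so these are also the series
`∑ ν, P_ν(a) b ^ ν`. -/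
def ATilde : Type := ℕ → ℂ[X]

namespace ATilde

instance : AddCommGroup ATilde := inferInstanceAs (AddCommGroup (ℕ → ℂ[X]))

instance : Module ℂ ATilde := inferInstanceAs (Module ℂ (ℕ → ℂ[X]))

instance : One ATilde := ⟨(Pi.single 0 1 : ℕ → ℂ[X])⟩

/-- The product determined by `a b - b a = b ^ 2` and `b`-adic continuity. -/
instance : Mul ATilde := ⟨fun u v => seriesAct leftA leftB u v⟩

theorem mul_def (u v : ATilde) : u * v = seriesAct leftA leftB u v := rfl

theorem act_one {V : Type*} [AddCommGroup V] [Module ℂ V] (A B : Module.End ℂ (ℕ → V)) :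
    seriesAct A B (1 : ATilde) = 1 := by
  refine LinearMap.ext fun y => funext fun m => ?_
  change ∑ ν ∈ Finset.range (m + 1), (B ^ ν) (aeval A ((Pi.single 0 1 : ℕ → ℂ[X]) ν) y) m = y m
  rw [Finset.sum_range_succ']
  simp

theorem aeval_leftA_single (q r : ℂ[X]) :
    aeval leftA q (Pi.single 0 r : ℕ → ℂ[X]) = Pi.single 0 (q * r) := by
  induction q using Polynomial.induction_on' with
  | add p q hp hq => simp [hp, hq, add_mul, Pi.single_add]
  | monomial n c =>
    have : ∀ n : ℕ, (leftA ^ n) (Pi.single 0 r : ℕ → ℂ[X]) = Pi.single 0 (X ^ n * r) := by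
      intro n
      induction n with
      | zero => simp
      | succ n ih =>
        rw [pow_succ', Module.End.mul_apply, ih]
        funext m
        rcases m with _ | _ | m <;> simp [leftA, pow_succ', mul_assoc]
    rw [aeval_monomial, Module.End.mul_apply, this, Module.algebraMap_end_apply, ← Pi.single_smul,
      ← C_mul_X_pow_eq_monomial, mul_assoc, smul_eq_C_mul]

theorem leftB_pow_single (n : ℕ) (r : ℂ[X]) :
    (leftB ^ n) (Pi.single 0 r : ℕ → ℂ[X]) = Pi.single n r := by
  induction n with
  | zero => simp
  | succ n ih =>
    rw [pow_succ', Module.End.mul_apply, ih]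
    funext m
    rcases m with _ | m
    · simp [leftB]
    · by_cases h : m = n <;> simp [leftB, h]

theorem act_self_one (u : ATilde) : seriesAct leftA leftB u (1 : ATilde) = u := by
  funext m
  change ∑ ν ∈ Finset.range (m + 1),
    (leftB ^ ν) (aeval leftA (u ν) (Pi.single 0 1 : ℕ → ℂ[X])) m = u m
  simp only [aeval_leftA_single, leftB_pow_single, mul_one]
  rw [Finset.sum_eq_single m]
  · simp
  · intro b _ hb
    simp [hb.symm]
  · simp

instance : Ring ATilde :=
  { (inferInstance : AddCommGroup ATilde) with
    mul := (· * ·)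
    one := 1
    left_distrib := fun u v w => map_add (seriesAct leftA leftB u) v w
    right_distrib := fun u v w => by
      rw [mul_def, mul_def, mul_def]
      exact congrArg (fun T => T w) (seriesAct_add leftA leftB u v)
    zero_mul := fun v => by
      funext m
      rw [mul_def]
      change ∑ ν ∈ Finset.range (m + 1), (leftB ^ ν) (aeval leftA (0 : ℂ[X]) v) m = 0
      refine Finset.sum_eq_zero fun ν _ => ?_
      rw [map_zero]
      exact congrFun (map_zero (leftB ^ ν)) m
    mul_zero := fun u => map_zero (seriesAct leftA leftB u)
    mul_assoc := fun u v w => by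
      simp only [mul_def]
      exact congrArg (fun T => T w) (isABPair_left.act_act u v)
    one_mul := fun u => congrArg (fun T => T u) (act_one leftA leftB)
    mul_one := fun u => act_self_one u }

instance : Algebra ℂ ATilde :=
  Algebra.ofModule
    (fun c u v => congrArg (fun T => T v) (seriesAct_smul leftA leftB c u))
    (fun c u v => map_smul (seriesAct leftA leftB u) c v)

/-- The element `a`. -/
def a : ATilde := (Pi.single 0 X : ℕ → ℂ[X])

/-- The element `b`. -/
def b : ATilde := (Pi.single 1 1 : ℕ → ℂ[X])

theorem a_mul (u : ATilde) : a * u = leftA u := by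
  have h := isABPair_left.act_leftA (1 : ATilde)
  have h1 : leftA (1 : ATilde) = a := by
    have := aeval_leftA_single X 1
    rw [aeval_X, mul_one] at this
    exact this
  rw [h1, act_one, mul_one] at h
  exact congrArg (fun T => T u) h

theorem b_mul (u : ATilde) : b * u = leftB u := by
  have h := isABPair_left.act_leftB (1 : ATilde)
  have h1 : leftB (1 : ATilde) = b := by
    have := leftB_pow_single 1 1
    rw [pow_one] at this
    exact this
  rw [h1, act_one, mul_one] at h
  exact congrArg (fun T => T u) h

/-- The commutation relation. -/
theorem a_mul_b : a * b - b * a = b ^ 2 := by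
  have h := congrArg (fun T => T (1 : ATilde)) isABPair_left.comm
  have h' : leftA (leftB (1 : ATilde)) =
      leftB (leftA (1 : ATilde)) + leftB (leftB (1 : ATilde)) := h
  rw [← b_mul, ← a_mul, ← a_mul, ← b_mul, ← b_mul] at h'
  simp only [mul_one] at h'
  rw [h', sq]
  exact add_sub_cancel_left (b * a) (b * b)

theorem leftB_pow_apply (n : ℕ) (u : ℕ → ℂ[X]) (m : ℕ) :
    (leftB ^ n) u m = if n ≤ m then u (m - n) else 0 := by
  induction n generalizing m with
  | zero => simp
  | succ n ih =>
    rw [pow_succ', Module.End.mul_apply]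
    rcases m with _ | m
    · simp [leftB]
    · have : leftB ((leftB ^ n) u) (m + 1) = (leftB ^ n) u m := by simp [leftB]
      rw [this, ih]
      simp

/-- The subalgebra `ℂ[[b]]`: the power series `∑ s_ν X ^ ν` is sent to `∑ s_ν b ^ ν`. -/
def ofB : PowerSeries ℂ →+* ATilde where
  toFun S := fun ν => C (PowerSeries.coeff ν S)
  map_one' := by
    funext m
    change C (PowerSeries.coeff m (1 : PowerSeries ℂ)) = (Pi.single 0 1 : ℕ → ℂ[X]) m
    rw [PowerSeries.coeff_one]
    by_cases h : m = 0 <;> simp [h]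
  map_zero' := by
    funext m
    change C (PowerSeries.coeff m (0 : PowerSeries ℂ)) = (0 : ℂ[X])
    simp
  map_add' S T := by
    funext m
    change C (PowerSeries.coeff m (S + T)) =
      C (PowerSeries.coeff m S) + C (PowerSeries.coeff m T)
    simp
  map_mul' S T := by
    funext m
    change C (PowerSeries.coeff m (S * T)) = ∑ ν ∈ Finset.range (m + 1),
      (leftB ^ ν) (aeval leftA (C (PowerSeries.coeff ν S))
        (fun ν => C (PowerSeries.coeff ν T) : ℕ → ℂ[X])) m
    rw [PowerSeries.coeff_mul, Finset.Nat.sum_antidiagonal_eq_sum_range_succ_mk, map_sum]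
    refine Finset.sum_congr rfl fun ν hν => ?_
    have : ν ≤ m := Nat.lt_succ_iff.mp (Finset.mem_range.mp hν)
    rw [leftB_pow_apply, if_pos this]
    simp [smul_eq_C_mul]

end ATilde

/-! ### Asymptotic expansions -/

/-- Rational numbers in the interval `]0, 1]`. -/
abbrev UnitRat : Type := {q : ℚ // 0 < q ∧ q ≤ 1}

/-- The space `Ξ_lam^(N) = ⨁_{j ≤ N} ℂ[[s]] s ^ (lam - 1) (Log s) ^ j`: the entry `y m j` is the
coefficient of `s ^ (lam + m - 1) (Log s) ^ j`. -/
def Xi (_lam : UnitRat) (N : ℕ) : Type := ℕ → (Fin (N + 1) → ℂ)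

namespace Xi

instance (lam : UnitRat) (N : ℕ) : AddCommGroup (Xi lam N) :=
  inferInstanceAs (AddCommGroup (ℕ → (Fin (N + 1) → ℂ)))

instance (lam : UnitRat) (N : ℕ) : Module ℂ (Xi lam N) :=
  inferInstanceAs (Module ℂ (ℕ → (Fin (N + 1) → ℂ)))

/-- Multiplication by `s`. -/
def opA (N : ℕ) : Module.End ℂ (ℕ → (Fin (N + 1) → ℂ)) where
  toFun y m := if m = 0 then 0 else y (m - 1)
  map_add' u v := by funext m; by_cases h : m = 0 <;> simp [h]
  map_smul' c u := by funext m; by_cases h : m = 0 <;> simp [h]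

/-- The matrix of `d/ds` from the span of the `s ^ μ (Log s) ^ j` to the span of the
`s ^ (μ - 1) (Log s) ^ j`, `j ≤ N`: the derivative of `s ^ μ (Log s) ^ j` is
`μ s ^ (μ - 1) (Log s) ^ j + j s ^ (μ - 1) (Log s) ^ (j - 1)`. -/
def derivMatrix (N : ℕ) (μ : ℂ) : Matrix (Fin (N + 1)) (Fin (N + 1)) ℂ :=
  Matrix.of fun i j =>
    if i = j then μ else if (i : ℕ) + 1 = (j : ℕ) then ((j : ℕ) : ℂ) else 0

theorem derivMatrix_det (N : ℕ) (μ : ℂ) : (derivMatrix N μ).det = μ ^ (N + 1) := by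
  rw [Matrix.det_of_isUpperTriangular]
  · simp [derivMatrix]
  · intro i j hij
    have hij' : j < i := hij
    have h1 : i ≠ j := ne_of_gt hij'
    have h2 : ¬ ((i : ℕ) + 1 = (j : ℕ)) := by
      have : (j : ℕ) < (i : ℕ) := hij'
      omega
    simp [derivMatrix, h1, h2]

theorem derivMatrix_add_one (N : ℕ) (μ : ℂ) :
    derivMatrix N (μ + 1) = derivMatrix N μ + 1 := by
  ext i j
  by_cases h : i = j <;> simp [derivMatrix, h]

/-- The primitive in `s` without constant: the entries of index `m + 1` are obtained from those of
index `m` by inverting `d/ds`. -/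
def opB (lam : UnitRat) (N : ℕ) : Module.End ℂ (ℕ → (Fin (N + 1) → ℂ)) where
  toFun y m :=
    if m = 0 then 0
    else ((derivMatrix N (((lam : ℚ) : ℂ) + ((m - 1 : ℕ) : ℂ)))⁻¹).mulVec (y (m - 1))
  map_add' u v := by funext m; by_cases h : m = 0 <;> simp [h, Matrix.mulVec_add]
  map_smul' c u := by funext m; by_cases h : m = 0 <;> simp [h, Matrix.mulVec_smul]

theorem lam_add_ne_zero (lam : UnitRat) (m : ℕ) : ((lam : ℚ) : ℂ) + (m : ℂ) ≠ 0 := by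
  have h : (0 : ℚ) < (lam : ℚ) + (m : ℚ) := by
    have := lam.2.1
    positivity
  exact_mod_cast h.ne'

theorem isABPair_op (lam : UnitRat) (N : ℕ) : IsABPair (opA N) (opB lam N) where
  comm := by
    refine LinearMap.ext fun y => funext fun m => ?_
    rcases m with _ | _ | m
    · simp [opA, opB]
    · simp [opA, opB]
    · have hu : ∀ n : ℕ,
          IsUnit (derivMatrix N (((lam : ℚ) : ℂ) + (n : ℂ))).det := by
        intro n
        rw [derivMatrix_det]
        exact (pow_ne_zero _ (lam_add_ne_zero lam n)).isUnit
      set D := derivMatrix N (((lam : ℚ) : ℂ) + (m : ℂ)) with hD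
      set D' := derivMatrix N (((lam : ℚ) : ℂ) + ((m + 1 : ℕ) : ℂ)) with hD'
      have h1 : D' = D + 1 := by
        rw [hD, hD', ← derivMatrix_add_one]
        push_cast
        rw [add_assoc]
      have key : D⁻¹ = D'⁻¹ + D'⁻¹ * D⁻¹ := by
        have e1 : D'⁻¹ * D' = 1 := Matrix.nonsing_inv_mul _ (hu (m + 1))
        have e2 : D * D⁻¹ = 1 := Matrix.mul_nonsing_inv _ (hu m)
        calc D⁻¹ = (D'⁻¹ * D') * D⁻¹ := by rw [e1, one_mul]
          _ = D'⁻¹ * (D * D⁻¹) + D'⁻¹ * D⁻¹ := by rw [h1]; noncomm_ring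
          _ = D'⁻¹ + D'⁻¹ * D⁻¹ := by rw [e2, mul_one]
      have : D⁻¹.mulVec (y m) = D'⁻¹.mulVec (y m) + D'⁻¹.mulVec (D⁻¹.mulVec (y m)) := by
        rw [Matrix.mulVec_mulVec, ← Matrix.add_mulVec, ← key]
      simpa [opA, opB, hD, hD'] using this
  filA n y hy m hm := by
    rcases m with _ | m
    · simp [opA]
    · simpa [opA] using hy m (by omega)
  filB n y hy m hm := by
    rcases m with _ | m
    · simp [opB]
    · simp [opB, hy m (by omega)]

/-- The `Ã`-module structure of `Ξ_lam^(N)`: `a` is the multiplication by `s`, `b` the primitive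
without constant. -/
instance (lam : UnitRat) (N : ℕ) : Module ATilde (Xi lam N) where
  smul u y := seriesAct (opA N) (opB lam N) u y
  one_smul y := congrArg (fun T => T y) (ATilde.act_one (opA N) (opB lam N))
  mul_smul u v y := congrArg (fun T => T y) ((isABPair_op lam N).act_act u v)
  smul_zero u := map_zero (seriesAct (opA N) (opB lam N) u)
  smul_add u y z := map_add (seriesAct (opA N) (opB lam N) u) y z
  add_smul u v y := congrArg (fun T => T y) (seriesAct_add (opA N) (opB lam N) u v)
  zero_smul y := by
    have h := congrArg (fun T => T y) (seriesAct_smul (opA N) (opB lam N) 0 0)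
    rw [zero_smul, zero_smul] at h
    exact h

end Xi

/-! ### `(a,b)`-modules -/

section ABModules

/-- The `ℂ[[b]]`-module underlying an `Ã`-module. -/
abbrev restrictB (E : Type) [AddCommGroup E] [Module ATilde E] : Module (PowerSeries ℂ) E :=
  Module.compHom E ATilde.ofB

/-- An `(a,b)`-module is an `Ã`-module that is free of finite rank over `ℂ[[b]]`. -/
structure IsABModule (E : Type) [AddCommGroup E] [Module ATilde E] : Prop where
  free : letI := restrictB E; Module.Free (PowerSeries ℂ) E
  finite : letI := restrictB E; Module.Finite (PowerSeries ℂ) E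

/-- The rank of an `(a,b)`-module over `ℂ[[b]]`. -/
def abRank (E : Type) [AddCommGroup E] [Module ATilde E] : ℕ :=
  letI := restrictB E; Module.finrank (PowerSeries ℂ) E

/-- A simple pole `(a,b)`-module: `a E ⊆ b E`. -/
structure IsSimplePole (E : Type) [AddCommGroup E] [Module ATilde E] : Prop where
  isABModule : IsABModule E
  pole : ∀ x : E, ∃ y : E, ATilde.a • x = ATilde.b • y

/-- A regular `(a,b)`-module: it embeds in a simple pole `(a,b)`-module. -/
def IsRegularAB (E : Type) [AddCommGroup E] [Module ATilde E] : Prop :=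
  IsABModule E ∧ ∃ W : ModuleCat.{0} ATilde, IsSimplePole W ∧
    ∃ j : E →ₗ[ATilde] W, Function.Injective j

theorem IsABModule.b_injective {E : Type} [AddCommGroup E] [Module ATilde E]
    (h : IsABModule E) : Function.Injective (fun x : E => ATilde.b • x) := by
  let _ := restrictB E
  have : Module.Free (PowerSeries ℂ) E := h.free
  have hX : ATilde.ofB (PowerSeries.X : PowerSeries ℂ) = ATilde.b := by
    funext m
    change C (PowerSeries.coeff m (PowerSeries.X : PowerSeries ℂ)) =
      (Pi.single 1 1 : ℕ → ℂ[X]) m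
    rw [PowerSeries.coeff_X]
    by_cases hm : m = 1 <;> simp [hm]
  intro x y hxy
  have hxy' : (PowerSeries.X : PowerSeries ℂ) • x = (PowerSeries.X : PowerSeries ℂ) • y := by
    change ATilde.ofB PowerSeries.X • x = ATilde.ofB PowerSeries.X • y
    rw [hX]
    exact hxy
  exact smul_right_injective E PowerSeries.X_ne_zero hxy'

variable (W : Type) [AddCommGroup W] [Module ℂ W] [Module ATilde W] [IsScalarTower ℂ ATilde W]

/-- The action of `u : Ã` as a `ℂ`-linear map. -/
def actL (u : ATilde) : W →ₗ[ℂ] W := Algebra.lsmul ℂ ℂ W u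

variable {W}

/-- The operator `b⁻¹ a` of a simple pole `(a,b)`-module. -/
def bInvA (h : IsSimplePole W) : W →ₗ[ℂ] W :=
  (LinearEquiv.ofInjective (actL W ATilde.b) h.isABModule.b_injective).symm.toLinearMap ∘ₗ
    (actL W ATilde.a).codRestrict (LinearMap.range (actL W ATilde.b))
      (fun x => by obtain ⟨y, hy⟩ := h.pole x; exact ⟨y, hy.symm⟩)

theorem b_bInvA (h : IsSimplePole W) (x : W) :
    ATilde.b • bInvA h x = ATilde.a • x := by
  have := LinearEquiv.apply_symm_apply
    (LinearEquiv.ofInjective (actL W ATilde.b) h.isABModule.b_injective)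
    ((actL W ATilde.a).codRestrict (LinearMap.range (actL W ATilde.b))
      (fun x => by obtain ⟨y, hy⟩ := h.pole x; exact ⟨y, hy.symm⟩) x)
  exact congrArg Subtype.val this

theorem bInvA_range (h : IsSimplePole W) :
    LinearMap.range (actL W ATilde.b) ≤
      (LinearMap.range (actL W ATilde.b)).comap (bInvA h) := by
  rintro _ ⟨x, rfl⟩
  refine ⟨bInvA h x + x, ?_⟩
  apply h.isABModule.b_injective
  change ATilde.b • (ATilde.b • (bInvA h x + x)) =
    ATilde.b • bInvA h (ATilde.b • x)
  rw [b_bInvA]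
  have e : ATilde.a * ATilde.b = ATilde.b * ATilde.a + ATilde.b * ATilde.b := by
    rw [← sq, ← ATilde.a_mul_b, add_sub_cancel]
  rw [smul_smul ATilde.a, e, add_smul, smul_add, mul_smul, mul_smul, smul_add, b_bInvA]

/-- The endomorphism of `W / b W` induced by `- b⁻¹ a`. -/
def residue (h : IsSimplePole W) :
    Module.End ℂ (W ⧸ LinearMap.range (actL W ATilde.b)) :=
  -Submodule.mapQ _ _ (bInvA h) (bInvA_range h)

/-- The Bernstein polynomial of a simple pole `(a,b)`-module. -/
def bernsteinPoly (h : IsSimplePole W) : ℂ[X] := minpoly ℂ (residue h)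

/-- `j : E → W` is (up to isomorphism) the inclusion of `E` in its saturation: the minimal
embedding of `E` in a simple pole `(a,b)`-module. -/
structure IsSaturation {E W : Type} [AddCommGroup E] [Module ATilde E] [AddCommGroup W]
    [Module ATilde W] (j : E →ₗ[ATilde] W) : Prop where
  injective : Function.Injective j
  simplePole : IsSimplePole W
  minimal : ∀ W' : Submodule ATilde W, LinearMap.range j ≤ W' →
    (∀ x ∈ W', ∃ y ∈ W', ATilde.a • x = ATilde.b • y) → W' = ⊤

end ABModules

/-- A `[lam]`-primitive regular `(a,b)`-module: all the roots of the Bernstein polynomial of its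
saturation are in `-lam + ℤ`. -/
def IsPrimitive (lam : UnitRat) (E : Type) [AddCommGroup E] [Module ATilde E] : Prop :=
  IsABModule E ∧
  ∃ (W : Type) (_ : AddCommGroup W) (_ : Module ℂ W) (_ : Module ATilde W)
    (_ : IsScalarTower ℂ ATilde W) (j : E →ₗ[ATilde] W) (h : IsSaturation j),
    ∀ z : ℂ, (bernsteinPoly h.simplePole).IsRoot z → ∃ n : ℤ, z = -((lam : ℚ) : ℂ) + n

/-- A fresco: an `Ã`-module isomorphic to some `Ã φ ⊆ Ξ_Λ^(N) ⊗ V`, with `Λ` a finite set of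
rational numbers in `]0, 1]` and `V = ℂ ^ n`. -/
def IsFresco (E : Type) [AddCommGroup E] [Module ATilde E] : Prop :=
  ∃ (Λ : Finset UnitRat) (N n : ℕ) (φ : Fin n → (l : Λ) → Xi l N),
    Nonempty (E ≃ₗ[ATilde] (Submodule.span ATilde {φ} :
      Submodule ATilde (Fin n → (l : Λ) → Xi l N)))

/-- A semi-simple `(a,b)`-module: a submodule of a finite direct sum of regular `(a,b)`-modules of
rank `1`. -/
def IsSemiSimpleAB (E : Type) [AddCommGroup E] [Module ATilde E] : Prop :=
  ∃ (n : ℕ) (M : Fin n → ModuleCat.{0} ATilde),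
    (∀ i, IsRegularAB (M i) ∧ abRank (M i) = 1) ∧
      ∃ f : E →ₗ[ATilde] ((i : Fin n) → M i), Function.Injective f

/-- A normal submodule: `F ∩ b E = b F`. -/
def IsNormalSub {E : Type} [AddCommGroup E] [Module ATilde E] (F : Submodule ATilde E) : Prop :=
  {x : E | x ∈ F ∧ ∃ y : E, x = ATilde.b • y} = {x : E | ∃ y ∈ F, x = ATilde.b • y}

/-- The element `a - μ b`. -/
def aSub (μ : ℂ) : ATilde := ATilde.a - μ • ATilde.b

/-- The left module `Ã / Ã P`. -/
abbrev CyclicMod (P : ATilde) : Type := ATilde ⧸ (Submodule.span ATilde {P} : Submodule ATilde ATilde)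

/-- The rank `1` module `E_μ = Ã / Ã (a - μ b)`. -/
abbrev RankOne (μ : ℂ) : Type := CyclicMod (aSub μ)

/-- `F` is a principal Jordan-Hölder sequence of `E` with quotients `E_{μ_1}, …, E_{μ_k}`: it
is an increasing sequence of normal submodules, from `0` to `E`, with `F_j / F_{j-1} ≃ E_{μ_j}`,
and the sequence `μ_j + j` is non decreasing (the index of `μ` starts at `0` here). -/
structure IsPrincipalJH {E : Type} [AddCommGroup E] [Module ATilde E] {k : ℕ} (μ : Fin k → ℚ)
    (F : Fin (k + 1) → Submodule ATilde E) : Prop where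
  bot : F 0 = ⊥
  top : F (Fin.last k) = ⊤
  mono : Monotone F
  normal : ∀ j, IsNormalSub (F j)
  quot : ∀ j : Fin k, Nonempty
    ((F j.succ ⧸ (F j.castSucc).submoduleOf (F j.succ)) ≃ₗ[ATilde] RankOne ((μ j : ℚ) : ℂ))
  principal : Monotone fun j : Fin k => μ j + ((j : ℕ) : ℚ)

/-! ### The set of isomorphism classes -/

/-- Tuples `(μ_1, …, μ_r)`, `r = k + 2`, with `μ_{j+1} = μ_j + p_j - 1` for integers `p_j ≥ 1`. -/
structure Invariants (k : ℕ) where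
  val : Fin (k + 2) → ℚ
  step : ∀ j : Fin (k + 1), ∃ p : ℕ, 1 ≤ p ∧ val j.succ = val j.castSucc + p - 1

/-- From `(μ_1, …, μ_r)`, `r ≥ 3`, to `(μ_1, …, μ_{r-2}, μ_r + 1)`. -/
def Invariants.descend {k : ℕ} (t : Invariants (k + 1)) : Invariants k where
  val := Fin.snoc (α := fun _ => ℚ) (fun j : Fin (k + 1) => t.val j.castSucc.castSucc)
    (t.val (Fin.last (k + 2)) + 1)
  step := by
    intro j
    refine Fin.lastCases ?_ (fun i => ?_) j
    · obtain ⟨p, hp, h⟩ := t.step (Fin.last k).castSucc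
      obtain ⟨q, hq, h'⟩ := t.step (Fin.last (k + 1))
      refine ⟨p + q, by omega, ?_⟩
      rw [Fin.succ_last, Fin.snoc_last, Fin.snoc_castSucc]
      rw [Fin.succ_last] at h'
      rw [Fin.succ_castSucc, Fin.succ_last] at h
      rw [h', h]
      push_cast
      ring
    · obtain ⟨p, hp, h⟩ := t.step i.castSucc.castSucc
      refine ⟨p, hp, ?_⟩
      rw [Fin.succ_castSucc, Fin.snoc_castSucc, Fin.snoc_castSucc]
      rw [Fin.succ_castSucc, Fin.succ_castSucc] at h
      exact h

/-- Isomorphism of left `Ã`-modules. -/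
def isoSetoid : Setoid (ModuleCat.{0} ATilde) where
  r E E' := Nonempty (E ≃ₗ[ATilde] E')
  iseqv := ⟨fun _ => ⟨LinearEquiv.refl _ _⟩, fun ⟨e⟩ => ⟨e.symm⟩, fun ⟨e⟩ ⟨f⟩ => ⟨e.trans f⟩⟩

/-- Isomorphism classes of left `Ã`-modules. -/
abbrev IsoClass : Type 1 := Quotient isoSetoid

/-- The isomorphism class of a left `Ã`-module. -/
def isoClass (E : Type) [AddCommGroup E] [Module ATilde E] : IsoClass :=
  Quotient.mk isoSetoid (ModuleCat.of ATilde E)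

/-- `F₀(μ_1, …, μ_r)`: the isomorphism classes of `[lam]`-primitive frescos `E` with fundamental
invariants `μ_1, …, μ_r` such that `F_{r-1}` and `E / F_1` are semi-simple, where `F` is the
principal Jordan-Hölder sequence of `E`. -/
def F₀ (lam : UnitRat) {k : ℕ} (t : Invariants k) : Set IsoClass :=
  {c | ∃ E : ModuleCat.{0} ATilde, isoClass E = c ∧ IsFresco E ∧ IsPrimitive lam E ∧
    ∃ F : Fin (k + 3) → Submodule ATilde E, IsPrincipalJH t.val F ∧
      IsSemiSimpleAB (F (Fin.last (k + 1)).castSucc) ∧ IsSemiSimpleAB (E ⧸ F 1)}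

/-- The power series `1 + ∑ i, s_i b ^ (i + 1)`. -/
def unitSeries (s : ℕ → ℂ) : PowerSeries ℂ := 1 + PowerSeries.X * PowerSeries.mk s

/-- The element `P(s) = (a - μ_1 b) S_1(s)⁻¹ ⋯ (a - μ_r b) S_r(s)⁻¹` of `Ã`, where
`S_j(s) = 1 + ∑ i, s_{j,i} b ^ (i + 1)`. -/
def presentation {r : ℕ} (μ : Fin r → ℚ) (s : Fin r × ℕ → ℂ) : ATilde :=
  (List.ofFn fun j : Fin r =>
    aSub ((μ j : ℚ) : ℂ) * ATilde.ofB (unitSeries fun i => s (j, i))⁻¹).prod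

/-- A function on `F₀(μ_1, …, μ_r)` that depends polynomially on the isomorphism class: there is a
polynomial (so in finitely many of the variables `s_{j,i}`) whose value at `s` is the value of the
function on the class of `E(s) = Ã / Ã P(s)` whenever that class is in `F₀(μ_1, …, μ_r)`. -/
def DependsPolynomially {lam : UnitRat} {k : ℕ} {t : Invariants k} (f : F₀ lam t → ℂ) : Prop :=
  ∃ Q : MvPolynomial (Fin (k + 2) × ℕ) ℂ, ∀ (s : Fin (k + 2) × ℕ → ℂ)
    (h : isoClass (CyclicMod (presentation t.val s)) ∈ F₀ lam t),
    MvPolynomial.eval s Q = f ⟨_, h⟩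

end

/-! A homomorphism from a cyclic module E = Ã e to a module of formal series is the same as a series
annihilated by the annihilator of e; call it a solution. The series used here are ∑ u_m b^(ρ+m)
(`PowMod ρ`, a copy of E_ρ) and ∑ (u_m + v_m Log b) b^(ρ+m) (`LogMod ρ`). Write r = k + 2 and
λ_{j+1} = μ₀ + n_j - j. The condition p_j ≥ 1 says that 0 = n_0 < n_1 < ⋯ < n_{k+1}, and the
possible leading exponents of solutions are μ₀ - k - 1 + n_j.

Semi-simple means without logarithms. In a sum of regular modules of rank one, a homogeneous
operator b^N ∏ (b⁻¹a - ν) with distinct ν gains as many extra powers of b as desired. By Artin-Rees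
such a divisibility is a relation satisfied by every solution, and since ∏ (x - ν) has simple roots
it forces v_m = 0 (`IsSemiSimpleAB.snd_eq_zero`). Conversely, r solutions without logarithms, one
for each quotient of the filtration, embed E in a sum of modules of rank one.

Solutions are constructed along the filtration by solving one first order equation for each step; a
logarithm appears only at a resonance (`IsStepFiltration.exists_solution`). In F₀ the
semi-simplicity of F_{r-1} excludes logarithms until the last step, so the solution with lowest
exponent, normalised by u_0 = 1, has its first logarithm at the index n_{k+1} or later. Two
normalised solutions differ by one which vanishes on F_1, hence factors through the semi-simple
module E / F_1 and has no logarithm. So v_{n_{k+1}} depends on E only, and α is its quotient by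
`alphaFactor`. If it vanishes, the whole solution is free of logarithms and E is semi-simple.

For ii), applying a - (λ_{r-1} - 1) b to a normalised solution of E gives a solution for G_{r-1}:
the leading coefficient is multiplied by -n_{r-2} and the first logarithmic one by n_{r-1} -
n_{r-2}. `alphaFactor` is the product of these ratios, started in rank two, where the solution 1 - p
x b^p Log b gives iii).

Polynomiality is Frobenius' method. After cancelling the coefficients at the intermediate exponents,
the others are computed recursively, dividing only by values of the indicial polynomial, which do
not depend on s; its derivative at the last exponent gives the logarithmic term.

Uniqueness is an induction on r based on ii) and iii): in rank two every E has the form required in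
iii) (`exists_equiv_rankTwo`), and in rank at least three a generator as in ii) always exists
(`exists_split_generator`). -/

noncomputable section

/-! ### Sequence modules with constant residue -/

/-- The space of formal series `∑ y_m b ^ (m + R)`, where `R` is an endomorphism of `V`. -/
def SeqMod (V : Type) [AddCommGroup V] [Module ℂ V] (_R : Module.End ℂ V) : Type := ℕ → V

namespace SeqMod

variable {V : Type} [AddCommGroup V] [Module ℂ V] {R : Module.End ℂ V}

instance : AddCommGroup (SeqMod V R) := inferInstanceAs (AddCommGroup (ℕ → V))

instance : Module ℂ (SeqMod V R) := inferInstanceAs (Module ℂ (ℕ → V))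

/-- The operator `a` on `SeqMod V R`. -/
def opA (R : Module.End ℂ V) : Module.End ℂ (ℕ → V) where
  toFun y m := if m = 0 then 0 else ((m - 1 : ℕ) : ℂ) • y (m - 1) + R (y (m - 1))
  map_add' u v := by
    funext m
    by_cases h : m = 0
    · simp [h]
    · simp [h]; abel
  map_smul' c u := by
    funext m
    by_cases h : m = 0
    · simp [h]
    · simp [h, smul_comm c]

/-- The operator `b` on `SeqMod V R`. -/
def opB (V : Type) [AddCommGroup V] [Module ℂ V] : Module.End ℂ (ℕ → V) where
  toFun y m := if m = 0 then 0 else y (m - 1)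
  map_add' u v := by funext m; by_cases h : m = 0 <;> simp [h]
  map_smul' c u := by funext m; by_cases h : m = 0 <;> simp [h]

theorem isABPair (R : Module.End ℂ V) : IsABPair (opA R) (opB V) where
  comm := by
    refine LinearMap.ext fun y => funext fun m => ?_
    rcases m with _ | _ | m
    · simp [opA, opB]
    · simp [opA, opB]
    · simp [opA, opB, add_smul]
      abel
  filA n y hy m hm := by
    rcases m with _ | m
    · simp [opA]
    · simp [opA, hy m (by omega)]
  filB n y hy m hm := by
    rcases m with _ | m
    · simp [opB]
    · simpa [opB] using hy m (by omega)

instance : Module ATilde (SeqMod V R) where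
  smul u y := seriesAct (opA R) (opB V) u y
  one_smul y := congrArg (fun T => T y) (ATilde.act_one (opA R) (opB V))
  mul_smul u v y := congrArg (fun T => T y) ((isABPair R).act_act u v)
  smul_zero u := map_zero (seriesAct (opA R) (opB V) u)
  smul_add u y z := map_add (seriesAct (opA R) (opB V) u) y z
  add_smul u v y := congrArg (fun T => T y) (seriesAct_add (opA R) (opB V) u v)
  zero_smul y := by
    have h := congrArg (fun T => T y) (seriesAct_smul (opA R) (opB V) 0 0)
    rw [zero_smul, zero_smul] at h
    exact h

instance : IsScalarTower ℂ ATilde (SeqMod V R) where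
  smul_assoc c u y := congrArg (fun T => T y) (seriesAct_smul (opA R) (opB V) c u)

instance : SMulCommClass ATilde ℂ (SeqMod V R) where
  smul_comm u c y := map_smul (seriesAct (opA R) (opB V) u) c y

@[simp] theorem add_apply (y z : SeqMod V R) (m : ℕ) : (y + z) m = y m + z m := rfl
@[simp] theorem sub_apply (y z : SeqMod V R) (m : ℕ) : (y - z) m = y m - z m := rfl
@[simp] theorem zero_apply (m : ℕ) : (0 : SeqMod V R) m = 0 := rfl
@[simp] theorem smul_apply (c : ℂ) (y : SeqMod V R) (m : ℕ) : (c • y) m = c • y m := rfl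

theorem a_smul (y : SeqMod V R) : ATilde.a • y = opA R y := by
  have h := (isABPair R).act_leftA (1 : ATilde)
  rw [← ATilde.a_mul, ATilde.act_one, mul_one, mul_one] at h
  exact congrArg (fun T => T y) h

theorem b_smul (y : SeqMod V R) : ATilde.b • y = opB V y := by
  have h := (isABPair R).act_leftB (1 : ATilde)
  rw [← ATilde.b_mul, ATilde.act_one, mul_one, mul_one] at h
  exact congrArg (fun T => T y) h

@[simp] theorem b_smul_zero (y : SeqMod V R) : (ATilde.b • y) 0 = 0 := by
  rw [b_smul]; simp [opB]

@[simp] theorem b_smul_succ (y : SeqMod V R) (m : ℕ) : (ATilde.b • y) (m + 1) = y m := by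
  rw [b_smul]; simp [opB]

theorem aSub_smul (μ : ℂ) (y : SeqMod V R) :
    aSub μ • y = ATilde.a • y - μ • (ATilde.b • y) := by
  rw [aSub, sub_smul, smul_assoc]

@[simp] theorem aSub_smul_zero (μ : ℂ) (y : SeqMod V R) : (aSub μ • y) 0 = 0 := by
  rw [aSub_smul, sub_apply, smul_apply, b_smul_zero, a_smul]; simp [opA]

theorem aSub_smul_succ (μ : ℂ) (y : SeqMod V R) (m : ℕ) :
    (aSub μ • y) (m + 1) = ((m : ℂ) - μ) • y m + R (y m) := by
  rw [aSub_smul, sub_apply, smul_apply, b_smul_succ, a_smul]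
  simp [opA, sub_smul]
  abel

theorem opB_pow_apply (n : ℕ) (y : ℕ → V) (m : ℕ) :
    (opB V ^ n) y m = if n ≤ m then y (m - n) else 0 := by
  induction n generalizing m with
  | zero => simp
  | succ n ih =>
    rw [pow_succ', Module.End.mul_apply]
    rcases m with _ | m
    · simp [opB]
    · have : opB V ((opB V ^ n) y) (m + 1) = (opB V ^ n) y m := by simp [opB]
      rw [this, ih]
      simp

theorem b_pow_smul (n : ℕ) (y : SeqMod V R) (m : ℕ) :
    (ATilde.b ^ n • y) m = if n ≤ m then y (m - n) else 0 := by
  induction n generalizing m with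
  | zero => simp
  | succ n ih =>
    rw [pow_succ', mul_smul]
    rcases m with _ | m
    · simp
    · rw [b_smul_succ, ih]
      simp

theorem seriesAct_ofB (S : PowerSeries ℂ) (y : ℕ → V) (m : ℕ) :
    seriesAct (opA R) (opB V) (fun ν => C (PowerSeries.coeff ν S)) y m =
      ∑ ν ∈ Finset.range (m + 1), PowerSeries.coeff ν S • y (m - ν) := by
  change ∑ ν ∈ Finset.range (m + 1),
    (opB V ^ ν) (aeval (opA R) (C (PowerSeries.coeff ν S)) y) m = _
  refine Finset.sum_congr rfl fun ν hν => ?_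
  have : ν ≤ m := Nat.lt_succ_iff.mp (Finset.mem_range.mp hν)
  rw [aeval_C, Module.algebraMap_end_apply, opB_pow_apply, if_pos this]
  rfl

theorem ofB_smul_apply (S : PowerSeries ℂ) (y : SeqMod V R) (m : ℕ) :
    (ATilde.ofB S • y) m = ∑ ν ∈ Finset.range (m + 1), PowerSeries.coeff ν S • y (m - ν) :=
  seriesAct_ofB S y m

theorem ofB_smul_zero (S : PowerSeries ℂ) (y : SeqMod V R) :
    (ATilde.ofB S • y) 0 = PowerSeries.constantCoeff S • y 0 := by
  rw [ofB_smul_apply]; simp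

/-- Respecting the order of vanishing is the continuity of `T`: the coefficient of index m only sees
the partial sum up to b^m, and on finite sums commutation with a and b is enough. -/
theorem map_seriesAct {V' : Type} [AddCommGroup V'] [Module ℂ V'] {R' : Module.End ℂ V'}
    (T : (ℕ → V) →ₗ[ℂ] (ℕ → V'))
    (hA : ∀ y, T (opA R y) = opA R' (T y)) (hB : ∀ y, T (opB V y) = opB V' (T y))
    (hT : ∀ (n : ℕ) (y : ℕ → V), (∀ m < n, y m = 0) → ∀ m < n, T y m = 0)
    (u : ℕ → ℂ[X]) (y : ℕ → V) :
    T (seriesAct (opA R) (opB V) u y) = seriesAct (opA R') (opB V') u (T y) := by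
  have hBn : ∀ n y, T ((opB V ^ n) y) = (opB V' ^ n) (T y) := by
    intro n
    induction n with
    | zero => simp
    | succ n ih => intro y; rw [pow_succ', pow_succ', Module.End.mul_apply, hB, ih]; rfl
  have hAn : ∀ (n : ℕ) y, T ((opA R ^ n) y) = (opA R' ^ n) (T y) := by
    intro n
    induction n with
    | zero => simp
    | succ n ih => intro y; rw [pow_succ', pow_succ', Module.End.mul_apply, hA, ih]; rfl
  have hq : ∀ (q : ℂ[X]) y, T (aeval (opA R) q y) = aeval (opA R') q (T y) := by
    intro q y
    induction q using Polynomial.induction_on' with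
    | add p q hp hq => simp [hp, hq]
    | monomial n c => simp [aeval_monomial, hAn]
  funext m
  have key : T (seriesAct (opA R) (opB V) u y -
      ∑ ν ∈ Finset.range (m + 1), (opB V ^ ν) (aeval (opA R) (u ν) y)) m = 0 := by
    refine hT (m + 1) _ (fun i hi => ?_) m (by omega)
    rw [Pi.sub_apply, (isABPair R).seriesAct_apply u y hi, sub_self]
  rw [map_sub, Pi.sub_apply, sub_eq_zero] at key
  rw [key, map_sum, (isABPair R').seriesAct_apply u _ (Nat.lt_succ_self m)]
  exact congrFun (Finset.sum_congr rfl fun ν _ => by rw [hBn, hq]) m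

/-- An operator commuting with `a` and `b` and respecting the order of vanishing commutes with
the whole algebra. -/
def mkLinear {V' : Type} [AddCommGroup V'] [Module ℂ V'] {R' : Module.End ℂ V'}
    (T : (ℕ → V) →ₗ[ℂ] (ℕ → V'))
    (hA : ∀ y, T (opA R y) = opA R' (T y)) (hB : ∀ y, T (opB V y) = opB V' (T y))
    (hT : ∀ (n : ℕ) (y : ℕ → V), (∀ m < n, y m = 0) → ∀ m < n, T y m = 0) :
    SeqMod V R →ₗ[ATilde] SeqMod V' R' where
  toFun := T
  map_add' := map_add T
  map_smul' u y := map_seriesAct T hA hB hT u y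

end SeqMod

/-! ### Constant terms and leading coefficients -/

namespace ATilde

/-- The coefficient of `a ^ 0 b ^ 0`. -/
def const (u : ATilde) : ℂ := Polynomial.coeff (u 0) 0

end ATilde

namespace SeqMod

variable {V : Type} [AddCommGroup V] [Module ℂ V] {R : Module.End ℂ V}

/-- In `SeqMod` the operator a also raises the order of vanishing, so every monomial of u other than
the constant one contributes only beyond the index m. This is the tool for comparing leading terms.
-/
theorem seriesAct_apply_of_vanish (u : ATilde) (y : ℕ → V) (m : ℕ) (h : ∀ i < m, y i = 0) :
    (∀ i < m, seriesAct (opA R) (opB V) u y i = 0) ∧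
      seriesAct (opA R) (opB V) u y m = u.const • y m := by
  have hpow : ∀ n : ℕ, (∀ i < m, (opA R ^ n) y i = 0) ∧
      (opA R ^ (n + 1)) y m = 0 := by
    intro n
    induction n with
    | zero =>
      refine ⟨by simpa using h, ?_⟩
      rw [zero_add, pow_one]
      rcases m with _ | m
      · simp [opA]
      · simp [opA, h m (by omega)]
    | succ n ih =>
      have h1 : ∀ i < m, (opA R ^ (n + 1)) y i = 0 := by
        intro i hi
        rw [pow_succ', Module.End.mul_apply]
        exact (isABPair R).filA m _ ih.1 i hi
      refine ⟨h1, ?_⟩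
      rw [pow_succ', Module.End.mul_apply]
      generalize (opA R ^ (n + 1)) y = z at h1
      rcases m with _ | m
      · simp [opA]
      · simp [opA, h1 m (by omega)]
  have haev : ∀ q : ℂ[X], (∀ i < m, aeval (opA R) q y i = 0) ∧
      aeval (opA R) q y m = q.coeff 0 • y m := by
    intro q
    induction q using Polynomial.induction_on' with
    | add p q hp hq =>
      refine ⟨fun i hi => ?_, ?_⟩
      · rw [map_add, LinearMap.add_apply, Pi.add_apply, hp.1 i hi, hq.1 i hi, add_zero]
      · rw [map_add, LinearMap.add_apply, Pi.add_apply, hp.2, hq.2, coeff_add, add_smul]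
    | monomial n c =>
      refine ⟨fun i hi => ?_, ?_⟩
      · rw [aeval_monomial, Module.End.mul_apply, Module.algebraMap_end_apply, Pi.smul_apply,
          (hpow n).1 i hi, smul_zero]
      · rcases n with _ | n
        · rw [aeval_monomial, Module.End.mul_apply, Module.algebraMap_end_apply]
          simp
        · rw [aeval_monomial, Module.End.mul_apply, Module.algebraMap_end_apply, Pi.smul_apply,
            (hpow n).2, smul_zero, coeff_monomial, if_neg (by omega), zero_smul]
  have hterm : ∀ i ≤ m, ∀ ν, 0 < ν → (opB V ^ ν) (aeval (opA R) (u ν) y) i = 0 := by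
    intro i hi ν hν
    rw [opB_pow_apply]
    split_ifs with h'
    · exact (haev _).1 _ (by omega)
    · rfl
  have hsum : ∀ i ≤ m, seriesAct (opA R) (opB V) u y i = aeval (opA R) (u 0) y i := by
    intro i hi
    change ∑ ν ∈ Finset.range (i + 1), (opB V ^ ν) (aeval (opA R) (u ν) y) i = _
    rw [Finset.sum_range_succ', Finset.sum_eq_zero, zero_add, pow_zero]
    · rfl
    · intro ν _
      exact hterm i hi _ (by omega)
  exact ⟨fun i hi => by rw [hsum i hi.le]; exact (haev _).1 i hi,
    by rw [hsum m le_rfl]; exact (haev _).2⟩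

theorem smul_apply_of_vanish (u : ATilde) (y : SeqMod V R) (m : ℕ) (h : ∀ i < m, y i = 0) :
    (∀ i < m, (u • y) i = 0) ∧ (u • y) m = u.const • y m :=
  seriesAct_apply_of_vanish u y m h

end SeqMod

/-- The module `⨁ ℂ b ^ (ρ + m)`. -/
abbrev PowMod (ρ : ℂ) : Type := SeqMod ℂ (ρ • 1)

/-- The residue `(u, v) ↦ (ρ u + v, ρ v)`. -/
def logResidue (ρ : ℂ) : Module.End ℂ (ℂ × ℂ) :=
  ρ • 1 + LinearMap.inl ℂ ℂ ℂ ∘ₗ LinearMap.snd ℂ ℂ ℂ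

theorem logResidue_apply (ρ : ℂ) (y : ℂ × ℂ) :
    logResidue ρ y = (ρ * y.1 + y.2, ρ * y.2) := by
  ext <;> simp [logResidue]

/-- The module of the series `∑ (u_m + v_m Log b) b ^ (ρ + m)`. -/
abbrev LogMod (ρ : ℂ) : Type := SeqMod (ℂ × ℂ) (logResidue ρ)

namespace LogMod

variable {ρ : ℂ}

theorem aSub_smul_succ (μ : ℂ) (y : LogMod ρ) (m : ℕ) :
    (aSub μ • y) (m + 1) =
      ((ρ + m - μ) * (y m).1 + (y m).2, (ρ + m - μ) * (y m).2) := by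
  rw [SeqMod.aSub_smul_succ, logResidue_apply]
  ext <;> simp <;> ring

/-- The part without logarithms. -/
def inl (ρ : ℂ) : PowMod ρ →ₗ[ATilde] LogMod ρ :=
  SeqMod.mkLinear
    { toFun := fun y m => (y m, 0)
      map_add' := fun y z => by funext m; simp
      map_smul' := fun c y => by funext m; simp }
    (fun y => by
      funext m; rcases m with _ | m <;> simp [SeqMod.opA, logResidue_apply])
    (fun y => by
      funext m; rcases m with _ | m <;> simp [SeqMod.opB])
    (fun n y hy m hm => by simp [hy m hm])

@[simp] theorem inl_apply (y : PowMod ρ) (m : ℕ) : inl ρ y m = (y m, 0) := rfl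

/-- The coefficient of the logarithm. -/
def snd (ρ : ℂ) : LogMod ρ →ₗ[ATilde] PowMod ρ :=
  SeqMod.mkLinear
    { toFun := fun y m => (y m).2
      map_add' := fun y z => by funext m; simp
      map_smul' := fun c y => by funext m; simp }
    (fun y => by
      funext m; rcases m with _ | m <;> simp [SeqMod.opA, logResidue_apply])
    (fun y => by
      funext m; rcases m with _ | m <;> simp [SeqMod.opB])
    (fun n y hy m hm => by simp [hy m hm])

@[simp] theorem snd_apply (y : LogMod ρ) (m : ℕ) : snd ρ y m = (y m).2 := rfl

/-- Multiplication by `b ^ n`, seen as an inclusion. -/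
def shift {ρ ρ' : ℂ} (n : ℕ) (h : ρ = ρ' + n) : LogMod ρ →ₗ[ATilde] LogMod ρ' :=
  SeqMod.mkLinear
    { toFun := fun y m => if n ≤ m then y (m - n) else 0
      map_add' := fun y z => by funext m; by_cases h : n ≤ m <;> simp [h]
      map_smul' := fun c y => by funext m; by_cases h : n ≤ m <;> simp [h] }
    (fun y => by
      funext m
      rcases m with _ | m
      · simp [SeqMod.opA]
      · by_cases h1 : n ≤ m
        · have h2 : n ≤ m + 1 := by omega
          have h3 : m + 1 - n - 1 = m - n := by omega
          have h4 : m + 1 - n ≠ 0 := by omega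
          simp [SeqMod.opA, logResidue_apply, h1, h2, h3, h4, h, Nat.cast_sub, Prod.ext_iff]
          constructor <;> ring
        · have h4 : m + 1 - n = 0 := by omega
          simp [SeqMod.opA, logResidue_apply, h1, h4, Prod.ext_iff])
    (fun y => by
      funext m
      rcases m with _ | m
      · simp [SeqMod.opB]
      · by_cases h1 : n ≤ m
        · have h2 : n ≤ m + 1 := by omega
          have h3 : m + 1 - n - 1 = m - n := by omega
          have h4 : m + 1 - n ≠ 0 := by omega
          simp [SeqMod.opB, h1, h2, h3, h4]
        · have h4 : m + 1 - n = 0 := by omega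
          simp [SeqMod.opB, h1, h4])
    (fun k y hy m hm => by
      by_cases h1 : n ≤ m
      · simpa [h1] using hy (m - n) (by omega)
      · simp [h1])

theorem shift_apply {ρ ρ' : ℂ} (n : ℕ) (h : ρ = ρ' + n) (y : LogMod ρ) (m : ℕ) :
    shift n h y m = if n ≤ m then y (m - n) else 0 := rfl

theorem shift_injective {ρ ρ' : ℂ} (n : ℕ) (h : ρ = ρ' + n) :
    Function.Injective (shift n h) := by
  intro y z hyz
  funext m
  have := congrFun hyz (m + n)
  simpa [shift_apply] using this

theorem eq_inl_of_snd_eq_zero (y : LogMod ρ) (h : ∀ m, (y m).2 = 0) :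
    y = inl ρ (fun m => (y m).1) := by
  funext m
  exact Prod.ext rfl (h m)

end LogMod

theorem PowMod.aSub_smul_succ {ρ : ℂ} (μ : ℂ) (y : PowMod ρ) (m : ℕ) :
    (aSub μ • y) (m + 1) = (ρ + m - μ) * y m := by
  rw [SeqMod.aSub_smul_succ]
  simp
  ring

/-! ### Division in `Ã` -/

namespace ATilde

theorem b_eq_ofB : b = ofB PowerSeries.X := by
  funext m
  change (Pi.single 1 1 : ℕ → ℂ[X]) m = C (PowerSeries.coeff m (PowerSeries.X : PowerSeries ℂ))
  rw [PowerSeries.coeff_X]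
  by_cases hm : m = 1 <;> simp [hm]

theorem const_mul (u v : ATilde) : (u * v).const = u.const * v.const := by
  -- Any series with nonzero coefficient of index 0 would do: elements of Ã act on that coefficient
  -- through their constant terms.
  let δ : PowMod 0 := fun _ => 1
  have h := fun (w : ATilde) (y : PowMod 0) =>
    (SeqMod.smul_apply_of_vanish w y 0 (by simp)).2
  have h1 := h (u * v) δ
  rw [mul_smul, h, h] at h1
  simpa [δ] using h1.symm

theorem const_add (u v : ATilde) : (u + v).const = u.const + v.const :=
  coeff_add (u 0) (v 0) 0

theorem const_sub (u v : ATilde) : (u - v).const = u.const - v.const :=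
  coeff_sub (u 0) (v 0) 0

theorem const_smul (c : ℂ) (u : ATilde) : (c • u).const = c * u.const :=
  coeff_smul c (u 0) 0

theorem const_ofB (S : PowerSeries ℂ) : (ofB S).const = PowerSeries.constantCoeff S := by
  change (C (PowerSeries.coeff 0 S)).coeff 0 = _
  simp

theorem const_one : (1 : ATilde).const = 1 := by
  rw [← map_one ofB, const_ofB, map_one]

theorem const_aSub (μ : ℂ) : (aSub μ).const = 0 := by
  have ha : a.const = 0 := by
    change ((Pi.single 0 X : ℕ → ℂ[X]) 0).coeff 0 = 0
    simp
  have hb : b.const = 0 := by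
    rw [b_eq_ofB, const_ofB]; simp
  rw [aSub, const_sub, const_smul, ha, hb]
  simp

theorem mul_zero_coord (u v : ATilde) : (u * v) 0 = u 0 * v 0 := by
  have hA : ∀ (q : ℂ[X]) (w : ℕ → ℂ[X]), aeval leftA q w 0 = q * w 0 := by
    intro q w
    induction q using Polynomial.induction_on' with
    | add p q hp hq => simp [hp, hq, add_mul]
    | monomial n c =>
      have : ∀ n : ℕ, (leftA ^ n) w 0 = X ^ n * w 0 := by
        intro n
        induction n with
        | zero => simp
        | succ n ih => 
          rw [pow_succ', Module.End.mul_apply]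
          have : leftA ((leftA ^ n) w) 0 = X * (leftA ^ n) w 0 := by simp [leftA]
          rw [this, ih, pow_succ']
          ring
      rw [aeval_monomial, Module.End.mul_apply, Module.algebraMap_end_apply, Pi.smul_apply, this,
        ← C_mul_X_pow_eq_monomial, smul_eq_C_mul, mul_assoc]
  rw [mul_def]
  change ∑ ν ∈ Finset.range (0 + 1), (leftB ^ ν) (aeval leftA (u ν) v) 0 = _
  rw [Finset.sum_range_succ, Finset.sum_range_zero, zero_add, pow_zero]
  exact hA (u 0) v

/-- A sequence of polynomials as an element of `Ã`. -/
def ofSeq (u : ℕ → ℂ[X]) : ATilde := u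

/-- A polynomial in `a`. -/
def ofA (q : ℂ[X]) : ATilde := ofSeq (Pi.single 0 q)

theorem b_mul_succ (u : ATilde) (m : ℕ) : (b * u) (m + 1) = u m := by
  rw [b_mul]; simp [leftB]

theorem b_mul_zero (u : ATilde) : (b * u) 0 = 0 := by
  rw [b_mul]; simp [leftB]

theorem eq_b_mul_of_zero_coord (u : ATilde) (h : u 0 = 0) :
    u = b * ofSeq fun m => u (m + 1) := by
  funext m
  rcases m with _ | m
  · rw [b_mul_zero, h]
  · rw [b_mul_succ]; rfl

/-- `a S(b) = S(b) a + b² S'(b)`. -/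
theorem a_mul_ofB (S : PowerSeries ℂ) :
    a * ofB S = ofB S * a +
      ofB (PowerSeries.mk fun m => ((m - 1 : ℕ) : ℂ) * PowerSeries.coeff (m - 1) S) := by
  have h1 : ∀ m, (ofB S * a) m = C (PowerSeries.coeff m S) * X := by
    intro m
    rw [mul_def]
    change ∑ ν ∈ Finset.range (m + 1),
      (leftB ^ ν) (aeval leftA (C (PowerSeries.coeff ν S)) (Pi.single 0 X : ℕ → ℂ[X])) m = _
    simp only [aeval_leftA_single, leftB_pow_single]
    rw [Finset.sum_eq_single m]
    · simp
    · intro i _ hi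
      simp [hi.symm]
    · simp
  funext m
  rw [a_mul]
  change X * C (PowerSeries.coeff m S) + ((m - 1 : ℕ) : ℂ) • C (PowerSeries.coeff (m - 1) S) =
    (ofB S * a) m + C (PowerSeries.coeff m
      (PowerSeries.mk fun m => ((m - 1 : ℕ) : ℂ) * PowerSeries.coeff (m - 1) S))
  rw [h1, PowerSeries.coeff_mk, smul_eq_C_mul]
  simp [mul_comm X]

theorem ofB_C (c : ℂ) : ofB (PowerSeries.C c) = algebraMap ℂ ATilde c := by
  rw [Algebra.algebraMap_eq_smul_one]
  funext m
  change C (PowerSeries.coeff m (PowerSeries.C c)) = c • (Pi.single 0 1 : ℕ → ℂ[X]) m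
  rw [PowerSeries.coeff_C]
  by_cases hm : m = 0 <;> simp [hm, smul_eq_C_mul]

/-- The correction term is b² S' + (ν - μ) b S, from a S = S a + b² S'. The parameter ν is free, so
that the factor left on the right can be chosen to kill a given vector. -/
theorem aSub_mul_ofB (μ ν : ℂ) (S : PowerSeries ℂ) :
    aSub μ * ofB S = ofB S * aSub ν + ofB (PowerSeries.mk fun m =>
      if m = 0 then 0 else (((m - 1 : ℕ) : ℂ) + ν - μ) * PowerSeries.coeff (m - 1) S) := by
  have h : (PowerSeries.mk fun m =>
      if m = 0 then 0 else (((m - 1 : ℕ) : ℂ) + ν - μ) * PowerSeries.coeff (m - 1) S) =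
      (PowerSeries.mk fun m => ((m - 1 : ℕ) : ℂ) * PowerSeries.coeff (m - 1) S) +
        PowerSeries.C (ν - μ) * (PowerSeries.X * S) := by
    ext m
    rcases m with _ | m
    · simp
    · rw [map_add, PowerSeries.coeff_C_mul, PowerSeries.coeff_succ_X_mul]
      simp
      ring
  have hb : b * ofB S = ofB S * b := by
    rw [b_eq_ofB, ← map_mul, ← map_mul, mul_comm]
  rw [h, map_add, map_mul, map_mul, ofB_C, ← b_eq_ofB, ← add_assoc, aSub, aSub, sub_mul, a_mul_ofB,
    mul_sub, ← Algebra.smul_def, mul_smul_comm, smul_mul_assoc, hb, sub_smul]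
  abel

/-- Right division by `a - μ b`. -/
theorem exists_eq_mul_aSub_add (μ : ℂ) (u : ATilde) :
    ∃ (q : ATilde) (S : PowerSeries ℂ), u = q * aSub μ + ofB S := by
  -- Modulo b the division by a - μ b is the division of a polynomial by X; what remains is a
  -- multiple of b.
  have step : ∀ u : ATilde, ∃ (q : ℂ[X]) (c : ℂ) (u' : ATilde),
      u = ofA q * aSub μ + ofB (PowerSeries.C c) + b * u' := by
    intro u
    refine ⟨divX (u 0), (u 0).coeff 0, _, sub_eq_iff_eq_add'.mp
      (eq_b_mul_of_zero_coord (u - (ofA (divX (u 0)) * aSub μ +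
        ofB (PowerSeries.C ((u 0).coeff 0)))) ?_)⟩
    have h1 : (ofA (divX (u 0)) * aSub μ) 0 =
        divX (u 0) * X := by
      rw [mul_zero_coord]
      change (Pi.single 0 (divX (u 0)) : ℕ → ℂ[X]) 0 *
        ((Pi.single 0 X : ℕ → ℂ[X]) 0 - μ • (Pi.single 1 1 : ℕ → ℂ[X]) 0) = _
      simp
    change u 0 - ((ofA (divX (u 0)) * aSub μ) 0 +
        C (PowerSeries.coeff 0 (PowerSeries.C ((u 0).coeff 0)))) = 0
    rw [h1]
    have := divX_mul_X_add (u 0)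
    simp only [PowerSeries.coeff_zero_C]
    rw [this, sub_self]
  choose Q c next hstep using step
  -- The quotient and the remainder collect all the successive partial quotients and constants; `q
  -- n` and `S n` do so for the tail starting at `w n`.
  let w : ℕ → ATilde := fun n => next^[n] u
  have hw : ∀ n, w (n + 1) = next (w n) := fun n => Function.iterate_succ_apply' next n u
  let q : ℕ → ATilde := fun n => ofSeq fun m => Q (w (n + m))
  let S : ℕ → PowerSeries ℂ := fun n => PowerSeries.mk fun m => c (w (n + m))
  have hq : ∀ n, q n = ofA (Q (w n)) + b * q (n + 1) := by
    intro n
    funext m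
    change q n m = (Pi.single 0 (Q (w n)) : ℕ → ℂ[X]) m + (b * q (n + 1)) m
    rcases m with _ | m
    · rw [b_mul_zero]; simp [q, ofSeq]
    · rw [b_mul_succ]
      simp only [q, ofSeq, Pi.single_eq_of_ne (Nat.succ_ne_zero m), zero_add]
      rw [add_assoc, add_comm 1 m]
  have hS : ∀ n, S n = PowerSeries.C (c (w n)) + PowerSeries.X * S (n + 1) := by
    intro n
    ext m
    rcases m with _ | m
    · simp [S]
    · simp only [S, PowerSeries.coeff_mk, map_add, PowerSeries.coeff_succ_X_mul,
        PowerSeries.coeff_C, if_neg (Nat.succ_ne_zero m), zero_add]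
      rw [add_assoc, add_comm 1 m]
  -- Each error is b times the next one, hence divisible by every power of b, hence zero.
  have herr : ∀ n, w n - (q n * aSub μ + ofB (S n)) =
      b * (w (n + 1) - (q (n + 1) * aSub μ + ofB (S (n + 1)))) := by
    intro n
    have h1 := hstep (w n)
    rw [← hw] at h1
    rw [hq n, hS n, map_add, map_mul, ← b_eq_ofB, add_mul, mul_sub, mul_add, ← mul_assoc b]
    nth_rewrite 1 [h1]
    abel
  have hzero : ∀ m n, (w n - (q n * aSub μ + ofB (S n))) m = 0 := by
    intro m
    induction m with
    | zero => intro n; rw [herr, b_mul_zero]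
    | succ m ih => intro n; rw [herr, b_mul_succ, ih]
  refine ⟨q 0, S 0, sub_eq_zero.mp (funext fun m => hzero m 0)⟩

theorem ofB_inv_mul {S : PowerSeries ℂ} (h : PowerSeries.constantCoeff S ≠ 0) :
    ofB S⁻¹ * ofB S = 1 := by
  rw [← map_mul, PowerSeries.inv_mul_cancel S h, map_one]

theorem ofB_mul_inv {S : PowerSeries ℂ} (h : PowerSeries.constantCoeff S ≠ 0) :
    ofB S * ofB S⁻¹ = 1 := by
  rw [← map_mul, PowerSeries.mul_inv_cancel S h, map_one]

end ATilde

open ATilde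

/-- The element `b ^ ρ` of `PowMod ρ`. -/
def PowMod.gen (ρ : ℂ) : PowMod ρ := (Pi.single 0 1 : ℕ → ℂ)

namespace PowMod

theorem ofB_smul_gen (ρ : ℂ) (S : PowerSeries ℂ) (m : ℕ) :
    (ofB S • gen ρ) m = PowerSeries.coeff m S := by
  rw [SeqMod.ofB_smul_apply, Finset.sum_eq_single m]
  · rw [Nat.sub_self]
    change PowerSeries.coeff m S * (Pi.single 0 1 : ℕ → ℂ) 0 = _
    simp
  · intro i hi him
    have h1 : m - i ≠ 0 := by
      have := Finset.mem_range.mp hi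
      omega
    change PowerSeries.coeff i S * (Pi.single 0 1 : ℕ → ℂ) (m - i) = 0
    simp [h1]
  · simp

theorem aSub_smul_gen (ρ : ℂ) : aSub ρ • gen ρ = 0 := by
  funext m
  rcases m with _ | m
  · exact SeqMod.aSub_smul_zero _ _
  · rw [aSub_smul_succ]
    change (ρ + m - ρ) * (Pi.single 0 1 : ℕ → ℂ) m = 0
    rcases m with _ | m <;> simp

/-- After division by a - ρ b only a series in b acts on b^ρ, and it acts freely. So the submodule
generated by b^ρ is E_ρ. -/
theorem smul_gen_eq_zero_iff (ρ : ℂ) (u : ATilde) :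
    u • gen ρ = 0 ↔ ∃ q, u = q * aSub ρ := by
  constructor
  · intro h
    obtain ⟨q, S, rfl⟩ := exists_eq_mul_aSub_add ρ u
    rw [add_smul, mul_smul, aSub_smul_gen, smul_zero, zero_add] at h
    have : S = 0 := by
      ext m
      rw [← ofB_smul_gen ρ S m, h]
      simp
    exact ⟨q, by rw [this, map_zero, add_zero]⟩
  · rintro ⟨q, rfl⟩
    rw [mul_smul, aSub_smul_gen, smul_zero]

end PowMod

/-! ### Steps of a filtration -/

section Steps

variable {E : Type} [AddCommGroup E] [Module ATilde E]

/-- `F ≤ F'` and `F' / F` is isomorphic to `Ã / Ã (a - μ b)`. -/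
def IsStep (F F' : Submodule ATilde E) (μ : ℂ) : Prop :=
  F ≤ F' ∧ ∃ h ∈ F', (∀ x ∈ F', ∃ u : ATilde, x - u • h ∈ F) ∧
    ∀ u : ATilde, u • h ∈ F ↔ ∃ q, u = q * aSub μ

theorem mem_cyclic_iff {P u : ATilde} :
    (Submodule.Quotient.mk u : CyclicMod P) = 0 ↔ ∃ q, u = q * P := by
  rw [Submodule.Quotient.mk_eq_zero, Submodule.mem_span_singleton]
  exact ⟨fun ⟨q, h⟩ => ⟨q, h.symm⟩, fun ⟨q, h⟩ => ⟨q, h.symm⟩⟩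

theorem isStep_of_equiv {F F' : Submodule ATilde E} {μ : ℂ} (hF : F ≤ F')
    (f : (F' ⧸ F.submoduleOf F') ≃ₗ[ATilde] RankOne μ) : IsStep F F' μ := by
  obtain ⟨⟨h, hh⟩, hf⟩ := Submodule.Quotient.mk_surjective _
    (f.symm (Submodule.Quotient.mk (1 : ATilde)))
  have key : ∀ u : ATilde, f (Submodule.Quotient.mk (u • (⟨h, hh⟩ : F'))) =
      Submodule.Quotient.mk u := by
    intro u
    rw [Submodule.Quotient.mk_smul, map_smul, hf, LinearEquiv.apply_symm_apply,
      ← Submodule.Quotient.mk_smul, smul_eq_mul, mul_one]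
  refine ⟨hF, h, hh, fun x hx => ?_, fun u => ?_⟩
  · obtain ⟨u, hu⟩ := Submodule.Quotient.mk_surjective _
      (f (Submodule.Quotient.mk (⟨x, hx⟩ : F')))
    rw [← key u] at hu
    have := f.injective hu
    rw [eq_comm, Submodule.Quotient.eq] at this
    exact ⟨u, this⟩
  · rw [← mem_cyclic_iff, ← key u, LinearEquiv.map_eq_zero_iff, Submodule.Quotient.mk_eq_zero]
    rfl

theorem IsStep.nonempty_equiv {F F' : Submodule ATilde E} {μ : ℂ} (h : IsStep F F' μ) :
    Nonempty ((F' ⧸ F.submoduleOf F') ≃ₗ[ATilde] RankOne μ) := by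
  obtain ⟨-, h, hh, h1, h2⟩ := h
  let g : ATilde →ₗ[ATilde] (F' ⧸ F.submoduleOf F') :=
    (F.submoduleOf F').mkQ ∘ₗ LinearMap.toSpanSingleton ATilde F' ⟨h, hh⟩
  have hg : ∀ u, g u = Submodule.Quotient.mk (u • (⟨h, hh⟩ : F')) := fun u => rfl
  have hsurj : Function.Surjective g := by
    intro y
    obtain ⟨⟨x, hx⟩, rfl⟩ := Submodule.Quotient.mk_surjective _ y
    obtain ⟨u, hu⟩ := h1 x hx
    refine ⟨u, ?_⟩
    rw [hg, eq_comm, Submodule.Quotient.eq]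
    exact hu
  have hker : LinearMap.ker g = Submodule.span ATilde {aSub μ} := by
    ext u
    rw [LinearMap.mem_ker, hg, Submodule.Quotient.mk_eq_zero, Submodule.mem_span_singleton]
    change u • h ∈ F ↔ _
    rw [h2]
    exact ⟨fun ⟨q, h⟩ => ⟨q, h.symm⟩, fun ⟨q, h⟩ => ⟨q, h.symm⟩⟩
  exact ⟨((Submodule.quotEquivOfEq _ _ hker.symm).trans
    (g.quotKerEquivOfSurjective hsurj)).symm⟩

/-- A generator of the larger submodule of a step. -/
theorem IsStep.exists_series {F F' : Submodule ATilde E} {μ : ℂ} (h : IsStep F F' μ) {e : E}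
    (he : Submodule.span ATilde {e} = F') :
    ∃ S : PowerSeries ℂ, PowerSeries.constantCoeff S ≠ 0 ∧
      (∀ u : ATilde, u • e ∈ F ↔ ∃ q, u = q * (aSub μ * ofB S)) ∧
      (aSub μ * ofB S) • e ∈ F ∧ Submodule.span ATilde {(aSub μ * ofB S) • e} = F := by
  obtain ⟨hF, h, hh, h1, h2⟩ := h
  have heF : e ∈ F' := he ▸ Submodule.mem_span_singleton_self e
  obtain ⟨w, hw⟩ := h1 e heF
  obtain ⟨q₀, T, rfl⟩ := exists_eq_mul_aSub_add μ w
  have hT : e - ofB T • h ∈ F := by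
    have h3 : (q₀ * aSub μ) • h ∈ F := (h2 _).mpr ⟨q₀, rfl⟩
    have := F.add_mem hw h3
    rwa [add_smul, sub_add_eq_add_sub, add_comm ((q₀ * aSub μ) • h), add_sub_add_right_eq_sub]
      at this
  have huT : ∀ u : ATilde, u • e ∈ F ↔ ∃ q, u * ofB T = q * aSub μ := by
    intro u
    rw [← h2, mul_smul]
    have := F.smul_mem u hT
    rw [smul_sub] at this
    constructor
    · intro h4
      have := F.sub_mem h4 this
      rwa [sub_sub_cancel] at this
    · intro h4
      have := F.add_mem this h4
      rwa [sub_add_cancel] at this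
  -- Write h = v e. Since e ≡ T h modulo F, v T - 1 sends h into F and is therefore a left multiple
  -- of a - μ b, with constant term 0. If T(0) = 0 its constant term would be -1.
  have hT0 : PowerSeries.constantCoeff T ≠ 0 := by
    intro h0
    rw [← he, Submodule.mem_span_singleton] at hh
    obtain ⟨v, rfl⟩ := hh
    have h5 : (v * ofB T - 1) • (v • e) ∈ F := by
      have := F.smul_mem v hT
      rw [smul_sub] at this
      rw [sub_smul, one_smul, mul_smul]
      have := F.neg_mem this
      rwa [neg_sub] at this
    obtain ⟨q, hq⟩ := (h2 _).mp h5
    have := congrArg const hq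
    rw [const_sub, const_mul, const_mul, const_ofB, h0, const_aSub, const_one] at this
    simp at this
  have hS0 : PowerSeries.constantCoeff T⁻¹ ≠ 0 := by
    rw [PowerSeries.constantCoeff_inv]
    exact inv_ne_zero hT0
  have key : ∀ u : ATilde, u • e ∈ F ↔ ∃ q, u = q * (aSub μ * ofB T⁻¹) := by
    intro u
    rw [huT]
    constructor
    · rintro ⟨q, hq⟩
      refine ⟨q, ?_⟩
      rw [← mul_assoc, ← hq, mul_assoc, ofB_mul_inv hT0, mul_one]
    · rintro ⟨q, rfl⟩
      refine ⟨q, ?_⟩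
      rw [mul_assoc, mul_assoc, ofB_inv_mul hT0, mul_one]
  have hmem : (aSub μ * ofB T⁻¹) • e ∈ F := (key _).mpr ⟨1, by rw [one_mul]⟩
  refine ⟨T⁻¹, hS0, key, hmem, le_antisymm ?_ ?_⟩
  · rw [Submodule.span_singleton_le_iff_mem]
    exact hmem
  · intro x hx
    have hx' := hF hx
    rw [← he, Submodule.mem_span_singleton] at hx'
    obtain ⟨u, rfl⟩ := hx'
    obtain ⟨q, rfl⟩ := (key u).mp hx
    exact Submodule.mem_span_singleton.mpr ⟨q, (mul_smul _ _ _).symm⟩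

/-- The solution is S⁻¹ b^μ, where (a - μ b) S generates the annihilator of e modulo F. It turns
membership in F into an equation between series. -/
theorem IsStep.exists_solution {F F' : Submodule ATilde E} {μ : ℂ} (h : IsStep F F' μ) {e : E}
    (he : Submodule.span ATilde {e} = F') :
    ∃ y : PowMod μ, y 0 ≠ 0 ∧ ∀ u : ATilde, u • e ∈ F ↔ u • y = 0 := by
  obtain ⟨S, hS, h1, -, -⟩ := h.exists_series he
  refine ⟨ofB S⁻¹ • PowMod.gen μ, ?_, fun u => ?_⟩
  · rw [PowMod.ofB_smul_gen, PowerSeries.coeff_zero_eq_constantCoeff,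
      PowerSeries.constantCoeff_inv]
    exact inv_ne_zero hS
  · rw [h1, smul_smul, PowMod.smul_gen_eq_zero_iff]
    constructor
    · rintro ⟨q, rfl⟩
      exact ⟨q, by rw [mul_assoc, mul_assoc, ofB_mul_inv hS, mul_one]⟩
    · rintro ⟨q, hq⟩
      exact ⟨q, by rw [← mul_assoc, ← hq, mul_assoc, ofB_inv_mul hS, mul_one]⟩

/-- If `(a - μ b) e` belongs to the smaller submodule, it generates it. -/
theorem IsStep.of_aSub_mem {F F' : Submodule ATilde E} {μ : ℂ} (h : IsStep F F' μ) {e : E}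
    (he : Submodule.span ATilde {e} = F') (hmem : aSub μ • e ∈ F) :
    (∀ u : ATilde, u • e ∈ F ↔ ∃ q, u = q * aSub μ) ∧
      Submodule.span ATilde {aSub μ • e} = F := by
  obtain ⟨S, hS, h1, h2, h3⟩ := h.exists_series he
  obtain ⟨q, hq⟩ := (h1 _).mp hmem
  -- The hypothesis makes a - μ b kill S⁻¹ b^μ; this operator multiplies the coefficient of index m
  -- by m, so S is a constant.
  have hconst : ∀ m, 0 < m → PowerSeries.coeff m S⁻¹ = 0 := by
    have h4 : aSub μ • (ofB S⁻¹ • PowMod.gen μ) = 0 := by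
      rw [hq, mul_smul, mul_smul, ← mul_smul (ofB S), ofB_mul_inv hS, one_smul,
        PowMod.aSub_smul_gen, smul_zero]
    intro m hm
    have h5 := congrFun h4 (m + 1)
    rw [PowMod.aSub_smul_succ, PowMod.ofB_smul_gen] at h5
    change _ = (0 : ℂ) at h5
    have : μ + m - μ ≠ 0 := by
      rw [add_sub_cancel_left]
      exact_mod_cast hm.ne'
    exact (mul_eq_zero.mp h5).resolve_left this
  have hSc : S⁻¹ = PowerSeries.C (PowerSeries.constantCoeff S)⁻¹ := by
    ext m
    rcases m with _ | m
    · simp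
    · rw [hconst _ (Nat.succ_pos m), PowerSeries.coeff_C, if_neg (Nat.succ_ne_zero m)]
  set c := (PowerSeries.constantCoeff S)⁻¹ with hc
  have hc0 : c ≠ 0 := inv_ne_zero hS
  have hS' : ofB S = algebraMap ℂ ATilde c⁻¹ := by
    have h6 : algebraMap ℂ ATilde c * ofB S = 1 := by
      rw [← ofB_C, ← hSc, ofB_inv_mul hS]
    calc ofB S = algebraMap ℂ ATilde c⁻¹ * (algebraMap ℂ ATilde c * ofB S) := by
          rw [← mul_assoc, ← map_mul, inv_mul_cancel₀ hc0, map_one, one_mul]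
      _ = _ := by rw [h6, mul_one]
  have hcomm : aSub μ * ofB S = algebraMap ℂ ATilde c⁻¹ * aSub μ := by
    rw [hS', Algebra.commutes]
  have h7 : ∀ u : ATilde, u • e ∈ F ↔ ∃ q, u = q * aSub μ := by
    intro u
    rw [h1]
    constructor
    · rintro ⟨q, rfl⟩
      exact ⟨q * algebraMap ℂ ATilde c⁻¹, by rw [hcomm, mul_assoc]⟩
    · rintro ⟨q, rfl⟩
      refine ⟨q * algebraMap ℂ ATilde c, ?_⟩
      rw [hcomm, mul_assoc, ← mul_assoc (algebraMap ℂ ATilde c), ← map_mul, mul_inv_cancel₀ hc0,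
        map_one, one_mul]
  refine ⟨h7, le_antisymm ?_ ?_⟩
  · rw [Submodule.span_singleton_le_iff_mem]
    exact hmem
  · intro x hx
    have hx' := h.1 hx
    rw [← he, Submodule.mem_span_singleton] at hx'
    obtain ⟨u, rfl⟩ := hx'
    obtain ⟨q, rfl⟩ := (h7 u).mp hx
    rw [mul_smul]
    exact Submodule.mem_span_singleton.mpr ⟨q, rfl⟩

end Steps

/-! ### `(a,b)`-modules -/

section ABModule

variable {E : Type} [AddCommGroup E] [Module ATilde E]

theorem b_pow_eq_ofB (n : ℕ) : b ^ n = ofB (PowerSeries.X ^ n) := by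
  rw [map_pow, b_eq_ofB]

theorem b_pow_mul_ofB (n : ℕ) (S : PowerSeries ℂ) : b ^ n * ofB S = ofB S * b ^ n := by
  rw [b_pow_eq_ofB, ← map_mul, ← map_mul, mul_comm]

/-- Conjugation by b^n translates b⁻¹a by n. -/
theorem aSub_mul_b_pow (μ : ℂ) (n : ℕ) : aSub (μ + n) * b ^ n = b ^ n * aSub μ := by
  rw [b_pow_eq_ofB, aSub_mul_ofB (μ + n) μ]
  have : (PowerSeries.mk fun m => if m = 0 then 0 else (((m - 1 : ℕ) : ℂ) + μ - (μ + n)) *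
      PowerSeries.coeff (m - 1) (PowerSeries.X ^ n : PowerSeries ℂ)) = 0 := by
    ext m
    rcases m with _ | m
    · simp
    · simp [PowerSeries.coeff_X_pow]
      intro h
      rw [h]; ring
  rw [this, map_zero, add_zero]

/-- Freeness makes the b-adic topology separated, as one sees on coordinates in a basis. -/
theorem IsABModule.eq_zero_of_forall_b_pow (h : IsABModule E) {x : E}
    (hx : ∀ n : ℕ, ∃ y : E, x = b ^ n • y) : x = 0 := by
  let _ := restrictB E
  have : Module.Free (PowerSeries ℂ) E := h.free
  let β := Module.Free.chooseBasis (PowerSeries ℂ) E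
  refine β.repr.map_eq_zero_iff.mp ?_
  ext i m
  obtain ⟨y, hy⟩ := hx (m + 1)
  have hy' : x = (PowerSeries.X ^ (m + 1) : PowerSeries ℂ) • y := by
    rw [hy, b_pow_eq_ofB]
    rfl
  rw [hy', map_smul]
  simp [PowerSeries.coeff_X_pow_mul']

theorem IsABModule.pi {n : ℕ} {M : Fin n → Type} [∀ i, AddCommGroup (M i)]
    [∀ i, Module ATilde (M i)] (h : ∀ i, IsABModule (M i)) : IsABModule ((i : Fin n) → M i) := by
  let _ := fun i => restrictB (M i)
  have h1 : ∀ i, Module.Free (PowerSeries ℂ) (M i) := fun i => (h i).free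
  have h2 : ∀ i, Module.Finite (PowerSeries ℂ) (M i) := fun i => (h i).finite
  exact ⟨inferInstanceAs (Module.Free (PowerSeries ℂ) ((i : Fin n) → M i)),
    inferInstanceAs (Module.Finite (PowerSeries ℂ) ((i : Fin n) → M i))⟩

open scoped Pointwise in
/-- The Artin-Rees lemma for an `(a,b)`-module and the submodule `N`. -/
theorem IsABModule.exists_artinRees (h : IsABModule E) (N : Submodule ATilde E) :
    ∃ k : ℕ, ∀ n : ℕ, ∀ x ∈ N, (∃ z : E, x = b ^ (n + k) • z) →
      ∃ w ∈ N, x = b ^ n • w := by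
  let _ := restrictB E
  have : Module.Finite (PowerSeries ℂ) E := h.finite
  let N' : Submodule (PowerSeries ℂ) E :=
    { carrier := N
      add_mem' := N.add_mem
      zero_mem' := N.zero_mem
      smul_mem' := fun S x hx => N.smul_mem (ofB S) hx }
  obtain ⟨k, hk⟩ := (Ideal.span {(PowerSeries.X : PowerSeries ℂ)}).exists_pow_inf_eq_pow_smul N'
  refine ⟨k, fun n x hx ⟨z, hz⟩ => ?_⟩
  have h1 := hk (n + k) (by omega)
  rw [Nat.add_sub_cancel, Ideal.span_singleton_pow, Ideal.span_singleton_pow,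
    Ideal.span_singleton_pow, Submodule.ideal_span_singleton_smul,
    Submodule.ideal_span_singleton_smul, Submodule.ideal_span_singleton_smul] at h1
  have h2 : x ∈ (PowerSeries.X ^ (n + k) : PowerSeries ℂ) • (⊤ : Submodule (PowerSeries ℂ) E) ⊓
      N' := by
    refine ⟨?_, hx⟩
    rw [hz, b_pow_eq_ofB]
    exact Submodule.smul_mem_pointwise_smul z (PowerSeries.X ^ (n + k) : PowerSeries ℂ) ⊤ trivial
  rw [h1] at h2
  obtain ⟨w, hw, hw'⟩ := h2
  refine ⟨w, hw.2, ?_⟩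
  rw [← hw', b_pow_eq_ofB]
  rfl

theorem exists_ofB_eq_b_sq (S : PowerSeries ℂ) (h0 : PowerSeries.coeff 0 S = 0)
    (h1 : PowerSeries.coeff 1 S = 0) : ∃ T, ofB S = b ^ 2 * ofB T := by
  have : (PowerSeries.X : PowerSeries ℂ) ^ 2 ∣ S := by
    rw [PowerSeries.X_pow_dvd_iff]
    intro m hm
    interval_cases m <;> assumption
  obtain ⟨T, rfl⟩ := this
  exact ⟨T, by rw [map_mul, b_pow_eq_ofB]⟩

/-- With e a basis, a e = f(b) e. If f(0) ≠ 0 then e = f⁻¹ a e, and as a raises b-divisibility in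
the simple pole module W, the image of e would be divisible by every power of b. So f = μ b + O(b²),
and this μ works. -/
theorem IsRegularAB.exists_eigenvalue (h : IsRegularAB E) (h1 : abRank E = 1) :
    ∃ μ : ℂ, ∀ x : E, ∃ y : E, aSub μ • x = b ^ 2 • y := by
  obtain ⟨hE, W, hW, j, hj⟩ := h
  let _ := restrictB E
  have : Module.Free (PowerSeries ℂ) E := hE.free
  have : Module.Finite (PowerSeries ℂ) E := hE.finite
  let β := Module.finBasisOfFinrankEq (PowerSeries ℂ) E h1
  have hβ : ∀ x : E, x = ofB (β.repr x 0) • β 0 := by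
    intro x
    have := (β.sum_repr x).symm
    rw [Fin.sum_univ_one] at this
    exact this
  set e := β 0 with he
  have he0 : e ≠ 0 := β.ne_zero 0
  set f := β.repr (a • e) 0 with hf
  have hae : a • e = ofB f • e := hβ _
  have hf0 : PowerSeries.coeff 0 f = 0 := by
    rw [PowerSeries.coeff_zero_eq_constantCoeff]
    by_contra hne
    apply he0
    apply hj
    rw [map_zero]
    refine hW.isABModule.eq_zero_of_forall_b_pow fun n => ?_
    induction n with
    | zero => exact ⟨j e, by rw [pow_zero, one_smul]⟩
    | succ n ih =>
      obtain ⟨w, hw⟩ := ih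
      obtain ⟨v, hv⟩ := hW.pole w
      have h1 : j e = ofB f⁻¹ • a • j e := by
        rw [← map_smul j, hae, ← map_smul, smul_smul, ofB_inv_mul hne, one_smul]
      have h2 : a • b ^ n • w = b ^ (n + 1) • (v + algebraMap ℂ ATilde n • w) := by
        have h3 : a = aSub (0 + n) + algebraMap ℂ ATilde n * b := by
          rw [aSub, zero_add, Algebra.smul_def, sub_add_cancel]
        have h4 : aSub 0 = a := by rw [aSub, zero_smul, sub_zero]
        nth_rewrite 1 [h3]
        rw [add_smul, smul_smul, aSub_mul_b_pow, mul_smul, h4, hv, smul_smul, ← pow_succ,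
          smul_add, smul_smul, smul_smul, mul_assoc, ← pow_succ', Algebra.commutes]
      refine ⟨ofB f⁻¹ • (v + algebraMap ℂ ATilde n • w), ?_⟩
      rw [h1, hw, h2, smul_smul, smul_smul, b_pow_mul_ofB]
  have hsq : ∃ T, (aSub (PowerSeries.coeff 1 f)) • e = (b ^ 2 * ofB T) • e := by
    obtain ⟨T, hT⟩ := exists_ofB_eq_b_sq
      (f - PowerSeries.C (PowerSeries.coeff 1 f) * PowerSeries.X)
      (by simp only [map_sub, hf0]; simp) (by simp)
    refine ⟨T, ?_⟩
    rw [← hT, map_sub, map_mul, ofB_C, ← b_eq_ofB, sub_smul, ← hae, aSub, sub_smul,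
      Algebra.smul_def]
  obtain ⟨T, hT⟩ := hsq
  refine ⟨PowerSeries.coeff 1 f, fun x => ?_⟩
  set μ := PowerSeries.coeff 1 f
  rw [hβ x]
  set S := β.repr x 0
  obtain ⟨U, hU⟩ := exists_ofB_eq_b_sq (PowerSeries.mk fun m =>
      if m = 0 then 0 else (((m - 1 : ℕ) : ℂ) + μ - μ) * PowerSeries.coeff (m - 1) S)
      (by simp) (by simp)
  refine ⟨(ofB S * ofB T + ofB U) • e, ?_⟩
  rw [smul_smul, smul_smul, aSub_mul_ofB μ μ, add_smul, mul_smul, hT, hU, smul_smul, ← add_smul,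
    mul_add, ← mul_assoc, ← mul_assoc]
  congr 3
  rw [b_pow_eq_ofB, ← map_mul, ← map_mul, mul_comm]

end ABModule

/-! ### Homogeneous operators -/

theorem sub_smul_mul_sub_smul {A : Type*} [Ring A] [Algebra ℂ A] (x y : A)
    (h : x * y = y * x + y * y) (μ ν : ℂ) :
    (x - μ • y) * (x - ν • y) = x * x - (μ + ν) • (y * x) + (μ * ν - ν) • (y * y) := by
  simp only [sub_mul, mul_sub, smul_mul_assoc, mul_smul_comm, h]
  module

/-- Only μ + ν and (μ - 1) ν enter, so the product is unchanged under (μ, ν) ↦ (ν + 1, μ - 1). This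
exchange rule is the source of the submodule in ii). -/
theorem aSub_mul_aSub (μ ν : ℂ) :
    aSub μ * aSub ν = a * a - (μ + ν) • (b * a) + (μ * ν - ν) • (b * b) :=
  sub_smul_mul_sub_smul a b (by rw [← sq b, ← a_mul_b, add_sub_cancel]) μ ν

/-- The element `b ^ n ∏ (b⁻¹ a - ν)` of `Ã`, the product being over the `n` elements of a
list. -/
def homog : List ℂ → ATilde
  | [] => 1
  | ν :: l => aSub (ν + l.length) * homog l

/-- The factors b⁻¹a - ν commute; in terms of a and b an adjacent transposition is the exchange rule
for a product of two factors. -/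
theorem homog_perm {l l' : List ℂ} (h : l.Perm l') : homog l = homog l' := by
  induction h with
  | nil => rfl
  | cons ν h ih => rw [homog, homog, ih, h.length_eq]
  | swap ν ν' l =>
    simp only [homog, List.length_cons, ← mul_assoc]
    congr 1
    rw [aSub_mul_aSub, aSub_mul_aSub]
    congr 1
    · congr 2
      push_cast; ring
    · congr 1
      push_cast; ring
  | trans _ _ h1 h2 => rw [h1, h2]

/-- In the presence of a simple pole every further factor gains at least one power of b, so the
excess n gained by l' is not lost. -/
theorem homog_append_smul_mem {E : Type} [AddCommGroup E] [Module ATilde E]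
    (hp : ∀ x : E, ∃ y : E, a • x = b • y) (l l' : List ℂ) (n : ℕ) (x : E)
    (h : ∃ y : E, homog l' • x = b ^ (n + l'.length) • y) :
    ∃ y : E, homog (l ++ l') • x = b ^ (n + (l ++ l').length) • y := by
  induction l with
  | nil => exact h
  | cons ν l ih =>
    obtain ⟨y, hy⟩ := ih
    obtain ⟨z, hz⟩ := hp y
    refine ⟨z + algebraMap ℂ ATilde (n - ν) • y, ?_⟩
    have h1 : ν + ((l ++ l').length : ℂ) = (ν - n) + ((n + (l ++ l').length : ℕ) : ℂ) := by
      push_cast; ring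
    rw [List.cons_append, homog, mul_smul, hy, h1, smul_smul, aSub_mul_b_pow, mul_smul, aSub,
      sub_smul, hz, List.length_cons, ← add_assoc, pow_succ, mul_smul, Algebra.smul_def, mul_smul,
      smul_add b, smul_smul b, ← Algebra.commutes, mul_smul, ← neg_sub (n : ℂ), map_neg, neg_smul,
      sub_neg_eq_add]

/-- After n factors the vector lies in b^(2n) E, and there a - (μ + 2n) b gains two powers of b
because a - μ b does so on E. -/
theorem homog_range_smul {E : Type} [AddCommGroup E] [Module ATilde E] (μ : ℂ)
    (h : ∀ x : E, ∃ y : E, aSub μ • x = b ^ 2 • y) (n : ℕ) (x : E) :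
    ∃ y : E, homog ((List.range n).map fun i : ℕ => μ + i).reverse • x =
      b ^ (n + ((List.range n).map fun i : ℕ => μ + i).reverse.length) • y := by
  induction n with
  | zero => exact ⟨x, by simp [homog]⟩
  | succ n ih =>
    obtain ⟨y, hy⟩ := ih
    obtain ⟨z, hz⟩ := h y
    refine ⟨z, ?_⟩
    rw [List.range_succ, List.map_append, List.reverse_append, List.map_singleton,
      List.reverse_singleton, List.singleton_append, homog, mul_smul, hy, add_assoc, ← Nat.cast_add,
      smul_smul, aSub_mul_b_pow, mul_smul, hz, smul_smul, ← pow_add, List.length_cons]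
    congr 2
    omega

/-- Take the union, without repetition, of the progressions μ_i, …, μ_i + K - 1. For each component
the factors may be permuted so that its own progression acts first. -/
theorem exists_nodup_homog {n : ℕ} {M : Fin n → Type} [∀ i, AddCommGroup (M i)]
    [∀ i, Module ATilde (M i)] (hp : ∀ i, ∀ x : M i, ∃ y : M i, a • x = b • y)
    (h : ∀ i, ∃ μ : ℂ, ∀ x : M i, ∃ y : M i, aSub μ • x = b ^ 2 • y) (K : ℕ) :
    ∃ l : List ℂ, l.Nodup ∧ ∀ x : (i : Fin n) → M i, ∃ y : (i : Fin n) → M i,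
      homog l • x = b ^ (K + l.length) • y := by
  classical
  choose μ hμ using h
  let Z : Fin n → List ℂ := fun i => ((List.range K).map fun k : ℕ => μ i + k).reverse
  have hZ : ∀ i, (Z i).Nodup := by
    intro i
    refine List.nodup_reverse.mpr ((List.nodup_map_iff ?_).mpr List.nodup_range)
    intro p q hpq
    simpa using hpq
  let A : Finset ℂ := Finset.univ.biUnion fun i => (Z i).toFinset
  refine ⟨A.toList, A.nodup_toList, fun x => ?_⟩
  have key : ∀ i, ∃ y : M i, homog A.toList • x i = b ^ (K + A.toList.length) • y := by
    intro i
    have hsub : (Z i).toFinset ⊆ A := Finset.subset_biUnion_of_mem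
      (fun i => (Z i).toFinset) (Finset.mem_univ i)
    have hperm : A.toList.Perm ((A \ (Z i).toFinset).toList ++ Z i) := by
      refine List.perm_of_nodup_nodup_toFinset_eq A.nodup_toList ?_ ?_
      · refine List.Nodup.append (Finset.nodup_toList _) (hZ i) ?_
        intro z hz hz'
        rw [Finset.mem_toList, Finset.mem_sdiff, List.mem_toFinset] at hz
        exact hz.2 hz'
      · rw [List.toFinset_append, Finset.toList_toFinset, Finset.toList_toFinset,
          Finset.sdiff_union_of_subset hsub]
    rw [homog_perm hperm, hperm.length_eq]
    exact homog_append_smul_mem (hp i) _ _ K (x i) (homog_range_smul (μ i) (hμ i) K (x i))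
  choose y hy using key
  exact ⟨y, funext hy⟩

/-- The action on series with a logarithm. -/
theorem LogMod.homog_smul {ρ : ℂ} (l : List ℂ) (y : LogMod ρ) (n : ℕ) :
    (homog l • y) (n + l.length) =
      (((l.map fun ν => (X - C ν : ℂ[X])).prod.eval (ρ + n)) * (y n).1 +
        (derivative (l.map fun ν => (X - C ν : ℂ[X])).prod).eval (ρ + n) * (y n).2,
      ((l.map fun ν => (X - C ν : ℂ[X])).prod.eval (ρ + n)) * (y n).2) := by
  induction l with
  | nil => simp [homog]
  | cons ν l ih =>
    rw [homog, mul_smul, List.length_cons, ← add_assoc, aSub_smul_succ, ih]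
    simp only [List.map_cons, List.prod_cons, derivative_mul, eval_mul, eval_add, eval_sub, eval_X,
      eval_C, derivative_sub, derivative_X, derivative_C]
    ext
    · simp; ring
    · simp; ring

/-- Distinct roots are simple. A multiple root is exactly what would let a logarithm survive. -/
theorem eval_prod_ne_zero_or {l : List ℂ} (hl : l.Nodup) (z : ℂ) :
    (l.map fun ν => (X - C ν : ℂ[X])).prod.eval z ≠ 0 ∨
      (derivative (l.map fun ν => (X - C ν : ℂ[X])).prod).eval z ≠ 0 := by
  induction l with
  | nil => left; simp
  | cons ν l ih =>
    rw [List.nodup_cons] at hl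
    by_cases hz : z = ν
    · right
      simp only [List.map_cons, List.prod_cons, derivative_mul, eval_mul, eval_add, eval_sub,
        eval_X, eval_C, derivative_sub, derivative_X, derivative_C, hz, sub_self]
      rw [zero_mul, add_zero, eval_one, eval_zero, sub_zero, one_mul, eval_list_prod]
      simp only [ne_eq, List.prod_eq_zero_iff, List.mem_map, not_exists, not_and]
      rintro x ⟨w, hw, rfl⟩ h0
      simp only [eval_sub, eval_X, eval_C, sub_eq_zero] at h0
      exact hl.1 (h0 ▸ hw)
    · have h1 : z - ν ≠ 0 := sub_ne_zero.mpr hz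
      simp only [List.map_cons, List.prod_cons, derivative_mul, eval_mul, eval_add, eval_sub,
        eval_X, eval_C, derivative_sub, derivative_X, derivative_C]
      by_cases h2 : (l.map fun ν => (X - C ν : ℂ[X])).prod.eval z = 0
      · right
        have := (ih hl.2).resolve_left (by simpa using h2)
        rw [h2]
        simpa [h1] using this
      · left
        exact mul_ne_zero h1 h2

/-! ### Semi-simple modules have no logarithms -/

section SemiSimple

variable {E : Type} [AddCommGroup E] [Module ATilde E]

theorem IsSimplePole.exists_pole_of_eigenvalue {μ : ℂ}
    (h : ∀ x : E, ∃ y : E, aSub μ • x = b ^ 2 • y) (x : E) : ∃ y : E, a • x = b • y := by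
  obtain ⟨y, hy⟩ := h x
  refine ⟨b • y + algebraMap ℂ ATilde μ • x, ?_⟩
  have : a = aSub μ + algebraMap ℂ ATilde μ * b := by
    rw [aSub, Algebra.smul_def, sub_add_cancel]
  rw [this, add_smul, hy, smul_add, sq, mul_smul, Algebra.commutes, mul_smul]

/-- A series with a logarithm annihilated by the annihilator of an element of a semi-simple
module has no logarithm. -/
theorem IsSemiSimpleAB.snd_eq_zero (h : IsSemiSimpleAB E) (s : E) {ρ : ℂ} (y : LogMod ρ)
    (hy : ∀ u : ATilde, u • s = 0 → u • y = 0) (m : ℕ) : (y m).2 = 0 := by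
  obtain ⟨n, M, hM, f, hf⟩ := h
  have hμ : ∀ i, ∃ μ : ℂ, ∀ x : M i, ∃ y : M i, aSub μ • x = b ^ 2 • y :=
    fun i => (hM i).1.exists_eigenvalue (hM i).2
  have hp : ∀ i, ∀ x : M i, ∃ y : M i, a • x = b • y := by
    intro i
    obtain ⟨μ, hμ⟩ := hμ i
    exact IsSimplePole.exists_pole_of_eigenvalue hμ
  have hP : IsABModule ((i : Fin n) → M i) := IsABModule.pi fun i => (hM i).1.1
  -- Divisibility by b in the ambient sum says nothing about s itself. At the cost of k powers it
  -- becomes divisibility inside Ã f(s), hence an element of the annihilator of s.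
  obtain ⟨k, hk⟩ := hP.exists_artinRees (Submodule.span ATilde {f s})
  obtain ⟨l, hl, hl'⟩ := exists_nodup_homog hp hμ (m + 1 + k)
  obtain ⟨z, hz⟩ := hl' (f s)
  obtain ⟨w, hw, hw'⟩ := hk (m + 1 + l.length) (homog l • f s)
    (Submodule.mem_span_singleton.mpr ⟨_, rfl⟩)
    ⟨z, by rw [hz]; congr 2; omega⟩
  obtain ⟨v, rfl⟩ := Submodule.mem_span_singleton.mp hw
  have h1 : homog l • s = (b ^ (m + 1 + l.length) * v) • s := by
    apply hf
    rw [map_smul, map_smul, hw', mul_smul]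
  have h2 := hy (homog l - b ^ (m + 1 + l.length) * v) (by rw [sub_smul, h1, sub_self])
  rw [sub_smul, sub_eq_zero, mul_smul] at h2
  -- At this index the multiple of b^(m+1+|l|) has no coefficient, so P(ρ+m) v_m = 0 and P(ρ+m) u_m
  -- + P'(ρ+m) v_m = 0, with P = ∏ (x - ν).
  have h3 := congrFun h2 (m + l.length)
  rw [LogMod.homog_smul, SeqMod.b_pow_smul, if_neg (by omega)] at h3
  obtain ⟨h4, h5⟩ := Prod.ext_iff.mp h3
  simp only [Prod.fst_zero, Prod.snd_zero] at h4 h5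
  by_contra hne
  have h6 := (mul_eq_zero.mp h5).resolve_right hne
  rw [h6, zero_mul, zero_add] at h4
  have h7 := (mul_eq_zero.mp h4).resolve_right hne
  exact (eval_prod_ne_zero_or hl (ρ + m)).elim (fun h => h h6) (fun h => h h7)

theorem IsSemiSimpleAB.of_injective {E' : Type} [AddCommGroup E'] [Module ATilde E']
    (h : IsSemiSimpleAB E) (g : E' →ₗ[ATilde] E) (hg : Function.Injective g) :
    IsSemiSimpleAB E' := by
  obtain ⟨n, M, hM, f, hf⟩ := h
  exact ⟨n, M, hM, f ∘ₗ g, hf.comp hg⟩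

end SemiSimple

/-! ### Filtrations with quotients of rank one -/

section Filtrations

variable {E : Type} [AddCommGroup E] [Module ATilde E]

/-- A filtration `0 = F 0 ≤ ⋯ ≤ F r = E` with `F (j + 1) / F j` isomorphic to the module of rank
one of parameter `μ₀ + n j - j`. -/
structure IsStepFiltration (r : ℕ) (μ₀ : ℂ) (n : ℕ → ℕ) (F : ℕ → Submodule ATilde E) : Prop where
  bot : F 0 = ⊥
  top : F r = ⊤
  step : ∀ j < r, IsStep (F j) (F (j + 1)) (μ₀ + n j - j)

namespace IsStepFiltration

variable {r : ℕ} {μ₀ : ℂ} {n : ℕ → ℕ} {F : ℕ → Submodule ATilde E}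

theorem mono (hF : IsStepFiltration r μ₀ n F) {i j : ℕ} (hij : i ≤ j) (hj : j ≤ r) :
    F i ≤ F j := by
  induction j, hij using Nat.le_induction with
  | base => exact le_rfl
  | succ j _ ih => exact (ih (by omega)).trans (hF.step j (by omega)).1

/-- The solutions with leading exponent given by the quotient of index `i`. -/
theorem exists_solution (hF : IsStepFiltration r μ₀ n F) (hn : StrictMono n) {i j : ℕ}
    (hij : i + 1 ≤ j) (hj : j ≤ r)
    (hlog : ∀ l, i < l → l < j → ∀ e, Submodule.span ATilde {e} = F l →
      ∀ (ρ : ℂ) (y : LogMod ρ), (∀ u : ATilde, u • e ∈ F i → u • y = 0) → ∀ m, (y m).2 = 0)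
    {e : E} (he : Submodule.span ATilde {e} = F j) {ρ : ℂ} (hρ : ρ = μ₀ + n i + 1 - j) :
    ∃ y : LogMod ρ, (∀ u : ATilde, u • e ∈ F i → u • y = 0) ∧
      (∀ u : ATilde, u • e ∈ F (i + 1) → u • y = 0 → u • e ∈ F i) ∧ (y 0).1 ≠ 0 ∧
      (∀ m < n (j - 1) - n i, (y m).2 = 0) ∧
      ((y (n (j - 1) - n i)).2 = 0 → ∀ m, (y m).2 = 0) := by
  induction j, hij using Nat.le_induction generalizing e ρ with
  | base =>
    have hstep := hF.step i (by omega)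
    rw [show μ₀ + n i - i = ρ by rw [hρ]; push_cast; ring] at hstep
    obtain ⟨y, hy0, hy⟩ := hstep.exists_solution he
    refine ⟨LogMod.inl ρ y, fun u hu => ?_, fun u _ hu => ?_, ?_, fun m _ => rfl, fun _ m => rfl⟩
    · rw [← map_smul, (hy u).mp hu, map_zero]
    · rw [← map_smul] at hu
      exact (hy u).mpr (funext fun m => congrArg Prod.fst (congrFun hu m))
    · exact hy0
  | succ j hij ih =>
    obtain ⟨S, hS, h1, -, h3⟩ := (hF.step j (by omega)).exists_series he
    obtain ⟨y', hy1, hy2, hy3, -, -⟩ := ih (by omega)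
      (fun l hl hl' => hlog l hl (by omega)) h3 (ρ := ρ + (1 : ℕ))
      (by rw [hρ]; push_cast; ring)
    -- The solution for the previous submodule has no logarithm, so at most one is created here.
    have hy' := hlog j (by omega) (by omega) _ h3 _ y' hy1
    rw [Nat.add_sub_cancel]
    have hp : n i < n j := hn (by omega)
    set p := n j - n i with hpdef
    have hp0 : 0 < p := by omega
    have hpc : (n j : ℂ) = n i + p := by
      rw [hpdef, Nat.cast_sub hp.le]; ring
    -- Term by term solution of (a - μ b) y₀ = y'. The operator multiplies the coefficient of index
    -- m by m - p; at the resonance m = p the right-hand side is reached by the derivative of the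
    -- logarithm instead.
    let y₀ : LogMod ρ := fun m =>
      if m = p then (0, (y' m).1) else ((y' m).1 / ((m : ℂ) - p), 0)
    have hy₀ : aSub (μ₀ + n j - j) • y₀ = LogMod.shift 1 rfl y' := by
      funext m
      rcases m with _ | m
      · rw [SeqMod.aSub_smul_zero, LogMod.shift_apply, if_neg (by omega)]
      · rw [LogMod.aSub_smul_succ, LogMod.shift_apply, if_pos (by omega), Nat.add_sub_cancel]
        have h4 : ρ + m - (μ₀ + n j - j) = m - p := by
          rw [hρ, hpc]; push_cast; ring
        rw [h4]
        by_cases hm : m = p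
        · ext
          · simp [y₀, hm]
          · simp [y₀, hm, hy' p]
        · have h5 : (m : ℂ) - p ≠ 0 := sub_ne_zero.mpr (by exact_mod_cast hm)
          ext
          · simp only [y₀, if_neg hm, add_zero]
            field_simp
          · simp [y₀, hm, hy' m]
    have hsnd : ∀ m < p, LogMod.snd ρ y₀ m = 0 := by
      intro m hm
      rw [LogMod.snd_apply]
      simp [y₀, hm.ne]
    have hS' : PowerSeries.constantCoeff S⁻¹ ≠ 0 := by
      rw [PowerSeries.constantCoeff_inv]
      exact inv_ne_zero hS
    have hq : ∀ q : ATilde, (q * (aSub (μ₀ + n j - j) * ofB S)) • ofB S⁻¹ • y₀ =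
        LogMod.shift 1 rfl (q • y') := by
      intro q
      rw [mul_smul, mul_smul, smul_smul (ofB S), ofB_mul_inv hS, one_smul, hy₀, map_smul]
    refine ⟨ofB S⁻¹ • y₀, fun u hu => ?_, fun u hu hu' => ?_, ?_, fun m hm => ?_,
      fun h m => ?_⟩
    · obtain ⟨q, rfl⟩ := (h1 u).mp (hF.mono (by omega) (by omega) hu)
      rw [hq, hy1 q, map_zero]
      rwa [mul_smul] at hu
    · obtain ⟨q, rfl⟩ := (h1 u).mp (hF.mono (by omega) (by omega) hu)
      rw [hq] at hu'
      rw [mul_smul] at hu ⊢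
      refine hy2 q hu (LogMod.shift_injective 1 rfl ?_)
      rw [hu', map_zero]
    · rw [SeqMod.ofB_smul_zero]
      refine mul_ne_zero hS' ?_
      simp only [y₀, if_neg hp0.ne]
      refine div_ne_zero hy3 ?_
      rw [Nat.cast_zero, zero_sub, neg_ne_zero]
      exact_mod_cast hp0.ne'
    · have := (SeqMod.smul_apply_of_vanish (ofB S⁻¹) (LogMod.snd ρ y₀) p hsnd).1 m hm
      rwa [← map_smul] at this
    · have h6 := (SeqMod.smul_apply_of_vanish (ofB S⁻¹) (LogMod.snd ρ y₀) p hsnd).2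
      rw [← map_smul, LogMod.snd_apply, h, const_ofB, eq_comm, smul_eq_mul] at h6
      have h7 := (mul_eq_zero.mp h6).resolve_left hS'
      have h8 : LogMod.snd ρ y₀ = 0 := by
        funext k
        by_cases hk : k = p
        · rw [hk, h7]; rfl
        · rw [LogMod.snd_apply]
          simp [y₀, hk]
      have h9 := congrArg (fun z => ofB S⁻¹ • z) h8
      simp only [← map_smul, smul_zero] at h9
      exact congrFun h9 m

/-- The leading exponents of the series annihilated by the annihilator of a generator. -/
theorem apply_eq_zero_of_vanish (hF : IsStepFiltration r μ₀ n F) {ρ : ℂ} {j m : ℕ} (hj : j ≤ r)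
    {e : E} (he : Submodule.span ATilde {e} = F j) {w : PowMod ρ}
    (hw : ∀ u : ATilde, u • e = 0 → u • w = 0) (hm : ∀ i < m, w i = 0)
    (hne : ∀ l < j, ρ + m + j - 1 - (μ₀ + n l) ≠ 0) : w m = 0 := by
  induction j generalizing e w m with
  | zero =>
    have he0 : e = 0 := by
      have := Submodule.mem_span_singleton_self (R := ATilde) e
      rw [he, hF.bot] at this
      exact this
    have := hw 1 (by rw [he0, smul_zero])
    rw [one_smul] at this
    rw [this]; rfl
  | succ j ih =>
    obtain ⟨S, hS, -, -, h3⟩ := (hF.step j (by omega)).exists_series he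
    -- The new first coefficient is S(0) w m times a factor excluded from vanishing by `hne` for l =
    -- j; the order moves from m to m + 1 while j drops by one, so the remaining conditions are the
    -- same.
    have h4 := ih (m := m + 1) (by omega) h3 (w := (aSub (μ₀ + n j - j) * ofB S) • w)
      (fun u hu => by
        rw [smul_smul]
        exact hw _ (by rw [mul_smul]; exact hu))
      (fun i hi => by
        rcases i with _ | i
        · rw [mul_smul, SeqMod.aSub_smul_zero]
        · rw [mul_smul, PowMod.aSub_smul_succ,
            (SeqMod.smul_apply_of_vanish (ofB S) w m hm).1 i (by omega), mul_zero])
      (fun l hl h => hne l (by omega) (by rw [← h]; push_cast; ring))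
    rw [mul_smul, PowMod.aSub_smul_succ, (SeqMod.smul_apply_of_vanish (ofB S) w m hm).2,
      const_ofB, smul_eq_mul, mul_eq_zero, mul_eq_zero] at h4
    rcases h4 with h4 | h4 | h4
    · exact absurd h4 fun h => hne j (by omega) (by rw [← h]; push_cast; ring)
    · exact absurd h4 hS
    · exact h4

/-- Look at the image in E_μ = F' (j + 1) / F' j of the generator of F j. It is a series starting at
index at least 2, whereas the exponents permitted by F j correspond to n l with l < j, and n l ≤ n j
makes them too small. So the image is zero. This is where the monotonicity of λ_j + j is needed. -/
theorem le_of_succ_eq (hF : IsStepFiltration r μ₀ n F) {F' : ℕ → Submodule ATilde E}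
    (hF' : IsStepFiltration r μ₀ n F') (hn : Monotone n) {j : ℕ} (hj : j < r) {e : E}
    (he : Submodule.span ATilde {e} = F (j + 1)) (heq : F (j + 1) = F' (j + 1)) :
    F j ≤ F' j := by
  obtain ⟨S, hS, -, h2, h3⟩ := (hF.step j hj).exists_series he
  have hstep := hF'.step j hj
  set μ := μ₀ + n j - j with hμ
  obtain ⟨y, -, hker⟩ := hstep.exists_solution (he.trans heq)
  set w : PowMod μ := (aSub μ * ofB S) • y with hw
  have hw0 : w = 0 := by
    have : ∀ m, (∀ i < m, w i = 0) → w m = 0 := by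
      intro m hm
      rcases m with _ | _ | m
      · rw [hw, mul_smul, SeqMod.aSub_smul_zero]
      · rw [hw, mul_smul, PowMod.aSub_smul_succ]
        simp
      · refine hF.apply_eq_zero_of_vanish hj.le h3 (fun u hu => ?_) hm fun l hl h => ?_
        · rw [hw, smul_smul, ← hker, mul_smul, hu]
          exact zero_mem _
        · have h5 : n l ≤ n j := hn hl.le
          have h6 : ((n j + m + 1 : ℕ) : ℂ) = (n l : ℕ) := by
            rw [← sub_eq_zero, ← h, hμ]; push_cast; ring
          have := Nat.cast_injective h6
          omega
    funext m
    exact Nat.strong_induction_on m this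
  rw [← h3, Submodule.span_singleton_le_iff_mem, hker]
  exact hw0

/-- The filtration is unique if `E` is cyclic. -/
theorem unique (hF : IsStepFiltration r μ₀ n F) {F' : ℕ → Submodule ATilde E}
    (hF' : IsStepFiltration r μ₀ n F') (hn : Monotone n) {e : E}
    (he : Submodule.span ATilde {e} = ⊤) {j : ℕ} (hj : j ≤ r) : F j = F' j := by
  have key : ∀ d, d ≤ r → F (r - d) = F' (r - d) ∧
      ∃ e, Submodule.span ATilde {e} = F (r - d) := by
    intro d
    induction d with
    | zero => exact fun _ => ⟨hF.top.trans hF'.top.symm, e, he.trans hF.top.symm⟩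
    | succ d ih =>
      intro hd
      obtain ⟨h1, e', he'⟩ := ih (by omega)
      have h2 : r - d = r - (d + 1) + 1 := by omega
      rw [h2] at h1 he'
      refine ⟨le_antisymm (hF.le_of_succ_eq hF' hn (by omega) he' h1)
        (hF'.le_of_succ_eq hF hn (by omega) (he'.trans h1) h1.symm), ?_⟩
      obtain ⟨S, -, -, -, h3⟩ := (hF.step _ (by omega)).exists_series he'
      exact ⟨_, h3⟩
  have := (key (r - j) (by omega)).1
  rwa [Nat.sub_sub_self hj] at this

/-- A solution vanishing at the lowest exponent vanishes on the first submodule. -/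
theorem smul_eq_zero_of_vanish (hF : IsStepFiltration r μ₀ n F) (hn : n 0 = 0) {j : ℕ}
    (hj : 1 ≤ j) (hjr : j ≤ r) {e : E} (he : Submodule.span ATilde {e} = F j) {ρ : ℂ}
    (hρ : ρ = μ₀ + 1 - j) {y : LogMod ρ} (hy : ∀ u : ATilde, u • e = 0 → u • y = 0)
    (hy0 : y 0 = 0) {u : ATilde} (hu : u • e ∈ F 1) : u • y = 0 := by
  induction j, hj using Nat.le_induction generalizing e ρ u with
  | base =>
    obtain ⟨S, hS, -, h2, -⟩ := (hF.step 0 (by omega)).exists_series he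
    rw [hF.bot, Submodule.mem_bot] at h2
    have h3 := hy _ h2
    rw [mul_smul] at h3
    have h4 : ofB S • y = 0 := by
      funext m
      rcases m with _ | m
      · rw [SeqMod.ofB_smul_zero, hy0, smul_zero]; rfl
      · have h5 := congrFun h3 (m + 2)
        have h6 : ρ + ((m + 1 : ℕ) : ℂ) - (μ₀ + n 0 - (0 : ℕ)) = ((m + 1 : ℕ) : ℂ) := by
          rw [hρ, hn]; push_cast; ring
        have h7 : ((m + 1 : ℕ) : ℂ) ≠ 0 := Nat.cast_ne_zero.mpr (by omega)
        rw [LogMod.aSub_smul_succ, h6] at h5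
        obtain ⟨h8, h9⟩ := Prod.ext_iff.mp h5
        have h10 := (mul_eq_zero.mp h9).resolve_left h7
        simp only at h8
        rw [h10, add_zero] at h8
        exact Prod.ext ((mul_eq_zero.mp h8).resolve_left h7) h10
    have h5 : y = 0 := by
      rw [← one_smul ATilde y, ← ofB_inv_mul hS, mul_smul, h4, smul_zero]
    rw [h5, smul_zero]
  | succ j hj ih =>
    obtain ⟨S, hS, h1, -, h3⟩ := (hF.step j (by omega)).exists_series he
    set w := (aSub (μ₀ + n j - j) * ofB S) • y with hw
    -- `w` has no coefficient of index 0, and that of index 1 vanishes with `y 0`; dividing by b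
    -- restores the hypotheses one step lower.
    let w' : LogMod (ρ + (1 : ℕ)) := fun m => w (m + 1)
    have hw' : w = LogMod.shift 1 rfl w' := by
      funext m
      rcases m with _ | m
      · rw [hw, mul_smul, SeqMod.aSub_smul_zero, LogMod.shift_apply, if_neg (by omega)]
      · rw [LogMod.shift_apply, if_pos (by omega)]; rfl
    obtain ⟨q, rfl⟩ := (h1 u).mp (hF.mono hj (by omega) hu)
    rw [mul_smul, ← hw, hw', ← map_smul]
    rw [mul_smul] at hu
    rw [ih (by omega) h3 (by rw [hρ]; push_cast; ring) (fun v hv => ?_) ?_ hu, map_zero]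
    · change w 1 = 0
      rw [hw, mul_smul, LogMod.aSub_smul_succ, SeqMod.ofB_smul_zero, hy0, smul_zero]
      simp
    · apply LogMod.shift_injective 1 rfl
      rw [map_smul, ← hw', hw, map_zero, smul_smul]
      exact hy _ (by rw [mul_smul]; exact hv)

/-- Nakayama's lemma for the filtration. -/
theorem span_eq_of_sub_mem (hF : IsStepFiltration r μ₀ n F) {j : ℕ} (hj : j < r) {e x : E}
    (he : Submodule.span ATilde {e} = F (j + 1)) (hx : x ∈ F (j + 1)) {V : PowerSeries ℂ}
    (hV : PowerSeries.constantCoeff V ≠ 0) (hxe : x - ofB V • e ∈ F j) :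
    Submodule.span ATilde {x} = F (j + 1) := by
  induction j generalizing e x V with
  | zero =>
    rw [hF.bot, Submodule.mem_bot, sub_eq_zero] at hxe
    rw [hxe, ← he]
    refine le_antisymm ?_ ?_
    · rw [Submodule.span_singleton_le_iff_mem]
      exact Submodule.smul_mem _ _ (Submodule.mem_span_singleton_self e)
    · rw [Submodule.span_singleton_le_iff_mem, Submodule.mem_span_singleton]
      exact ⟨ofB V⁻¹, by rw [smul_smul, ofB_inv_mul hV, one_smul]⟩
  | succ j ih =>
    obtain ⟨S, hS, h1, h2, h3⟩ := (hF.step (j + 1) hj).exists_series he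
    set μ := μ₀ + n (j + 1) - (j + 1 : ℕ) with hμ
    set e' := (aSub μ * ofB S) • e with he'
    obtain ⟨w, hw⟩ := Submodule.mem_span_singleton.mp (h3.symm ▸ hxe : x - ofB V • e ∈
      Submodule.span ATilde {e'})
    obtain ⟨S', hS', h1', h2', h3'⟩ := (hF.step j (by omega)).exists_series h3
    set μ' := μ₀ + n j - j with hμ'
    -- the analogue of `e'` for `x`
    have hxdef : x = ofB V • e + w • e' := by rw [hw, add_sub_cancel]
    -- P sends V e to e', so P x = e' + P w e'. The second term has constant term 0 modulo F j,
    -- hence P x is a unit of ℂ[[b]] times e' modulo F j, and the induction hypothesis applies to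
    -- it.
    obtain ⟨P, hP⟩ : ∃ P, P = aSub μ * ofB (S * V⁻¹) := ⟨_, rfl⟩
    have hPx : P • x = e' + P • w • e' := by
      rw [hxdef, smul_add, hP, he', smul_smul, mul_assoc (aSub μ), ← map_mul ofB, mul_assoc S,
        PowerSeries.inv_mul_cancel V hV, mul_one]
    have hPxF : P • x ∈ F (j + 1) := by
      rw [hPx]
      exact add_mem h2 (Submodule.smul_mem _ _ (Submodule.smul_mem _ _ h2))
    -- reduce `P w e'` modulo `F j`
    obtain ⟨q, T, hqT⟩ := exists_eq_mul_aSub_add μ' (P * w * ofB S'⁻¹)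
    have hT0 : PowerSeries.constantCoeff T = 0 := by
      have := congrArg const hqT
      rw [const_add, const_mul, const_mul, const_mul, const_aSub, const_ofB, hP, const_mul,
        const_aSub] at this
      simpa [const_ofB] using this.symm
    have hPw : P * w = q * (aSub μ' * ofB S') + ofB (T * S') := by
      calc P * w = P * w * ofB S'⁻¹ * ofB S' := by
            rw [mul_assoc, ofB_inv_mul hS', mul_one]
        _ = _ := by rw [hqT, add_mul, mul_assoc, map_mul]
    have hspan : Submodule.span ATilde {P • x} = F (j + 1) := by
      refine ih (by omega) h3 hPxF (V := 1 + T * S') (by simp [hT0]) ?_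
      have : P • x - ofB (1 + T * S') • e' = q • (aSub μ' * ofB S') • e' := by
        rw [hPx, smul_smul, hPw, map_add, map_one, add_smul, add_smul, one_smul, mul_smul]
        abel
      rw [this]
      exact Submodule.smul_mem _ _ h2'
    refine le_antisymm ?_ ?_
    · rw [Submodule.span_singleton_le_iff_mem]
      exact hx
    · have hle : F (j + 1) ≤ Submodule.span ATilde {x} := by
        rw [← hspan, Submodule.span_singleton_le_iff_mem]
        exact Submodule.smul_mem _ _ (Submodule.mem_span_singleton_self x)
      have hmem : ofB V • e ∈ Submodule.span ATilde {x} := by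
        have := sub_mem (Submodule.mem_span_singleton_self x) (hle hxe)
        rwa [sub_sub_cancel] at this
      rw [← he, Submodule.span_singleton_le_iff_mem]
      have := Submodule.smul_mem _ (ofB V⁻¹) hmem
      rwa [smul_smul, ofB_inv_mul hV, one_smul] at this

/-- The normal form of the last two steps. -/
theorem exists_normal_generator (hF : IsStepFiltration r μ₀ n F) (hn : StrictMono n) {j : ℕ}
    (hj : j + 2 ≤ r) {e : E} (he : Submodule.span ATilde {e} = F (j + 2)) :
    ∃ (e' h : E) (x : ℂ), Submodule.span ATilde {e'} = F (j + 2) ∧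
      Submodule.span ATilde {h} = F (j + 1) ∧
      aSub (μ₀ + n (j + 1) - (j + 1 : ℕ)) • e' -
        ofB (1 + PowerSeries.C x * PowerSeries.X ^ (n (j + 1) - n j)) • h ∈ F j ∧
      aSub (μ₀ + n j - j) • h ∈ F j := by
  obtain ⟨S, hS, h1, h2, h3⟩ := (hF.step (j + 1) (by omega)).exists_series he
  set μ := μ₀ + n (j + 1) - (j + 1 : ℕ) with hμ
  set e₁ := (aSub μ * ofB S) • e with he₁
  obtain ⟨S', hS', -, h2', h3'⟩ := (hF.step j (by omega)).exists_series h3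
  set μ' := μ₀ + n j - j with hμ'
  set p := n (j + 1) - n j with hp
  have hnj : n j < n (j + 1) := hn (by omega)
  have hpc : μ' - μ = 1 - p := by
    rw [hμ, hμ', hp, Nat.cast_sub hnj.le]; push_cast; ring
  -- normalise the constant term
  set c := PowerSeries.constantCoeff S' with hc
  -- The factor c gives T constant term 1, with e₁ = T h and (a - μ' b) h in F j. It remains to
  -- simplify T by adding a multiple of h to the generator.
  obtain ⟨T, hT⟩ : ∃ T : PowerSeries ℂ, T = PowerSeries.C c * S'⁻¹ := ⟨_, rfl⟩
  have hT0 : PowerSeries.coeff 0 T = 1 := by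
    rw [hT, PowerSeries.coeff_C_mul, PowerSeries.coeff_zero_eq_constantCoeff,
      PowerSeries.constantCoeff_inv, ← hc, mul_inv_cancel₀ hS']
  obtain ⟨h, hh⟩ : ∃ h, h = ofB (PowerSeries.C c⁻¹ * S') • e₁ := ⟨_, rfl⟩
  have hTh : e₁ = ofB T • h := by
    rw [hh, smul_smul, ← map_mul, hT]
    have : PowerSeries.C c * S'⁻¹ * (PowerSeries.C c⁻¹ * S') = 1 := by
      calc PowerSeries.C c * S'⁻¹ * (PowerSeries.C c⁻¹ * S') =
          PowerSeries.C (c * c⁻¹) * (S'⁻¹ * S') := by rw [map_mul]; ring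
        _ = 1 := by rw [mul_inv_cancel₀ hS', PowerSeries.inv_mul_cancel S' hS', map_one, one_mul]
    rw [this, map_one, one_smul]
  have hhF : h ∈ F (j + 1) := hh ▸ Submodule.smul_mem _ _ h2
  have hspan : Submodule.span ATilde {h} = F (j + 1) := by
    refine le_antisymm ?_ ?_
    · rw [Submodule.span_singleton_le_iff_mem]
      exact hhF
    · rw [← h3, Submodule.span_singleton_le_iff_mem, hTh]
      exact Submodule.smul_mem _ _ (Submodule.mem_span_singleton_self h)
  have hah : aSub μ' • h ∈ F j := by
    have : aSub μ' • h = algebraMap ℂ ATilde c⁻¹ • (aSub μ' * ofB S') • e₁ := by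
      rw [hh, map_mul, ofB_C, smul_smul (aSub μ'), smul_smul _ _ e₁, ← mul_assoc, ← mul_assoc,
        Algebra.commutes]
    rw [this]
    exact Submodule.smul_mem _ _ h2'
  -- Adding U h changes the coefficient of index m + 1 of T by (m + 1 - p) U_m, so all of them can
  -- be cancelled except at m + 1 = p. There the division by zero gives U_m = 0, and any other value
  -- would do as well.
  let U : PowerSeries ℂ := PowerSeries.mk fun m =>
    -PowerSeries.coeff (m + 1) T / ((m : ℂ) + 1 - p)
  have hU : T + (PowerSeries.mk fun m =>
      if m = 0 then 0 else (((m - 1 : ℕ) : ℂ) + μ' - μ) * PowerSeries.coeff (m - 1) U) =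
      1 + PowerSeries.C (PowerSeries.coeff p T) * PowerSeries.X ^ p := by
    ext m
    rw [map_add, map_add, PowerSeries.coeff_mk, PowerSeries.coeff_C_mul,
      PowerSeries.coeff_X_pow, PowerSeries.coeff_one]
    rcases m with _ | m
    · have : (0 : ℕ) ≠ p := by omega
      simp [hT0, this]
    · rw [if_neg (Nat.succ_ne_zero m), if_neg (Nat.succ_ne_zero m), Nat.add_sub_cancel, add_sub_assoc, hpc,
        PowerSeries.coeff_mk]
      by_cases hm : m + 1 = p
      · have h4 : (m : ℂ) + (1 - p) = 0 := by rw [← hm]; push_cast; ring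
        rw [h4, if_pos hm, hm]; ring
      · have h4 : (m : ℂ) + 1 - p ≠ 0 := by
          rw [sub_ne_zero]; exact_mod_cast hm
        have h5 : (m : ℂ) + (1 - p) = (m : ℂ) + 1 - p := by ring
        rw [h5, if_neg hm]
        field_simp
        ring
  refine ⟨ofB S • e + ofB U • h, h, PowerSeries.coeff p T, ?_, hspan, ?_, hah⟩
  · refine hF.span_eq_of_sub_mem (by omega) he ?_ hS ?_
    · refine add_mem (Submodule.smul_mem _ _ ?_) (Submodule.smul_mem _ _ ?_)
      · rw [← he]; exact Submodule.mem_span_singleton_self e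
      · exact (hF.step (j + 1) (by omega)).1 hhF
    · rw [add_sub_cancel_left]
      exact Submodule.smul_mem _ _ hhF
  · have : aSub μ • (ofB S • e + ofB U • h) -
        ofB (1 + PowerSeries.C (PowerSeries.coeff p T) * PowerSeries.X ^ p) • h =
        ofB U • aSub μ' • h := by
      rw [← hU, smul_add, smul_smul, ← he₁, smul_smul, aSub_mul_ofB μ μ' U, add_smul, map_add,
        add_smul, ← hTh, mul_smul]
      abel
    rw [this]
    exact Submodule.smul_mem _ _ hah

end IsStepFiltration

end Filtrations

/-! ### The modules of rank one -/

namespace PowMod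

variable (ρ : ℂ)

theorem isSimplePole_and_rank : IsSimplePole (PowMod ρ) ∧ abRank (PowMod ρ) = 1 := by
  let _ := restrictB (PowMod ρ)
  let φ : PowerSeries ℂ →ₗ[PowerSeries ℂ] PowMod ρ := LinearMap.toSpanSingleton _ _ (gen ρ)
  have hφ : ∀ S m, φ S m = PowerSeries.coeff m S := fun S m => ofB_smul_gen ρ S m
  let ψ : PowerSeries ℂ ≃ₗ[PowerSeries ℂ] PowMod ρ := LinearEquiv.ofBijective φ
    ⟨fun S T h => by
      ext m
      rw [← hφ, ← hφ, h],
     fun y => ⟨PowerSeries.mk y, by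
      funext m
      exact (hφ _ m).trans (PowerSeries.coeff_mk m _)⟩⟩
  refine ⟨⟨⟨Module.Free.of_equiv ψ, Module.Finite.equiv ψ⟩, fun y => ?_⟩, ?_⟩
  · let z : PowMod ρ := fun m => (ρ + m) * y m
    refine ⟨z, ?_⟩
    have : a = aSub 0 := by rw [aSub, zero_smul, sub_zero]
    funext m
    rcases m with _ | m
    · rw [this, SeqMod.aSub_smul_zero, SeqMod.b_smul_zero]
    · rw [this, aSub_smul_succ, SeqMod.b_smul_succ, sub_zero]
  · change Module.finrank (PowerSeries ℂ) (PowMod ρ) = 1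
    rw [← ψ.finrank_eq, Module.finrank_self]

end PowMod

section Cyclic

variable {E : Type} [AddCommGroup E] [Module ATilde E]

/-- E is Ã modulo the annihilator of e, so solutions are the same thing as homomorphisms. -/
theorem exists_linearMap_of_annihilator {Y : Type} [AddCommGroup Y] [Module ATilde Y] {e : E}
    (he : Submodule.span ATilde {e} = ⊤) {y : Y} (h : ∀ u : ATilde, u • e = 0 → u • y = 0) :
    ∃ φ : E →ₗ[ATilde] Y, ∀ u : ATilde, φ (u • e) = u • y := by
  let g := LinearMap.toSpanSingleton ATilde E e
  have hg : Function.Surjective g := by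
    intro x
    have : x ∈ Submodule.span ATilde {e} := he ▸ Submodule.mem_top
    exact Submodule.mem_span_singleton.mp this
  let f := LinearMap.toSpanSingleton ATilde Y y
  have hk : LinearMap.ker g ≤ LinearMap.ker f := fun u hu => h u hu
  refine ⟨(LinearMap.ker g).liftQ f hk ∘ₗ (g.quotKerEquivOfSurjective hg).symm.toLinearMap,
    fun u => ?_⟩
  have h1 : (g.quotKerEquivOfSurjective hg).symm (u • e) = Submodule.Quotient.mk u := by
    rw [LinearEquiv.symm_apply_eq]
    rfl
  rw [LinearMap.comp_apply, LinearEquiv.coe_coe, h1]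
  rfl

/-- A cyclic module embedded in a product of modules of rank one is semi-simple. -/
theorem isSemiSimpleAB_of_solutions {e : E} (he : Submodule.span ATilde {e} = ⊤) (r : ℕ)
    (ρ : Fin r → ℂ) (y : (i : Fin r) → PowMod (ρ i))
    (h : ∀ u : ATilde, u • e = 0 ↔ ∀ i, u • y i = 0) : IsSemiSimpleAB E := by
  obtain ⟨φ, hφ⟩ := exists_linearMap_of_annihilator he (y := y)
    (fun u hu => funext fun i => (h u).mp hu i)
  refine ⟨r, fun i => ModuleCat.of ATilde (PowMod (ρ i)), fun i => ?_, φ, ?_⟩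
  · obtain ⟨h1, h2⟩ := PowMod.isSimplePole_and_rank (ρ i)
    exact ⟨⟨h1.isABModule, ModuleCat.of ATilde (PowMod (ρ i)), h1, LinearMap.id,
      Function.injective_id⟩, h2⟩
  · rw [← LinearMap.ker_eq_bot, LinearMap.ker_eq_bot']
    intro x hx
    have : x ∈ Submodule.span ATilde {e} := he ▸ Submodule.mem_top
    obtain ⟨u, rfl⟩ := Submodule.mem_span_singleton.mp this
    rw [hφ] at hx
    exact (h u).mpr fun i => congrFun hx i

end Cyclic

/-! ### The invariant -/

/-- The normalisation of the invariant. -/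
def alphaFactor (k : ℕ) (n : ℕ → ℕ) : ℂ :=
  (∏ j ∈ Finset.range (k + 1), -(n (j + 1) : ℂ)) /
    ∏ j ∈ Finset.range k, ((n (k + 1) : ℂ) - n (j + 1))

theorem alphaFactor_ne_zero {k : ℕ} {n : ℕ → ℕ} (hn : StrictMono n) : alphaFactor k n ≠ 0 := by
  refine div_ne_zero (Finset.prod_ne_zero_iff.mpr fun j _ => ?_)
    (Finset.prod_ne_zero_iff.mpr fun j hj => ?_)
  · rw [neg_ne_zero, Nat.cast_ne_zero]
    have := hn (by omega : 0 < j + 1)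
    omega
  · rw [sub_ne_zero, ne_eq, Nat.cast_inj]
    have := Finset.mem_range.mp hj
    exact (hn (by omega : j + 1 < k + 1)).ne'

/-- `y` is a normalised solution for the generator `e`, whose logarithmic term is given
by `x`. -/
structure IsAlphaSolution (k : ℕ) (μ₀ : ℂ) (n : ℕ → ℕ) {E : Type} [AddCommGroup E]
    [Module ATilde E] (e : E) (y : LogMod (μ₀ - k - 1)) (x : ℂ) : Prop where
  ann : ∀ u : ATilde, u • e = 0 → u • y = 0
  lead : (y 0).1 = 1
  vanish : ∀ m < n (k + 1), (y m).2 = 0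
  log : (y (n (k + 1))).2 = alphaFactor k n * x

/-- `x` is the invariant of `E`. -/
def HasAlpha (k : ℕ) (μ₀ : ℂ) (n : ℕ → ℕ) (E : Type) [AddCommGroup E] [Module ATilde E]
    (x : ℂ) : Prop :=
  ∃ e : E, Submodule.span ATilde {e} = ⊤ ∧ ∃ y, IsAlphaSolution k μ₀ n e y x

section NearlySemiSimple

variable {E : Type} [AddCommGroup E] [Module ATilde E] {k : ℕ} {μ₀ : ℂ} {n : ℕ → ℕ}

/-- If e = u e' and e' = v e, then u y is a solution for e. Both its leading coefficient and its
first logarithmic coefficient are multiplied by u(0), and u(0) v(0) = 1, so v(0) u y is normalised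
with the same x. -/
theorem HasAlpha.exists_solution {x : ℂ} (h : HasAlpha k μ₀ n E x) {e : E}
    (he : Submodule.span ATilde {e} = ⊤) : ∃ y, IsAlphaSolution k μ₀ n e y x := by
  obtain ⟨e', he', y, hy⟩ := h
  obtain ⟨u, hu⟩ := Submodule.mem_span_singleton.mp
    (he' ▸ Submodule.mem_top : e ∈ Submodule.span ATilde {e'})
  obtain ⟨v, hv⟩ := Submodule.mem_span_singleton.mp
    (he ▸ Submodule.mem_top : e' ∈ Submodule.span ATilde {e})
  have h1 : (v * u) • y = y := by
    have := hy.ann (v * u - 1) (by rw [sub_smul, one_smul, mul_smul, hu, hv, sub_self])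
    rwa [sub_smul, one_smul, sub_eq_zero] at this
  have h2 : v.const * u.const = 1 := by
    have := (SeqMod.smul_apply_of_vanish (v * u) y 0 (by simp)).2
    rw [h1, const_mul] at this
    have := congrArg Prod.fst this
    rw [Prod.smul_fst, hy.lead, smul_eq_mul, mul_one] at this
    exact this.symm
  have hs := SeqMod.smul_apply_of_vanish u (LogMod.snd _ y) (n (k + 1)) hy.vanish
  rw [← map_smul] at hs
  refine ⟨v.const • u • y, ⟨fun w hw => ?_, ?_, fun m hm => ?_, ?_⟩⟩
  · rw [smul_comm, smul_smul, hy.ann, smul_zero]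
    rw [mul_smul, hu, hw]
  · rw [SeqMod.smul_apply, (SeqMod.smul_apply_of_vanish u y 0 (by simp)).2, smul_smul, h2,
      one_smul, hy.lead]
  · have := hs.1 m hm
    rw [LogMod.snd_apply] at this
    rw [SeqMod.smul_apply, Prod.smul_snd, this, smul_zero]
  · have := hs.2
    rw [LogMod.snd_apply, LogMod.snd_apply] at this
    rw [SeqMod.smul_apply, Prod.smul_snd, this, smul_smul, h2, one_smul, hy.log]

theorem HasAlpha.of_equiv {E' : Type} [AddCommGroup E'] [Module ATilde E'] {x : ℂ}
    (h : HasAlpha k μ₀ n E x) (f : E ≃ₗ[ATilde] E') : HasAlpha k μ₀ n E' x := by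
  obtain ⟨e, he, y, hy⟩ := h
  refine ⟨f e, ?_, y, ⟨fun u hu => hy.ann u ?_, hy.lead, hy.vanish, hy.log⟩⟩
  · have := congrArg (Submodule.map f.toLinearMap) he
    rwa [Submodule.map_span, Set.image_singleton, Submodule.map_top, LinearEquiv.range] at this
  · rwa [← map_smul, LinearEquiv.map_eq_zero_iff] at hu

/-- The filtration of a cyclic module such that the largest proper submodule of the filtration
and the quotient by the first one are semi-simple. -/
structure IsNearlySemiSimple (k : ℕ) (μ₀ : ℂ) (n : ℕ → ℕ) (F : ℕ → Submodule ATilde E) :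
    Prop where
  filtration : IsStepFiltration (k + 2) μ₀ n F
  strictMono : StrictMono n
  zero : n 0 = 0
  cyclic : ∃ e : E, Submodule.span ATilde {e} = ⊤
  semiSimple_sub : IsSemiSimpleAB (F (k + 1))
  semiSimple_quot : IsSemiSimpleAB (E ⧸ F 1)

namespace IsNearlySemiSimple

variable {F : ℕ → Submodule ATilde E}

theorem snd_eq_zero_of_mem (h : IsNearlySemiSimple k μ₀ n F) {e : E} (he : e ∈ F (k + 1)) {ρ : ℂ}
    (y : LogMod ρ) (hy : ∀ u : ATilde, u • e ∈ F 0 → u • y = 0) (m : ℕ) : (y m).2 = 0 := by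
  refine h.semiSimple_sub.snd_eq_zero ⟨e, he⟩ y (fun u hu => hy u ?_) m
  rw [h.filtration.bot, Submodule.mem_bot]
  exact congrArg Subtype.val hu

theorem snd_eq_zero_of_one_le (h : IsNearlySemiSimple k μ₀ n F) (e : E) {i : ℕ} (hi : 1 ≤ i)
    (hik : i ≤ k + 2) {ρ : ℂ} (y : LogMod ρ) (hy : ∀ u : ATilde, u • e ∈ F i → u • y = 0)
    (m : ℕ) : (y m).2 = 0 := by
  refine h.semiSimple_quot.snd_eq_zero (Submodule.Quotient.mk e) y (fun u hu => hy u ?_) m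
  rw [← Submodule.Quotient.mk_smul, Submodule.Quotient.mk_eq_zero] at hu
  exact h.filtration.mono hi hik hu

/-- The intermediate stages have no logarithm: for i = 0 they live on submodules of F_{r-1}, for i ≥
1 they factor through E / F_1. -/
theorem exists_solution (h : IsNearlySemiSimple k μ₀ n F) {i : ℕ} (hi : i < k + 2) {e : E}
    (he : Submodule.span ATilde {e} = ⊤) {ρ : ℂ} (hρ : ρ = μ₀ + n i - k - 1) :
    ∃ y : LogMod ρ, (∀ u : ATilde, u • e ∈ F i → u • y = 0) ∧
      (∀ u : ATilde, u • e ∈ F (i + 1) → u • y = 0 → u • e ∈ F i) ∧ (y 0).1 ≠ 0 ∧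
      (∀ m < n (k + 1) - n i, (y m).2 = 0) ∧
      ((y (n (k + 1) - n i)).2 = 0 → ∀ m, (y m).2 = 0) := by
  refine h.filtration.exists_solution h.strictMono (j := k + 2) hi le_rfl ?_
    (he.trans h.filtration.top.symm) (by rw [hρ]; push_cast; ring)
  intro l hl hl' e' he' ρ' y hy
  rcases Nat.eq_zero_or_pos i with rfl | hi0
  · refine h.snd_eq_zero_of_mem (h.filtration.mono (Nat.le_of_lt_succ hl') (by omega) ?_) y hy
    rw [← he']
    exact Submodule.mem_span_singleton_self e'
  · exact h.snd_eq_zero_of_one_le e' hi0 hi.le y hy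

theorem exists_hasAlpha (h : IsNearlySemiSimple k μ₀ n F) : ∃ x, HasAlpha k μ₀ n E x := by
  obtain ⟨e, he⟩ := h.cyclic
  obtain ⟨y, hy1, -, hy3, hy4, -⟩ := h.exists_solution (i := 0) (by omega) he
    (ρ := μ₀ - k - 1) (by rw [h.zero]; push_cast; ring)
  rw [h.zero, Nat.sub_zero] at hy4
  refine ⟨((y 0).1)⁻¹ * (y (n (k + 1))).2 / alphaFactor k n, e, he, ((y 0).1)⁻¹ • y,
    ⟨fun u hu => ?_, ?_, fun m hm => ?_, ?_⟩⟩
  · rw [smul_comm, hy1, smul_zero]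
    rw [hu]
    exact zero_mem _
  · rw [SeqMod.smul_apply, Prod.smul_fst, smul_eq_mul, inv_mul_cancel₀ hy3]
  · rw [SeqMod.smul_apply, Prod.smul_snd, hy4 m hm, smul_zero]
  · rw [SeqMod.smul_apply, Prod.smul_snd, smul_eq_mul,
      mul_div_cancel₀ _ (alphaFactor_ne_zero h.strictMono)]

theorem exponent_pos (h : IsNearlySemiSimple k μ₀ n F) : 0 < n (k + 1) := by
  have := h.strictMono (by omega : 0 < k + 1)
  omega

/-- The difference of two normalised solutions vanishes at index 0, hence on F_1, so it factors
through the semi-simple E / F_1 and has no logarithm. -/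
theorem alpha_unique (h : IsNearlySemiSimple k μ₀ n F) {x x' : ℂ} (hx : HasAlpha k μ₀ n E x)
    (hx' : HasAlpha k μ₀ n E x') : x = x' := by
  obtain ⟨e, he, y, hy⟩ := hx
  obtain ⟨y', hy'⟩ := hx'.exists_solution he
  have h1 : ∀ m, ((y - y') m).2 = 0 := by
    refine h.snd_eq_zero_of_one_le e le_rfl (by omega) _ fun u hu => ?_
    refine h.filtration.smul_eq_zero_of_vanish h.zero (j := k + 2) (by omega) le_rfl
      (he.trans h.filtration.top.symm) (by push_cast; ring)
      (fun v hv => by rw [smul_sub, hy.ann v hv, hy'.ann v hv, sub_zero]) ?_ hu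
    rw [SeqMod.sub_apply]
    refine Prod.ext ?_ ?_
    · rw [Prod.fst_sub, hy.lead, hy'.lead, sub_self]; rfl
    · rw [Prod.snd_sub, hy.vanish 0 h.exponent_pos, hy'.vanish 0 h.exponent_pos, sub_zero]; rfl
  have h2 := h1 (n (k + 1))
  rw [SeqMod.sub_apply, Prod.snd_sub, hy.log, hy'.log, sub_eq_zero] at h2
  exact mul_left_cancel₀ (alphaFactor_ne_zero h.strictMono) h2

/-- If x = 0 the solution attached to the first quotient has no logarithm, and the others never have
one; together they separate the steps of the filtration and embed E. Conversely a semi-simple E has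
no logarithmic solution. -/
theorem alpha_eq_zero_iff (h : IsNearlySemiSimple k μ₀ n F) {x : ℂ} (hx : HasAlpha k μ₀ n E x) :
    x = 0 ↔ IsSemiSimpleAB E := by
  constructor
  · rintro rfl
    obtain ⟨e, he⟩ := h.cyclic
    have hsol : ∀ i : Fin (k + 2), ∃ y : LogMod (μ₀ + n i - k - 1),
        (∀ u : ATilde, u • e ∈ F i → u • y = 0) ∧
        (∀ u : ATilde, u • e ∈ F (i + 1) → u • y = 0 → u • e ∈ F i) ∧ ∀ m, (y m).2 = 0 := by
      intro i
      obtain ⟨y, hy1, hy2, hy3, hy4, hy5⟩ := h.exists_solution i.2 he rfl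
      refine ⟨y, hy1, hy2, ?_⟩
      rcases Nat.eq_zero_or_pos (i : ℕ) with hi | hi
      · refine hy5 ?_
        have hp : n (k + 1) - n i = n (k + 1) := by rw [hi, h.zero, Nat.sub_zero]
        rw [hp] at hy4 ⊢
        have hρ : μ₀ + n i - k - 1 = μ₀ - k - 1 := by rw [hi, h.zero]; push_cast; ring
        have hα : HasAlpha k μ₀ n E (((y 0).1)⁻¹ * (y (n (k + 1))).2 / alphaFactor k n) := by
          -- The shift by 0 only moves y between two equal exponents that are not definitionally
          -- equal.
          let y' : LogMod (μ₀ - k - 1) := ((y 0).1)⁻¹ • LogMod.shift 0 (by rw [hρ]; simp) y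
          have hy' : ∀ m, y' m = ((y 0).1)⁻¹ • y m := by
            intro m
            simp [y', LogMod.shift_apply]
          refine ⟨e, he, y', ⟨fun u hu => ?_, ?_, fun m hm => ?_, ?_⟩⟩
          · have h0 : u • y = 0 := hy1 u (by rw [hu]; exact zero_mem _)
            have h1 := (smul_comm u ((y 0).1)⁻¹ (LogMod.shift 0 (by rw [hρ]; simp) y :
              LogMod (μ₀ - k - 1)))
            exact h1.trans (by rw [← map_smul, h0, map_zero, smul_zero])
          · rw [hy', Prod.smul_fst, smul_eq_mul, inv_mul_cancel₀ hy3]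
          · rw [hy', Prod.smul_snd, hy4 m hm, smul_zero]
          · rw [hy', Prod.smul_snd, smul_eq_mul,
              mul_div_cancel₀ _ (alphaFactor_ne_zero h.strictMono)]
        have := h.alpha_unique hα hx
        rw [div_eq_zero_iff, or_iff_left (alphaFactor_ne_zero h.strictMono), mul_eq_zero,
          or_iff_right (inv_ne_zero hy3)] at this
        exact this
      · exact h.snd_eq_zero_of_one_le e hi i.2.le y hy1
    choose y hy1 hy2 hy3 using hsol
    let z : (i : Fin (k + 2)) → PowMod (μ₀ + n i - k - 1) := fun i m => (y i m).1
    have hz : ∀ i (u : ATilde), u • z i = 0 ↔ u • y i = 0 := by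
      intro i u
      have hyz : y i = LogMod.inl _ (z i) := LogMod.eq_inl_of_snd_eq_zero (y i) (hy3 i)
      rw [hyz, ← map_smul]
      constructor
      · intro h0
        rw [h0, map_zero]
      · intro h0
        funext m
        exact congrArg Prod.fst (congrFun h0 m)
    refine isSemiSimpleAB_of_solutions he (k + 2) _ z fun u => ⟨fun hu i => ?_, fun hu => ?_⟩
    · rw [hz]
      refine hy1 i u ?_
      rw [hu]
      exact zero_mem _
    -- The solution of index i has kernel inside F i when restricted to F (i + 1), so a common zero
    -- descends the whole filtration to 0.
    · have key : ∀ d ≤ k + 2, u • e ∈ F (k + 2 - d) := by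
        intro d
        induction d with
        | zero =>
          intro _
          rw [Nat.sub_zero, h.filtration.top]
          trivial
        | succ d ih =>
          intro hd
          have h1 := ih (by omega)
          have h2 : k + 2 - d = k + 2 - (d + 1) + 1 := by omega
          rw [h2] at h1
          exact hy2 ⟨k + 2 - (d + 1), by omega⟩ u h1 ((hz _ u).mp (hu _))
      have := key (k + 2) le_rfl
      rw [Nat.sub_self, h.filtration.bot] at this
      exact this
  · intro hE
    obtain ⟨e, he, y, hy⟩ := hx
    have := hE.snd_eq_zero e y hy.ann (n (k + 1))
    rw [hy.log, mul_eq_zero] at this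
    exact this.resolve_left (alphaFactor_ne_zero h.strictMono)

end IsNearlySemiSimple

end NearlySemiSimple

/-! ### Submodules of primitive modules and of frescos -/

section Transfer

variable {E E' : Type} [AddCommGroup E] [Module ATilde E] [AddCommGroup E'] [Module ATilde E']

theorem IsABModule.of_injective (h : IsABModule E') (f : E →ₗ[ATilde] E')
    (hf : Function.Injective f) : IsABModule E := by
  let _ := restrictB E
  let _ := restrictB E'
  have : Module.Free (PowerSeries ℂ) E' := h.free
  have : Module.Finite (PowerSeries ℂ) E' := h.finite
  let g : E →ₗ[PowerSeries ℂ] E' :=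
    { toFun := f
      map_add' := map_add f
      map_smul' := fun S x => map_smul f (ofB S) x }
  let ψ := LinearEquiv.ofInjective g hf
  exact ⟨Module.Free.of_equiv ψ.symm, Module.Finite.equiv ψ.symm⟩

theorem aeval_apply_of_comm {V V' : Type*} [AddCommGroup V] [Module ℂ V] [AddCommGroup V']
    [Module ℂ V'] (π : V →ₗ[ℂ] V') {T : Module.End ℂ V} {T' : Module.End ℂ V'}
    (h : ∀ x, π (T x) = T' (π x)) (q : ℂ[X]) (x : V) :
    π (aeval T q x) = aeval T' q (π x) := by
  have hn : ∀ (n : ℕ) x, π ((T ^ n) x) = (T' ^ n) (π x) := by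
    intro n
    induction n with
    | zero => simp
    | succ n ih => intro x; rw [pow_succ', pow_succ', Module.End.mul_apply, h, ih]; rfl
  induction q using Polynomial.induction_on' with
  | add p q hp hq => simp [hp, hq]
  | monomial n c => simp [aeval_monomial, hn]

/-! ### Bernstein polynomials and powers of b -/

section Residue

variable {W : Type} [AddCommGroup W] [Module ℂ W] [Module ATilde W] [IsScalarTower ℂ ATilde W]

theorem mk_aeval_neg_bInvA (h : IsSimplePole W) (q : ℂ[X]) (x : W) :
    (LinearMap.range (actL W b)).mkQ (aeval (-bInvA h) q x) =
      aeval (residue h) q ((LinearMap.range (actL W b)).mkQ x) := by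
  refine aeval_apply_of_comm _ (fun x => ?_) q x
  rw [residue, LinearMap.neg_apply, LinearMap.neg_apply, map_neg]
  rfl

theorem bInvA_b_pow (h : IsSimplePole W) (n : ℕ) (x : W) :
    bInvA h (b ^ n • x) = b ^ n • (bInvA h x + (n : ℂ) • x) := by
  apply h.isABModule.b_injective
  change b • bInvA h (b ^ n • x) = b • b ^ n • (bInvA h x + (n : ℂ) • x)
  have h1 : aSub 0 = a := by rw [aSub, zero_smul, sub_zero]
  have h2 : a = aSub (0 + n) + (n : ℂ) • b := by
    rw [aSub, zero_add, sub_add_cancel]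
  rw [b_bInvA]
  nth_rewrite 1 [h2]
  rw [add_smul, smul_smul, aSub_mul_b_pow, h1, mul_smul, ← b_bInvA h, smul_add, smul_add,
    smul_smul b, smul_smul b, ← pow_succ', smul_smul, ← pow_succ, smul_assoc, smul_smul,
    ← pow_succ', ← algebraMap_smul ATilde (n : ℂ) x, smul_smul, ← Algebra.commutes, mul_smul,
    algebraMap_smul]

theorem aeval_neg_bInvA_b_pow (h : IsSimplePole W) (n : ℕ) (q : ℂ[X]) (x : W) :
    aeval (-bInvA h) (q.comp (X + C (n : ℂ))) (b ^ n • x) = b ^ n • aeval (-bInvA h) q x := by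
  rw [aeval_comp]
  symm
  refine aeval_apply_of_comm (actL W (b ^ n)) (fun x => ?_) q x
  change b ^ n • (-bInvA h) x = aeval (-bInvA h) (X + C (n : ℂ)) (b ^ n • x)
  rw [map_add, aeval_X, aeval_C, LinearMap.add_apply, LinearMap.neg_apply, LinearMap.neg_apply,
    bInvA_b_pow, Module.algebraMap_end_apply, smul_add, smul_neg,
    ← algebraMap_smul ATilde (n : ℂ) x, smul_smul (b ^ n), ← Algebra.commutes, mul_smul,
    algebraMap_smul]
  abel

/-- The Bernstein polynomial B of T = -b⁻¹a sends W into bW. Because (T + n) b^n = b^n T, the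
translate B(x + n) sends b^n W into b^(n+1) W, and the product gains K powers. -/
theorem exists_prod_aeval (h : IsSimplePole W) (K : ℕ) (x : W) :
    ∃ y : W, aeval (-bInvA h)
      (∏ n ∈ Finset.range K, (bernsteinPoly h).comp (X + C (n : ℂ))) x = b ^ K • y := by
  induction K with
  | zero => exact ⟨x, by simp⟩
  | succ K ih =>
    obtain ⟨y, hy⟩ := ih
    have h1 : (LinearMap.range (actL W b)).mkQ (aeval (-bInvA h) (bernsteinPoly h) y) = 0 := by
      rw [mk_aeval_neg_bInvA, bernsteinPoly, minpoly.aeval]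
      rfl
    rw [Submodule.mkQ_apply, Submodule.Quotient.mk_eq_zero] at h1
    obtain ⟨z, hz⟩ := h1
    refine ⟨z, ?_⟩
    rw [Finset.prod_range_succ, mul_comm, map_mul, Module.End.mul_apply, hy,
      aeval_neg_bInvA_b_pow, ← hz, pow_succ, mul_smul]
    rfl

end Residue

/-- The saturation W₀ of E is found inside that of E'. A product of integer translates of the
Bernstein polynomial of W kills W₀ / b W₀, so the roots for E are integer translates of roots for
E'. -/
theorem IsPrimitive.of_injective {lam : UnitRat} (h : IsPrimitive lam E') (f : E →ₗ[ATilde] E')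
    (hf : Function.Injective f) : IsPrimitive lam E := by
  obtain ⟨hE', W, _, _, _, _, j, hj, hroot⟩ := h
  refine ⟨hE'.of_injective f hf, ?_⟩
  have hW := hj.simplePole
  have hb := hW.isABModule.b_injective
  let 𝒲 : Set (Submodule ATilde W) := {W' | LinearMap.range (j ∘ₗ f) ≤ W' ∧
    ∀ x ∈ W', ∃ y ∈ W', a • x = b • y}
  let W₀ : Submodule ATilde W := sInf 𝒲
  -- The simple pole condition passes to intersections because b is injective: the y is the same for
  -- all the submodules.
  have hW₀ : ∀ x ∈ W₀, ∃ y ∈ W₀, a • x = b • y := by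
    intro x hx
    obtain ⟨y, hy⟩ := hW.pole x
    refine ⟨y, ?_, hy⟩
    rw [Submodule.mem_sInf] at hx ⊢
    intro W' hW'
    obtain ⟨y', hy', h1⟩ := hW'.2 x (hx W' hW')
    rwa [hb (hy.symm.trans h1)]
  have hrange : ∀ x, j (f x) ∈ W₀ := by
    intro x
    rw [Submodule.mem_sInf]
    exact fun W' hW' => hW'.1 ⟨x, rfl⟩
  let j₀ : E →ₗ[ATilde] W₀ := (j ∘ₗ f).codRestrict W₀ hrange
  have hsp : IsSimplePole W₀ :=
    ⟨hW.isABModule.of_injective W₀.subtype Subtype.val_injective, fun x => by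
      obtain ⟨y, hy, h1⟩ := hW₀ x x.2
      exact ⟨⟨y, hy⟩, Subtype.ext h1⟩⟩
  have hsat : IsSaturation j₀ := by
    refine ⟨fun x y hxy => ?_, hsp, fun W' h1 h2 => ?_⟩
    · exact hf (hj.injective (congrArg Subtype.val hxy))
    · have hle : W₀ ≤ W'.map W₀.subtype := by
        refine sInf_le ⟨?_, ?_⟩
        · rintro _ ⟨x, rfl⟩
          exact ⟨j₀ x, h1 ⟨x, rfl⟩, rfl⟩
        · rintro _ ⟨x, hx, rfl⟩
          obtain ⟨y, hy, h3⟩ := h2 x hx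
          exact ⟨y, ⟨y, hy, rfl⟩, congrArg Subtype.val h3⟩
      rw [eq_top_iff]
      rintro ⟨x, hx⟩ -
      obtain ⟨y, hy, h3⟩ := hle hx
      have : y = ⟨x, hx⟩ := Subtype.ext h3
      rwa [← this]
  refine ⟨W₀, inferInstance, inferInstance, inferInstance, inferInstance, j₀, hsat, ?_⟩
  intro z hz
  obtain ⟨k, hk⟩ := hW.isABModule.exists_artinRees W₀
  have hval : ∀ (q : ℂ[X]) (x : W₀),
      ((aeval (-bInvA hsat.simplePole) q x : W₀) : W) = aeval (-bInvA hW) q (x : W) := by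
    intro q x
    refine aeval_apply_of_comm (W₀.subtype.restrictScalars ℂ) (fun x => ?_) q x
    change ((-bInvA hsat.simplePole) x : W₀).1 = (-bInvA hW) x.1
    rw [LinearMap.neg_apply, LinearMap.neg_apply, Submodule.coe_neg]
    congr 1
    apply hb
    change b • ((bInvA hsat.simplePole) x : W₀).1 = b • bInvA hW x.1
    rw [b_bInvA, ← Submodule.coe_smul, b_bInvA]
    rfl
  -- Artin-Rees for W₀ loses k powers of b; 1 + k translates leave one, so Q maps W₀ into b W₀.
  set Q : ℂ[X] := ∏ n ∈ Finset.range (1 + k), (bernsteinPoly hW).comp (X + C (n : ℂ)) with hQ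
  have hann : aeval (residue hsat.simplePole) Q = 0 := by
    ext x
    change aeval (residue hsat.simplePole) Q
      ((LinearMap.range (actL W₀ b)).mkQ x) = 0
    rw [← mk_aeval_neg_bInvA, Submodule.mkQ_apply, Submodule.Quotient.mk_eq_zero]
    obtain ⟨y, hy⟩ := exists_prod_aeval hW (1 + k) (x : W)
    rw [← hQ, ← hval] at hy
    obtain ⟨w, hw, h1⟩ := hk 1 _ (Subtype.prop _) ⟨y, hy⟩
    rw [pow_one] at h1
    exact ⟨⟨w, hw⟩, Subtype.ext h1.symm⟩
  have hdvd := minpoly.dvd ℂ _ hann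
  have h0 : Q.eval z = 0 := by
    obtain ⟨q, hq⟩ := hdvd
    have : eval z (minpoly ℂ (residue hsat.simplePole)) = 0 := hz
    rw [hq, eval_mul, this, zero_mul]
  rw [hQ, eval_prod, Finset.prod_eq_zero_iff] at h0
  obtain ⟨n, -, hn⟩ := h0
  rw [eval_comp] at hn
  obtain ⟨m, hm⟩ := hroot _ hn
  refine ⟨m - n, ?_⟩
  simp only [eval_add, eval_X, eval_C] at hm
  push_cast
  rw [← add_sub_assoc, ← hm, add_sub_cancel_right]

theorem IsFresco.of_injective (h : IsFresco E') (f : E →ₗ[ATilde] E')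
    (hf : Function.Injective f) {e : E} (he : Submodule.span ATilde {e} = ⊤) : IsFresco E := by
  obtain ⟨Λ, N, n, φ, ⟨g⟩⟩ := h
  let F : E →ₗ[ATilde] (Fin n → (l : Λ) → Xi l N) :=
    (Submodule.span ATilde {φ}).subtype ∘ₗ g.toLinearMap ∘ₗ f
  have hF : Function.Injective F := Subtype.val_injective.comp (g.injective.comp hf)
  have hr : LinearMap.range F = Submodule.span ATilde {F e} := by
    rw [← Submodule.map_top, ← he, Submodule.map_span, Set.image_singleton]
  exact ⟨Λ, N, n, F e, ⟨(LinearEquiv.ofInjective F hF).trans (LinearEquiv.ofEq _ _ hr)⟩⟩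

theorem IsFresco.exists_generator (h : IsFresco E) :
    ∃ e : E, Submodule.span ATilde {e} = ⊤ := by
  obtain ⟨Λ, N, n, φ, ⟨g⟩⟩ := h
  refine ⟨g.symm ⟨φ, Submodule.mem_span_singleton_self φ⟩, eq_top_iff.mpr fun x _ => ?_⟩
  obtain ⟨u, hu⟩ := Submodule.mem_span_singleton.mp (g x).2
  rw [Submodule.mem_span_singleton]
  refine ⟨u, ?_⟩
  rw [← map_smul, LinearEquiv.symm_apply_eq]
  exact Subtype.ext hu

end Transfer

/-! ### The set `F₀` -/

section FZero

variable {E E' : Type} [AddCommGroup E] [Module ATilde E] [AddCommGroup E'] [Module ATilde E']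

theorem IsStep.comap {F F' : Submodule ATilde E'} {μ : ℂ} (h : IsStep F F' μ)
    (g : E →ₗ[ATilde] E') (hg : F' ≤ LinearMap.range g) :
    IsStep (F.comap g) (F'.comap g) μ := by
  obtain ⟨h0, x, hx, h1, h2⟩ := h
  obtain ⟨x, rfl⟩ := hg hx
  refine ⟨Submodule.comap_mono h0, x, hx, fun y hy => ?_, fun u => ?_⟩
  · obtain ⟨u, hu⟩ := h1 _ hy
    exact ⟨u, by rwa [Submodule.mem_comap, map_sub, map_smul]⟩
  · rw [← h2, Submodule.mem_comap, map_smul]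

theorem IsPrincipalJH.isStep {k : ℕ} {μ : Fin k → ℚ} {F : Fin (k + 1) → Submodule ATilde E}
    (h : IsPrincipalJH μ F) (j : Fin k) : IsStep (F j.castSucc) (F j.succ) ((μ j : ℚ) : ℂ) := by
  obtain ⟨f⟩ := h.quot j
  exact isStep_of_equiv (h.mono (Fin.castSucc_le_succ j)) f

theorem IsPrincipalJH.comap_equiv {k : ℕ} {μ : Fin k → ℚ}
    {F : Fin (k + 1) → Submodule ATilde E'} (h : IsPrincipalJH μ F) (g : E ≃ₗ[ATilde] E') :
    IsPrincipalJH μ fun j => (F j).comap g.toLinearMap := by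
  refine ⟨?_, ?_, fun i j hij => Submodule.comap_mono (h.mono hij), fun j => ?_, fun j =>
    ((h.isStep j).comap g.toLinearMap (by rw [LinearEquiv.range]; exact le_top)).nonempty_equiv, h.principal⟩
  · rw [h.bot, Submodule.comap_bot, LinearEquiv.ker]
  · rw [h.top, Submodule.comap_top]
  · ext x
    have h1 := Set.ext_iff.mp (h.normal j) (g x)
    simp only [Set.mem_ofPred_eq, Submodule.mem_comap, LinearEquiv.coe_coe] at h1 ⊢
    constructor
    · rintro ⟨hx, y, rfl⟩
      obtain ⟨z, hz, h2⟩ := h1.mp ⟨hx, g y, map_smul g b y⟩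
      refine ⟨g.symm z, by rwa [LinearEquiv.apply_symm_apply], ?_⟩
      apply g.injective
      rw [h2, map_smul, LinearEquiv.apply_symm_apply]
    · rintro ⟨y, hy, rfl⟩
      exact ⟨(h1.mpr ⟨g y, hy, map_smul g b y⟩).1, y, rfl⟩

theorem IsSemiSimpleAB.comap_equiv {F : Submodule ATilde E'} (h : IsSemiSimpleAB F)
    (g : E ≃ₗ[ATilde] E') : IsSemiSimpleAB (F.comap g.toLinearMap) :=
  h.of_injective ((g.toLinearMap.domRestrict (F.comap g.toLinearMap)).codRestrict F
    fun x => x.2) fun _ _ hxy => Subtype.ext (g.injective (congrArg Subtype.val hxy))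

theorem IsSemiSimpleAB.quotient_comap {F : Submodule ATilde E'} (h : IsSemiSimpleAB (E' ⧸ F))
    (g : E →ₗ[ATilde] E') : IsSemiSimpleAB (E ⧸ F.comap g) := by
  refine h.of_injective (Submodule.mapQ _ _ g le_rfl) ?_
  rw [← LinearMap.ker_eq_bot, Submodule.ker_mapQ, Submodule.mkQ_map_self]

theorem isoClass_eq_iff : isoClass E = isoClass E' ↔ Nonempty (E ≃ₗ[ATilde] E') :=
  Quotient.eq (r := isoSetoid)

/-- All the defining conditions are transported along isomorphisms, so the representative may be
taken to be E itself. -/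
theorem isoClass_mem_F₀_iff {lam : UnitRat} {k : ℕ} {t : Invariants k} :
    isoClass E ∈ F₀ lam t ↔ IsFresco E ∧ IsPrimitive lam E ∧
      ∃ F : Fin (k + 3) → Submodule ATilde E, IsPrincipalJH t.val F ∧
        IsSemiSimpleAB (F (Fin.last (k + 1)).castSucc) ∧ IsSemiSimpleAB (E ⧸ F 1) := by
  constructor
  · rintro ⟨E', h, hf, hp, F, h1, h2, h3⟩
    obtain ⟨g⟩ := isoClass_eq_iff.mp h.symm
    obtain ⟨e, he⟩ := hf.exists_generator
    refine ⟨hf.of_injective g.toLinearMap g.injective (e := g.symm e) ?_,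
      hp.of_injective g.toLinearMap g.injective, _, h1.comap_equiv g, h2.comap_equiv g,
      h3.quotient_comap g.toLinearMap⟩
    have := congrArg (Submodule.map g.symm.toLinearMap) he
    rwa [Submodule.map_span, Set.image_singleton, Submodule.map_top, LinearEquiv.range] at this
  · rintro ⟨hf, hp, F, h1, h2, h3⟩
    exact ⟨ModuleCat.of ATilde E, rfl, hf, hp, F, h1, h2, h3⟩

/-! ### Exponents -/

theorem Invariants.exists_exponent {k : ℕ} (t : Invariants k) :
    ∃ n : ℕ → ℕ, StrictMono n ∧ n 0 = 0 ∧
      ∀ j : Fin (k + 2), t.val j = t.val 0 + n j - (j : ℕ) := by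
  choose p hp h using t.step
  -- The exponents are the partial sums of the p_j; the default 1 keeps them strictly increasing on
  -- all of ℕ.
  let p' : ℕ → ℕ := fun i => if h : i < k + 1 then p ⟨i, h⟩ else 1
  have hp' : ∀ i, 1 ≤ p' i := by
    intro i
    by_cases hi : i < k + 1
    · simp only [p', dif_pos hi]; exact hp _
    · simp only [p', dif_neg hi]; exact le_rfl
  refine ⟨fun j => ∑ i ∈ Finset.range j, p' i, strictMono_nat_of_lt_succ fun j => ?_, by simp,
    fun j => ?_⟩
  · change ∑ i ∈ Finset.range j, p' i < ∑ i ∈ Finset.range (j + 1), p' i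
    rw [Finset.sum_range_succ]
    have := hp' j
    omega
  · induction j using Fin.induction with
    | zero => simp
    | succ j ih =>
      rw [h j, ih, Fin.val_succ]
      beta_reduce
      rw [Finset.sum_range_succ]
      simp only [p', dif_pos j.2, Fin.val_castSucc]
      push_cast
      ring

/-- The exponents of the series annihilated by a generator of a module with the given
invariants, up to a constant. -/
def Invariants.exponent {k : ℕ} (t : Invariants k) : ℕ → ℕ := t.exists_exponent.choose

namespace Invariants

variable {k : ℕ} (t : Invariants k)

theorem exponent_strictMono : StrictMono t.exponent := t.exists_exponent.choose_spec.1

theorem exponent_zero : t.exponent 0 = 0 := t.exists_exponent.choose_spec.2.1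

theorem val_eq (j : Fin (k + 2)) : t.val j = t.val 0 + t.exponent j - (j : ℕ) :=
  t.exists_exponent.choose_spec.2.2 j

theorem val_eq_complex (j : Fin (k + 2)) :
    ((t.val j : ℚ) : ℂ) = ((t.val 0 : ℚ) : ℂ) + t.exponent j - (j : ℕ) := by
  rw [t.val_eq j]
  push_cast
  rfl

theorem exponent_eq_of_val_eq {j : Fin (k + 2)} {m : ℕ}
    (h : t.val j = t.val 0 + m - (j : ℕ)) : t.exponent j = m := by
  rw [t.val_eq j] at h
  have : (t.exponent j : ℚ) = m := by linarith
  exact_mod_cast this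

theorem principal : Monotone fun j : Fin (k + 2) => t.val j + ((j : ℕ) : ℚ) := by
  intro i j hij
  change t.val i + ((i : ℕ) : ℚ) ≤ t.val j + ((j : ℕ) : ℚ)
  rw [t.val_eq i, t.val_eq j, sub_add_cancel, sub_add_cancel, add_le_add_iff_left, Nat.cast_le]
  exact t.exponent_strictMono.monotone hij

end Invariants

/-- A filtration indexed by the natural numbers. -/
def extendFiltration {k : ℕ} (F : Fin (k + 3) → Submodule ATilde E) (j : ℕ) :
    Submodule ATilde E :=
  if h : j < k + 3 then F ⟨j, h⟩ else ⊤

theorem extendFiltration_of_lt {k : ℕ} (F : Fin (k + 3) → Submodule ATilde E) {j : ℕ}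
    (h : j < k + 3) : extendFiltration F j = F ⟨j, h⟩ := dif_pos h

theorem IsPrincipalJH.isStepFiltration {k : ℕ} {t : Invariants k}
    {F : Fin (k + 3) → Submodule ATilde E} (h : IsPrincipalJH t.val F) :
    IsStepFiltration (k + 2) ((t.val 0 : ℚ) : ℂ) t.exponent (extendFiltration F) := by
  refine ⟨?_, ?_, fun j hj => ?_⟩
  · rw [extendFiltration_of_lt F (by omega)]
    exact h.bot
  · rw [extendFiltration_of_lt F (by omega)]
    exact h.top
  · rw [extendFiltration_of_lt F (by omega), extendFiltration_of_lt F (by omega)]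
    have := h.isStep ⟨j, hj⟩
    rw [t.val_eq_complex] at this
    exact this

theorem IsPrincipalJH.isNearlySemiSimple {k : ℕ} {t : Invariants k}
    {F : Fin (k + 3) → Submodule ATilde E} (h : IsPrincipalJH t.val F) (hE : IsFresco E)
    (h1 : IsSemiSimpleAB (F (Fin.last (k + 1)).castSucc)) (h2 : IsSemiSimpleAB (E ⧸ F 1)) :
    IsNearlySemiSimple k ((t.val 0 : ℚ) : ℂ) t.exponent (extendFiltration F) where
  filtration := h.isStepFiltration
  strictMono := t.exponent_strictMono
  zero := t.exponent_zero
  cyclic := hE.exists_generator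
  semiSimple_sub := by
    rw [extendFiltration_of_lt F (by omega)]
    exact h1
  semiSimple_quot := by
    rw [extendFiltration_of_lt F (by omega)]
    exact h2

/-- All the principal sequences of a module of `F₀` have the defining properties of `F₀`. -/
theorem IsPrincipalJH.isNearlySemiSimple_of_mem {lam : UnitRat} {k : ℕ} {t : Invariants k}
    {F : Fin (k + 3) → Submodule ATilde E} (h : IsPrincipalJH t.val F)
    (hE : isoClass E ∈ F₀ lam t) :
    IsNearlySemiSimple k ((t.val 0 : ℚ) : ℂ) t.exponent (extendFiltration F) := by
  obtain ⟨hf, -, F', h', h1, h2⟩ := isoClass_mem_F₀_iff.mp hE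
  obtain ⟨e, he⟩ := hf.exists_generator
  have hFF' : F = F' := by
    funext j
    have := h.isStepFiltration.unique h'.isStepFiltration t.exponent_strictMono.monotone he
      (Nat.le_of_lt_succ j.2)
    rwa [extendFiltration_of_lt F j.2, extendFiltration_of_lt F' j.2] at this
  subst hFF'
  exact h.isNearlySemiSimple hf h1 h2

end FZero

/-! ### Modules of rank two -/

/-- The solution of the module of rank two of parameter `x`. -/
def rankTwoSolution (ρ : ℂ) (p : ℕ) (x : ℂ) : LogMod ρ := fun m =>
  if m = 0 then (1, 0) else if m = p then (0, -p * x) else 0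

/-- a - (ρ + p) b sends b^ρ (1 - p x b^p Log b) to -p b (1 + x b^p) b^ρ. The inverse series reduces
this to -p b^(ρ+1), which a - (ρ + 1) b kills. -/
theorem rankTwo_smul_solution (ρ : ℂ) {p : ℕ} (hp : 1 ≤ p) (x : ℂ) :
    (aSub (ρ + 1) * ofB (1 + PowerSeries.C x * PowerSeries.X ^ p)⁻¹ * aSub (ρ + p)) •
      rankTwoSolution ρ p x = 0 := by
  set V : PowerSeries ℂ := 1 + PowerSeries.C x * PowerSeries.X ^ p with hV
  have hV0 : PowerSeries.constantCoeff V ≠ 0 := by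
    have : p ≠ 0 := by omega
    simp [hV, this]
  have h1 : aSub (ρ + p) • rankTwoSolution ρ p x =
      LogMod.inl ρ ((-p : ℂ) • b • ofB V • PowMod.gen ρ) := by
    funext m
    rcases m with _ | m
    · rw [SeqMod.aSub_smul_zero, LogMod.inl_apply, SeqMod.smul_apply, SeqMod.b_smul_zero,
        smul_zero]
      rfl
    · rw [LogMod.aSub_smul_succ, LogMod.inl_apply, SeqMod.smul_apply, SeqMod.b_smul_succ,
        PowMod.ofB_smul_gen, hV]
      rcases m with _ | m
      · have h0 : p ≠ 0 := by omega
        have h0' : (0 : ℕ) ≠ p := by omega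
        simp [rankTwoSolution, h0]
      · by_cases hm : m + 1 = p
        · subst hm
          simp [rankTwoSolution, PowerSeries.coeff_X_pow, PowerSeries.coeff_one,
            PowerSeries.coeff_C_mul]
        · simp [rankTwoSolution, PowerSeries.coeff_X_pow, PowerSeries.coeff_one,
            PowerSeries.coeff_C_mul, hm]
  have hb : ∀ S, b * ofB S = ofB S * b := fun S => by
    have := b_pow_mul_ofB 1 S
    rwa [pow_one] at this
  have h2 : aSub (ρ + 1) * b = b * aSub ρ := by
    have := aSub_mul_b_pow ρ 1
    rwa [pow_one, Nat.cast_one] at this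
  rw [mul_smul, h1, ← map_smul, mul_smul, smul_comm (ofB V⁻¹), smul_smul b, hb, mul_smul,
    smul_smul (ofB V⁻¹), ofB_inv_mul hV0, one_smul, smul_comm (aSub (ρ + 1)), smul_smul, h2,
    mul_smul, PowMod.aSub_smul_gen, smul_zero, smul_zero, map_zero]

section RankTwo

variable {E : Type} [AddCommGroup E] [Module ATilde E]

theorem hasAlpha_of_equiv_rankTwo {μ₀ : ℂ} {n : ℕ → ℕ} (hn : 1 ≤ n 1) {x : ℂ}
    (f : E ≃ₗ[ATilde] CyclicMod (aSub μ₀ *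
      ofB (1 + PowerSeries.C x * PowerSeries.X ^ n 1)⁻¹ * aSub (μ₀ + n 1 - 1))) :
    HasAlpha 0 μ₀ n E x := by
  refine HasAlpha.of_equiv ⟨Submodule.Quotient.mk 1, ?_, rankTwoSolution _ (n 1) x,
    ⟨fun u hu => ?_, ?_, fun m hm => ?_, ?_⟩⟩ f.symm
  · rw [eq_top_iff]
    rintro y -
    obtain ⟨u, rfl⟩ := Submodule.Quotient.mk_surjective _ y
    rw [Submodule.mem_span_singleton]
    exact ⟨u, by rw [← Submodule.Quotient.mk_smul, smul_eq_mul, mul_one]⟩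
  · rw [← Submodule.Quotient.mk_smul, smul_eq_mul, mul_one, mem_cyclic_iff] at hu
    obtain ⟨q, rfl⟩ := hu
    have := rankTwo_smul_solution (μ₀ - (0 : ℕ) - 1) hn x
    have e1 : μ₀ - (0 : ℕ) - 1 + 1 = μ₀ := by push_cast; ring
    have e2 : μ₀ - (0 : ℕ) - 1 + (n 1 : ℂ) = μ₀ + n 1 - 1 := by push_cast; ring
    rw [e1, e2] at this
    rw [mul_smul, this, smul_zero]
  · rfl
  · have : m ≠ n 1 := by
      rw [zero_add] at hm
      exact hm.ne
    by_cases h0 : m = 0 <;> simp [rankTwoSolution, h0, this]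
  · have : n 1 ≠ 0 := by omega
    simp [rankTwoSolution, this, alphaFactor]

/-! ### Normal form and exchange of two consecutive steps -/

namespace IsStepFiltration

variable {r : ℕ} {μ₀ : ℂ} {n : ℕ → ℕ} {F : ℕ → Submodule ATilde E}

theorem normal_annihilator (hF : IsStepFiltration r μ₀ n F) {j : ℕ} (hj : j + 2 ≤ r) {e h : E}
    {V : PowerSeries ℂ} (hV : PowerSeries.constantCoeff V ≠ 0)
    (he : Submodule.span ATilde {e} = F (j + 2)) (hh : Submodule.span ATilde {h} = F (j + 1))
    (h1 : aSub (μ₀ + n (j + 1) - (j + 1 : ℕ)) • e - ofB V • h ∈ F j)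
    (h2 : aSub (μ₀ + n j - j) • h ∈ F j) (u : ATilde) :
    u • e ∈ F j ↔ ∃ q, u = q * (aSub (μ₀ + n j - j) * ofB V⁻¹ *
      aSub (μ₀ + n (j + 1) - (j + 1 : ℕ))) := by
  set μ := μ₀ + n j - j
  set ν := μ₀ + n (j + 1) - (j + 1 : ℕ)
  have hhF : h ∈ F (j + 1) := hh ▸ Submodule.mem_span_singleton_self h
  have hle := (hF.step j (by omega)).1
  have h3 : aSub ν • e ∈ F (j + 1) := by
    have := add_mem (hle h1) (Submodule.smul_mem _ (ofB V) hhF)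
    rwa [sub_add_cancel] at this
  have h4 := ((hF.step (j + 1) (by omega)).of_aSub_mem he h3).1
  have h5 := ((hF.step j (by omega)).of_aSub_mem hh h2).1
  constructor
  · intro hu
    obtain ⟨q, rfl⟩ := (h4 u).mp (hle hu)
    have h6 := sub_mem hu (Submodule.smul_mem _ q h1)
    rw [mul_smul, smul_sub, sub_sub_cancel, smul_smul] at h6
    obtain ⟨q', hq'⟩ := (h5 _).mp h6
    refine ⟨q', ?_⟩
    rw [← mul_assoc, ← mul_assoc, ← hq', mul_assoc q, ofB_mul_inv hV, mul_one]
  · rintro ⟨q, rfl⟩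
    have h6 := Submodule.smul_mem _ (aSub μ * ofB V⁻¹) h1
    rw [smul_sub, smul_smul, smul_smul, mul_assoc (aSub μ) (ofB V⁻¹) (ofB V), ofB_inv_mul hV,
      mul_one] at h6
    have h7 := add_mem h6 h2
    rw [sub_add_cancel] at h7
    rw [mul_smul]
    exact Submodule.smul_mem _ _ h7

theorem constantCoeff_ne_zero {p : ℕ} (hp : 1 ≤ p) (x : ℂ) :
    PowerSeries.constantCoeff (1 + PowerSeries.C x * PowerSeries.X ^ p) ≠ 0 := by
  have : p ≠ 0 := by omega
  simp [this]

/-- The classification of the cyclic modules of rank two. -/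
theorem exists_equiv_rankTwo (hF : IsStepFiltration 2 μ₀ n F) (hn : StrictMono n) (hn0 : n 0 = 0)
    {e : E} (he : Submodule.span ATilde {e} = ⊤) :
    ∃ x : ℂ, Nonempty (E ≃ₗ[ATilde] CyclicMod (aSub μ₀ *
      ofB (1 + PowerSeries.C x * PowerSeries.X ^ n 1)⁻¹ * aSub (μ₀ + n 1 - 1))) := by
  obtain ⟨e', h, x, h1, h2, h3, h4⟩ := hF.exists_normal_generator hn (j := 0) le_rfl
    (he.trans hF.top.symm)
  have h5 := hF.normal_annihilator (j := 0) le_rfl (constantCoeff_ne_zero (by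
    have := hn (by omega : 0 < 0 + 1)
    omega) x) h1 h2 h3 h4
  have hn1 : n (0 + 1) - n 0 = n 1 := by rw [hn0]; rfl
  have e1 : μ₀ + n 0 - (0 : ℕ) = μ₀ := by rw [hn0]; push_cast; ring
  have e2 : μ₀ + n (0 + 1) - (0 + 1 : ℕ) = μ₀ + n 1 - 1 := by push_cast; ring
  rw [hn1, e1, e2] at h5
  rw [hF.top] at h1
  refine ⟨x, ?_⟩
  let g := LinearMap.toSpanSingleton ATilde E e'
  have hg : Function.Surjective g := by
    intro y
    have : y ∈ Submodule.span ATilde {e'} := h1 ▸ Submodule.mem_top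
    exact Submodule.mem_span_singleton.mp this
  have hker : LinearMap.ker g = Submodule.span ATilde {aSub μ₀ *
      ofB (1 + PowerSeries.C x * PowerSeries.X ^ n 1)⁻¹ * aSub (μ₀ + n 1 - 1)} := by
    ext u
    rw [Submodule.mem_span_singleton]
    have := h5 u
    rw [hF.bot, Submodule.mem_bot] at this
    exact this.trans ⟨fun ⟨q, h⟩ => ⟨q, h.symm⟩, fun ⟨q, h⟩ => ⟨q, h.symm⟩⟩
  exact ⟨(g.quotKerEquivOfSurjective hg).symm.trans (Submodule.quotEquivOfEq _ _ hker)⟩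

/-- Two consecutive steps with a generator of the split form. -/
theorem swap_generator (hF : IsStepFiltration r μ₀ n F) (hn : StrictMono n) {j : ℕ}
    (hj : j + 2 ≤ r) {e : E} (he : Submodule.span ATilde {e} = F (j + 2))
    (h : (aSub (μ₀ + n j - j) * aSub (μ₀ + n (j + 1) - (j + 1 : ℕ))) • e ∈ F j) :
    F j ≤ Submodule.span ATilde {aSub (μ₀ + n j - j - 1) • e} ∧
      ∀ u : ATilde, u • aSub (μ₀ + n j - j - 1) • e ∈ F j ↔
        ∃ q, u = q * aSub (μ₀ + n (j + 1) - (j + 1 : ℕ) + 1) := by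
  have hst := hF.step j (by omega)
  have hst' := hF.step (j + 1) (by omega)
  have hd : n j < n (j + 1) := hn (by omega)
  have hμν : μ₀ + n (j + 1) - (j + 1 : ℕ) = (μ₀ + n j - j - 1) + ((n (j + 1) - n j : ℕ) : ℂ) := by
    rw [Nat.cast_sub hd.le]; push_cast; ring
  rw [hμν] at hst' h ⊢
  set d := n (j + 1) - n j
  have hd0 : d ≠ 0 := by omega
  set μ := μ₀ + n j - j
  set ν := μ - 1 + (d : ℂ) with hν
  obtain ⟨y, hy0, hy⟩ := hst'.exists_solution he
  -- The split product multiplies the coefficient of index m by (d + m) m, so the solution modulo F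
  -- (j + 1) is a multiple of b^ν.
  have hym : ∀ m, 0 < m → y m = 0 := by
    intro m hm
    have h1 := congrFun ((hy _).mp (hst.1 h)) (m + 2)
    rw [mul_smul, PowMod.aSub_smul_succ, PowMod.aSub_smul_succ] at h1
    have h2 : ν + ((m + 1 : ℕ) : ℂ) - μ = ((d + m : ℕ) : ℂ) := by
      rw [hν]; push_cast; ring
    rw [h2, add_sub_cancel_left] at h1
    have h3 : ((d + m : ℕ) : ℂ) ≠ 0 := Nat.cast_ne_zero.mpr (by omega)
    have h4 : (m : ℂ) ≠ 0 := Nat.cast_ne_zero.mpr (by omega)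
    exact (mul_eq_zero.mp ((mul_eq_zero.mp h1).resolve_left h3)).resolve_left h4
  have h1 : aSub ν • e ∈ F (j + 1) := by
    rw [hy]
    funext m
    rcases m with _ | m
    · exact SeqMod.aSub_smul_zero _ _
    · rw [PowMod.aSub_smul_succ, add_sub_cancel_left]
      rcases Nat.eq_zero_or_pos m with rfl | hm
      · simp
      · rw [hym m hm, mul_zero]; rfl
  have h2 := (hst'.of_aSub_mem he h1).2
  rw [mul_smul] at h
  have h3 := (hst.of_aSub_mem h2 h).2
  -- The exchange rule puts a - (μ - 1) b next to e, with ν + 1 as the new parameter over F j.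
  have hswap : aSub (ν + 1) * aSub (μ - 1) = aSub μ * aSub ν := by
    rw [aSub_mul_aSub, aSub_mul_aSub]
    congr 1
    · congr 2; ring
    · congr 1; ring
  have hmem : (aSub (ν + 1)) • aSub (μ - 1) • e ∈ F j := by
    rwa [smul_smul, hswap, mul_smul]
  refine ⟨?_, fun u => ⟨fun hu => ?_, ?_⟩⟩
  · rw [← h3, Submodule.span_singleton_le_iff_mem, smul_smul, ← hswap, mul_smul]
    exact Submodule.smul_mem _ _ (Submodule.mem_span_singleton_self _)
  · obtain ⟨q, R, rfl⟩ := exists_eq_mul_aSub_add (ν + 1) u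
    rw [add_smul, mul_smul] at hu
    have hR := hst.1 ((Submodule.add_mem_iff_right _ (Submodule.smul_mem _ q hmem)).mp hu)
    rw [smul_smul, hy, mul_smul] at hR
    have hz : ∀ m, m ≠ 1 → (aSub (μ - 1) • y) m = 0 := by
      intro m hm
      rcases m with _ | m
      · exact SeqMod.aSub_smul_zero _ _
      · rw [PowMod.aSub_smul_succ, hym m (by omega), mul_zero]
    have hz1 : (aSub (μ - 1) • y) 1 ≠ 0 := by
      rw [PowMod.aSub_smul_succ]
      refine mul_ne_zero ?_ hy0
      have : ν + ((0 : ℕ) : ℂ) - (μ - 1) = d := by rw [hν]; push_cast; ring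
      rw [this]
      exact_mod_cast hd0
    -- (a - (μ - 1) b) y is d times y 0 at index 1 and zero elsewhere; as d ≠ 0, a series in b acts
    -- on it freely.
    have hR0 : R = 0 := by
      ext m
      have h5 := congrFun hR (m + 1)
      rw [SeqMod.ofB_smul_apply, Finset.sum_eq_single m] at h5
      · rw [Nat.add_sub_cancel_left] at h5
        rw [map_zero]
        exact (mul_eq_zero.mp h5).resolve_right hz1
      · intro i hi him
        have := Finset.mem_range.mp hi
        rw [hz _ (by omega), smul_zero]
      · intro hm
        exact absurd (Finset.mem_range.mpr (by omega)) hm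
    exact ⟨q, by rw [hR0, map_zero, add_zero]⟩
  · rintro ⟨q, rfl⟩
    rw [mul_smul]
    exact Submodule.smul_mem _ _ hmem

end IsStepFiltration

/-- A generator of the split form exists in rank at least three. -/
theorem IsNearlySemiSimple.exists_split_generator {k : ℕ} {μ₀ : ℂ} {n : ℕ → ℕ}
    {F : ℕ → Submodule ATilde E} (h : IsNearlySemiSimple (k + 1) μ₀ n F) :
    ∃ e : E, Submodule.span ATilde {e} = ⊤ ∧
      (aSub (μ₀ + n (k + 1) - (k + 1 : ℕ)) * aSub (μ₀ + n (k + 2) - (k + 2 : ℕ))) • e ∈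
        F (k + 1) := by
  obtain ⟨e₀, he₀⟩ := h.cyclic
  obtain ⟨e, g, x, h1, h2, h3, h4⟩ := h.filtration.exists_normal_generator h.strictMono
    (j := k + 1) le_rfl (he₀.trans h.filtration.top.symm)
  have hd : n (k + 1) < n (k + 1 + 1) := h.strictMono (by omega)
  have hp : 1 ≤ n (k + 1 + 1) - n (k + 1) := by omega
  -- The solution of rank two with parameter x is killed by the annihilator of e modulo F (k + 1),
  -- so it factors through the semi-simple E / F 1. Its logarithmic coefficient -p x must vanish.
  have hx : x = 0 := by
    have h5 := h.filtration.normal_annihilator (j := k + 1) le_rfl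
      (IsStepFiltration.constantCoeff_ne_zero hp x) h1 h2 h3 h4
    have h6 := rankTwo_smul_solution (μ₀ + n (k + 1) - (k + 1 : ℕ) - 1) hp x
    have e2 : μ₀ + n (k + 1) - (k + 1 : ℕ) - 1 + ((n (k + 1 + 1) - n (k + 1) : ℕ) : ℂ) =
        μ₀ + n (k + 1 + 1) - (k + 1 + 1 : ℕ) := by
      rw [Nat.cast_sub hd.le]; push_cast; ring
    rw [sub_add_cancel, e2] at h6
    have h7 := h.snd_eq_zero_of_one_le e (i := k + 1) (by omega) (by omega)
      (rankTwoSolution (μ₀ + n (k + 1) - (k + 1 : ℕ) - 1) (n (k + 1 + 1) - n (k + 1)) x)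
      (fun u hu => by
        obtain ⟨q, rfl⟩ := (h5 u).mp hu
        rw [mul_smul, h6, smul_zero]) (n (k + 1 + 1) - n (k + 1))
    have h8 : n (k + 1 + 1) - n (k + 1) ≠ 0 := by omega
    generalize n (k + 1 + 1) - n (k + 1) = p at h7 h8
    simpa [rankTwoSolution, h8] using h7
  refine ⟨e, h1.trans h.filtration.top, ?_⟩
  have h5 := Submodule.smul_mem _ (aSub (μ₀ + n (k + 1) - (k + 1 : ℕ))) h3
  rw [hx, map_zero, zero_mul, add_zero, map_one, one_smul, smul_sub, smul_smul] at h5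
  have := add_mem h5 h4
  rwa [sub_add_cancel] at this

/-- The invariant of the submodule generated by `(a - (μ_{r-1} - 1) b) e`. -/
theorem HasAlpha.submodule {k : ℕ} {μ₀ : ℂ} {n n' : ℕ → ℕ} (hn : StrictMono n) (hn0 : n 0 = 0)
    (hn' : ∀ j < k + 1, n' j = n j) (hn'k : n' (k + 1) = n (k + 2)) {x : ℂ}
    (h : HasAlpha (k + 1) μ₀ n E x) {e : E} (he : Submodule.span ATilde {e} = ⊤) {c : ℂ}
    (hc : c = μ₀ + n (k + 1) - (k + 1 : ℕ) - 1) :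
    HasAlpha k μ₀ n' (Submodule.span ATilde {aSub c • e} : Submodule ATilde E) x := by
  obtain ⟨y, hy⟩ := h.exists_solution he
  have hn1 : (n (k + 1) : ℂ) ≠ 0 := by
    have := hn (by omega : 0 < k + 1)
    exact_mod_cast (by omega : n (k + 1) ≠ 0)
  have hn2 : n (k + 1) < n (k + 2) := hn (by omega)
  -- (a - c b) y = b z. At index 0 the factor is -n (k + 1), at the first logarithm it is n (k + 2)
  -- - n (k + 1); dividing by the former normalises z.
  let z : LogMod (μ₀ - k - 1) := fun m =>
    (((m : ℂ) - n (k + 1)) * (y m).1 + (y m).2, ((m : ℂ) - n (k + 1)) * (y m).2)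
  have hρ : μ₀ - k - 1 = μ₀ - (k + 1 : ℕ) - 1 + (1 : ℕ) := by push_cast; ring
  have hz : aSub c • y = LogMod.shift 1 hρ z := by
    funext m
    rcases m with _ | m
    · rw [SeqMod.aSub_smul_zero, LogMod.shift_apply, if_neg (by omega)]
    · rw [LogMod.aSub_smul_succ, LogMod.shift_apply, if_pos (by omega), Nat.add_sub_cancel]
      have : μ₀ - (k + 1 : ℕ) - 1 + m - c = m - n (k + 1) := by
        rw [hc]; push_cast; ring
      rw [this]
  let g : (Submodule.span ATilde {aSub c • e} : Submodule ATilde E) :=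
    ⟨aSub c • e, Submodule.mem_span_singleton_self _⟩
  refine ⟨g, ?_, (-(n (k + 1) : ℂ))⁻¹ • z, ⟨fun u hu => ?_, ?_, fun m hm => ?_, ?_⟩⟩
  · rw [eq_top_iff]
    rintro ⟨w, hw⟩ -
    obtain ⟨u, rfl⟩ := Submodule.mem_span_singleton.mp hw
    exact Submodule.mem_span_singleton.mpr ⟨u, rfl⟩
  · have h1 : u • aSub c • e = 0 := congrArg Subtype.val hu
    rw [smul_smul] at h1
    have h2 := hy.ann _ h1
    rw [mul_smul, hz, ← map_smul] at h2
    have h3 : u • z = 0 := LogMod.shift_injective 1 hρ (by rw [h2, map_zero])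
    rw [smul_comm, h3, smul_zero]
  · rw [SeqMod.smul_apply, Prod.smul_fst]
    simp only [z]
    rw [hy.lead, hy.vanish 0 (by have := hn2; change 0 < n (k + 2); omega), smul_eq_mul]
    simp only [CharP.cast_eq_zero, zero_sub, mul_one, add_zero]
    exact inv_mul_cancel₀ (neg_ne_zero.mpr hn1)
  · rw [SeqMod.smul_apply, Prod.smul_snd]
    simp only [z]
    rw [hy.vanish m (by rwa [hn'k] at hm), mul_zero, smul_zero]
  · rw [SeqMod.smul_apply, Prod.smul_snd, hn'k]
    simp only [z]
    rw [hy.log]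
    have h1 : ∏ j ∈ Finset.range k, ((n (k + 2) : ℂ) - n (j + 1)) ≠ 0 := by
      rw [Finset.prod_ne_zero_iff]
      intro j hj
      have := Finset.mem_range.mp hj
      rw [sub_ne_zero, ne_eq, Nat.cast_inj]
      exact (hn (by omega : j + 1 < k + 2)).ne'
    have h2 : (n (k + 2) : ℂ) - n (k + 1) ≠ 0 := by
      rw [sub_ne_zero, ne_eq, Nat.cast_inj]
      exact hn2.ne'
    have h3 : ∏ j ∈ Finset.range k, -(n' (j + 1) : ℂ) = ∏ j ∈ Finset.range k, -(n (j + 1) : ℂ) :=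
      Finset.prod_congr rfl fun j hj => by
        rw [hn' _ (by have := Finset.mem_range.mp hj; omega)]
    have h4 : ∏ j ∈ Finset.range k, ((n (k + 2) : ℂ) - n' (j + 1)) =
        ∏ j ∈ Finset.range k, ((n (k + 2) : ℂ) - n (j + 1)) :=
      Finset.prod_congr rfl fun j hj => by
        rw [hn' _ (by have := Finset.mem_range.mp hj; omega)]
    -- The ratio of the two factors just obtained is the ratio of the values of `alphaFactor` in the
    -- two ranks.
    rw [alphaFactor, alphaFactor, Finset.prod_range_succ (n := k + 1),
      Finset.prod_range_succ (n := k), Finset.prod_range_succ (n := k),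
      Finset.prod_range_succ (n := k), hn'k, h3, h4, smul_eq_mul]
    field_simp

end RankTwo

/-! ### The submodule of corank one -/

section Descend

variable {E : Type} [AddCommGroup E] [Module ATilde E]

namespace Invariants

variable {k : ℕ} (t : Invariants (k + 1))

theorem descend_val_castSucc (j : Fin (k + 1)) :
    t.descend.val j.castSucc = t.val j.castSucc.castSucc := by
  simp [descend]

theorem descend_val_last : t.descend.val (Fin.last (k + 1)) = t.val (Fin.last (k + 2)) + 1 := by
  simp [descend]

theorem descend_val_zero : t.descend.val 0 = t.val 0 := t.descend_val_castSucc 0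

theorem descend_exponent_of_lt {j : ℕ} (hj : j < k + 1) :
    t.descend.exponent j = t.exponent j := by
  have := t.descend_val_castSucc ⟨j, hj⟩
  rw [t.val_eq, ← t.descend_val_zero] at this
  exact t.descend.exponent_eq_of_val_eq (j := (⟨j, hj⟩ : Fin (k + 1)).castSucc) this

theorem descend_exponent_last : t.descend.exponent (k + 1) = t.exponent (k + 2) := by
  refine t.descend.exponent_eq_of_val_eq (j := Fin.last (k + 1)) ?_
  rw [descend_val_last, t.val_eq, descend_val_zero]
  simp only [Fin.val_last]
  push_cast
  ring

end Invariants

/-- G is cyclic inside E, so it is a primitive fresco. The exchange of the last two steps shows that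
G contains F_{r-2}, with quotient of parameter λ_r + 1. The conditions of semi-simplicity are
inherited from F_{r-1} and E / F_1. -/
theorem isoClass_submodule_mem_F₀ {lam : UnitRat} {k : ℕ} {t : Invariants (k + 1)}
    (hE : isoClass E ∈ F₀ lam t) {F : Fin (k + 4) → Submodule ATilde E}
    (hF : IsPrincipalJH t.val F) {e : E} (he : Submodule.span ATilde {e} = ⊤)
    (h : (aSub ((t.val (Fin.last (k + 1)).castSucc : ℚ) : ℂ) *
      aSub ((t.val (Fin.last (k + 2)) : ℚ) : ℂ)) • e ∈ F (Fin.last (k + 1)).castSucc.castSucc) :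
    isoClass (Submodule.span ATilde
      {aSub ((t.val (Fin.last (k + 1)).castSucc - 1 : ℚ) : ℂ) • e} : Submodule ATilde E) ∈
        F₀ lam t.descend := by
  have hN := hF.isNearlySemiSimple_of_mem hE
  obtain ⟨hf, hp, -⟩ := isoClass_mem_F₀_iff.mp hE
  set Fe := extendFiltration F with hFe
  set n := t.exponent
  set μ₀ := ((t.val 0 : ℚ) : ℂ)
  have e1 : ((t.val (Fin.last (k + 1)).castSucc : ℚ) : ℂ) =
      μ₀ + n (k + 1) - (k + 1 : ℕ) := t.val_eq_complex _
  have e2 : ((t.val (Fin.last (k + 2)) : ℚ) : ℂ) =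
      μ₀ + n (k + 1 + 1) - (k + 1 + 1 : ℕ) := t.val_eq_complex _
  have hFk : F (Fin.last (k + 1)).castSucc.castSucc = Fe (k + 1) :=
    (extendFiltration_of_lt F (by omega : k + 1 < k + 1 + 3)).symm
  rw [e1, e2, hFk] at h
  obtain ⟨h1, h2⟩ := hN.filtration.swap_generator hN.strictMono (j := k + 1) le_rfl
    (he.trans hN.filtration.top.symm) h
  rw [Rat.cast_sub, Rat.cast_one, e1]
  set c := μ₀ + n (k + 1) - (k + 1 : ℕ) - 1
  set G := Submodule.span ATilde {aSub c • e} with hG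
  let g : G := ⟨aSub c • e, Submodule.mem_span_singleton_self _⟩
  have hg : Submodule.span ATilde {g} = ⊤ := by
    rw [eq_top_iff]
    rintro ⟨w, hw⟩ -
    obtain ⟨u, rfl⟩ := Submodule.mem_span_singleton.mp hw
    exact Submodule.mem_span_singleton.mpr ⟨u, rfl⟩
  have hmono : ∀ {i j : ℕ}, i ≤ j → j ≤ k + 3 → Fe i ≤ Fe j :=
    fun hij hj => hN.filtration.mono hij hj
  have hle : ∀ j ≤ k + 1, Fe j ≤ LinearMap.range G.subtype := by
    intro j hj
    rw [Submodule.range_subtype]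
    exact (hmono hj (by omega)).trans h1
  -- Up to index k + 1 the submodules F_j lie in G and are kept; the last term is G itself.
  let F' : Fin (k + 3) → Submodule ATilde G := fun j =>
    if (j : ℕ) < k + 2 then (Fe j).comap G.subtype else ⊤
  have hF'lt : ∀ {j : Fin (k + 3)}, (j : ℕ) < k + 2 → F' j = (Fe j).comap G.subtype :=
    fun hj => if_pos hj
  have hF'last : F' (Fin.last (k + 2)) = ⊤ := if_neg (by simp)
  have hinj : Function.Injective G.subtype := Subtype.val_injective
  have hstep : ∀ j : Fin (k + 2), IsStep (F' j.castSucc) (F' j.succ)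
      ((t.descend.val j : ℚ) : ℂ) := by
    intro j
    refine Fin.lastCases ?_ (fun i => ?_) j
    · rw [hF'lt (j := (Fin.last (k + 1)).castSucc) (by simp), Fin.succ_last, hF'last,
        t.descend_val_last]
      push_cast
      rw [e2]
      refine ⟨le_top, g, trivial, fun w _ => ?_, h2⟩
      obtain ⟨u, hu⟩ := Submodule.mem_span_singleton.mp
        (hg ▸ Submodule.mem_top : w ∈ Submodule.span ATilde {g})
      exact ⟨u, by rw [hu, sub_self]; exact zero_mem _⟩
    · rw [hF'lt (by simp; omega), hF'lt (by have := i.2; simp; omega), t.descend_val_castSucc]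
      have := hN.filtration.step i (by omega)
      rw [t.val_eq_complex]
      exact this.comap G.subtype (hle _ (by omega))
  rw [isoClass_mem_F₀_iff]
  refine ⟨hf.of_injective G.subtype hinj hg, hp.of_injective G.subtype hinj, F', ?_, ?_, ?_⟩
  · refine ⟨?_, hF'last, Fin.monotone_iff_le_succ.mpr fun j => (hstep j).1, fun j => ?_,
      fun j => (hstep j).nonempty_equiv, t.descend.principal⟩
    · rw [hF'lt (by simp)]
      change (Fe 0).comap G.subtype = ⊥
      rw [hN.filtration.bot, Submodule.comap_bot, Submodule.ker_subtype]
    · by_cases hj : (j : ℕ) < k + 2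
      · rw [hF'lt hj]
        ext w
        have h3 := Set.ext_iff.mp (hF.normal ⟨j, by omega⟩) w
        rw [← extendFiltration_of_lt F] at h3
        simp only [Set.mem_ofPred_eq, Submodule.mem_comap, Submodule.subtype_apply] at h3 ⊢
        constructor
        · rintro ⟨hw, v, rfl⟩
          obtain ⟨z, hz, h4⟩ := h3.mp ⟨hw, v, rfl⟩
          have hzG : z ∈ G := (hmono (by omega : (j : ℕ) ≤ k + 1) (by omega)).trans h1 hz
          exact ⟨⟨z, hzG⟩, hz, Subtype.ext h4⟩
        · rintro ⟨v, hv, rfl⟩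
          exact ⟨Submodule.smul_mem _ _ hv, v, rfl⟩
      · have : j = Fin.last (k + 2) := Fin.ext (by simp; omega)
        rw [this, hF'last]
        ext w
        simp
  · rw [hF'lt (by simp)]
    refine hN.semiSimple_sub.of_injective ((G.subtype.domRestrict _).codRestrict _ fun x =>
      hmono (by simp) (by omega) x.2) fun _ _ hxy => Subtype.ext (Subtype.ext (congrArg Subtype.val hxy :))
  · rw [hF'lt (by simp)]
    exact hN.semiSimple_quot.quotient_comap G.subtype

end Descend

/-! ### Polynomial functions -/

/-- The algebra of the polynomial functions on `σ → ℂ`. -/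
def polyFun (σ : Type) : Subalgebra ℂ ((σ → ℂ) → ℂ) :=
  (MvPolynomial.aeval fun (i : σ) (s : σ → ℂ) => s i).range

section PolyFun

variable {σ : Type}

theorem mem_polyFun_iff {g : (σ → ℂ) → ℂ} :
    g ∈ polyFun σ ↔ ∃ Q : MvPolynomial σ ℂ, ∀ s, MvPolynomial.eval s Q = g s := by
  have h : ∀ (Q : MvPolynomial σ ℂ) (s : σ → ℂ),
      (MvPolynomial.aeval fun (i : σ) (s : σ → ℂ) => s i) Q s = MvPolynomial.eval s Q := by
    intro Q s
    induction Q using MvPolynomial.induction_on with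
    | C c => simp
    | add p q hp hq => rw [map_add, map_add, Pi.add_apply, hp, hq]
    | mul_X p i hp => rw [map_mul, map_mul, Pi.mul_apply, hp]; simp
  constructor
  · rintro ⟨Q, rfl⟩
    exact ⟨Q, fun s => (h Q s).symm⟩
  · rintro ⟨Q, hQ⟩
    exact ⟨Q, funext fun s => (h Q s).trans (hQ s)⟩

theorem const_mem_polyFun (c : ℂ) : (fun _ => c) ∈ polyFun σ :=
  (polyFun σ).algebraMap_mem c

theorem apply_mem_polyFun (i : σ) : (fun s => s i) ∈ polyFun σ :=
  mem_polyFun_iff.mpr ⟨MvPolynomial.X i, fun s => by simp⟩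

theorem sum_mem_polyFun {ι : Type*} (T : Finset ι) {g : ι → (σ → ℂ) → ℂ}
    (h : ∀ i ∈ T, g i ∈ polyFun σ) : (fun s => ∑ i ∈ T, g i s) ∈ polyFun σ := by
  have := Subalgebra.sum_mem (polyFun σ) h
  rwa [show ∑ i ∈ T, g i = fun s => ∑ i ∈ T, g i s from funext fun s => Finset.sum_apply _ _ _]
    at this

/-- With constant term 1 the recursion for the inverse involves no division. -/
theorem coeff_inv_mem_polyFun {S : (σ → ℂ) → PowerSeries ℂ}
    (h0 : ∀ s, PowerSeries.constantCoeff (S s) = 1)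
    (hS : ∀ m, (fun s => PowerSeries.coeff m (S s)) ∈ polyFun σ) (m : ℕ) :
    (fun s => PowerSeries.coeff m (S s)⁻¹) ∈ polyFun σ := by
  induction m using Nat.strong_induction_on with
  | _ m ih =>
    rw [funext fun s => PowerSeries.coeff_inv m (S s)]
    simp only [h0]
    by_cases hm : m = 0
    · simp only [hm, if_true]
      exact const_mem_polyFun _
    · simp only [hm, if_false]
      refine mul_mem (const_mem_polyFun _) (sum_mem_polyFun _ fun x _ => ?_)
      by_cases hx : x.2 < m
      · simp only [hx, if_true]
        exact mul_mem (hS _) (ih _ hx)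
      · simp only [hx, if_false]
        exact const_mem_polyFun _

theorem constantCoeff_unitSeries (s : ℕ → ℂ) :
    PowerSeries.constantCoeff (unitSeries s) = 1 := by
  simp [unitSeries]

theorem coeff_unitSeries_mem_polyFun (f : ℕ → σ) (m : ℕ) :
    (fun s : σ → ℂ => PowerSeries.coeff m (unitSeries fun i => s (f i))) ∈ polyFun σ := by
  rcases m with _ | m
  · simp only [PowerSeries.coeff_zero_eq_constantCoeff_apply, constantCoeff_unitSeries]
    exact const_mem_polyFun _
  · have : (fun s : σ → ℂ => PowerSeries.coeff (m + 1) (unitSeries fun i => s (f i))) =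
        fun s => s (f m) := by
      funext s
      simp [unitSeries, PowerSeries.coeff_one, PowerSeries.coeff_succ_X_mul]
    rw [this]
    exact apply_mem_polyFun _

/-- A family of series whose coefficients are polynomial functions. -/
def IsPolyFamily {ρ : ℂ} (y : (σ → ℂ) → LogMod ρ) : Prop :=
  ∀ m, (fun s => (y s m).1) ∈ polyFun σ ∧ (fun s => (y s m).2) ∈ polyFun σ

namespace IsPolyFamily

variable {ρ : ℂ} {y : (σ → ℂ) → LogMod ρ}

theorem aSub_smul (hy : IsPolyFamily y) (μ : ℂ) : IsPolyFamily fun s => aSub μ • y s := by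
  rintro (_ | m)
  · simp only [SeqMod.aSub_smul_zero]
    exact ⟨const_mem_polyFun 0, const_mem_polyFun 0⟩
  · simp only [LogMod.aSub_smul_succ]
    exact ⟨add_mem (mul_mem (const_mem_polyFun _) (hy m).1) (hy m).2,
      mul_mem (const_mem_polyFun _) (hy m).2⟩

theorem ofB_smul (hy : IsPolyFamily y) {S : (σ → ℂ) → PowerSeries ℂ}
    (hS : ∀ m, (fun s => PowerSeries.coeff m (S s)) ∈ polyFun σ) :
    IsPolyFamily fun s => ofB (S s) • y s := by
  intro m
  simp only [SeqMod.ofB_smul_apply, Prod.fst_sum, Prod.snd_sum, Prod.smul_fst, Prod.smul_snd,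
    smul_eq_mul]
  exact ⟨sum_mem_polyFun _ fun i _ => mul_mem (hS i) (hy _).1,
    sum_mem_polyFun _ fun i _ => mul_mem (hS i) (hy _).2⟩

theorem prod_smul (hy : IsPolyFamily y) {r : ℕ} (A : Fin r → (σ → ℂ) → ATilde)
    (hA : ∀ (j : Fin r) (z : (σ → ℂ) → LogMod ρ), IsPolyFamily z →
      IsPolyFamily fun s => A j s • z s) :
    IsPolyFamily fun s => (List.ofFn fun j => A j s).prod • y s := by
  induction r with
  | zero => simpa using hy
  | succ r ih =>
    simp only [List.ofFn_succ, List.prod_cons, mul_smul]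
    exact hA 0 _ (ih (fun j => A j.succ) fun j => hA j.succ)

theorem presentation_smul {r : ℕ} {y : (Fin r × ℕ → ℂ) → LogMod ρ} (hy : IsPolyFamily y)
    (μ : Fin r → ℚ) : IsPolyFamily fun s => presentation μ s • y s := by
  refine hy.prod_smul (fun j s => aSub ((μ j : ℚ) : ℂ) * ofB (unitSeries fun i => s (j, i))⁻¹)
    fun j z hz => ?_
  simp only [mul_smul]
  exact (hz.ofB_smul (coeff_inv_mem_polyFun (fun s => constantCoeff_unitSeries _)
    (coeff_unitSeries_mem_polyFun fun i => (j, i)))).aSub_smul _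

end IsPolyFamily

end PolyFun

/-! ### The leading coefficients -/

section Leading

/-- The action of a product of operators of degree one on the first coefficient of a series. -/
theorem prod_smul_apply_of_vanish {ρ : ℂ} {r : ℕ} (μ : Fin r → ℂ) (ν : Fin r → ℂ)
    (hμ : ∀ j, μ j = ρ + ν j + (r - 1 - (j : ℕ))) (V : Fin r → PowerSeries ℂ)
    (hV : ∀ j, PowerSeries.constantCoeff (V j) = 1) (y : LogMod ρ) (m : ℕ)
    (hy : ∀ i < m, y i = 0) :
    (∀ i < m + r, ((List.ofFn fun j => aSub (μ j) * ofB (V j)).prod • y) i = 0) ∧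
      ((List.ofFn fun j => aSub (μ j) * ofB (V j)).prod • y) (m + r) =
        ((∏ j, (X - C (ν j))).eval (m : ℂ) * (y m).1 +
          (derivative (∏ j, (X - C (ν j)))).eval (m : ℂ) * (y m).2,
          (∏ j, (X - C (ν j))).eval (m : ℂ) * (y m).2) := by
  induction r with
  | zero => simpa using hy
  | succ r ih =>
    obtain ⟨h1, h2⟩ := ih (fun j => μ j.succ) (fun j => ν j.succ)
      (fun j => by rw [hμ, Fin.val_succ]; push_cast; ring) (fun j => V j.succ) fun j => hV j.succ
    rw [List.ofFn_succ, List.prod_cons, mul_smul, mul_smul]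
    set z := (List.ofFn fun j => aSub (μ (Fin.succ j)) * ofB (V (Fin.succ j))).prod • y with hz
    obtain ⟨h3, h4⟩ := SeqMod.smul_apply_of_vanish (ofB (V 0)) z _ h1
    rw [const_ofB, hV, one_smul] at h4
    constructor
    · rintro (_ | i) hi
      · exact SeqMod.aSub_smul_zero _ _
      · rw [LogMod.aSub_smul_succ, h3 i (by omega)]
        simp
    · rw [← add_assoc, LogMod.aSub_smul_succ, h4, h2, hμ, Fin.prod_univ_succ]
      simp only [eval_mul, eval_sub, eval_X, eval_C, derivative_mul, derivative_sub, derivative_X,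
        derivative_C, eval_add, sub_zero, one_mul, Fin.val_zero]
      push_cast
      ext <;> ring

variable {k : ℕ} {μ₀ : ℂ} {n : ℕ → ℕ} {E : Type} [AddCommGroup E] [Module ATilde E]

/-- The solution normalized at the exponents of the other solutions. -/
theorem IsNearlySemiSimple.exists_normalized {F : ℕ → Submodule ATilde E}
    (h : IsNearlySemiSimple k μ₀ n F) {x : ℂ} (hx : HasAlpha k μ₀ n E x) {e : E}
    (he : Submodule.span ATilde {e} = ⊤) (K : ℕ) (hK : K ≤ k) :
    ∃ y, IsAlphaSolution k μ₀ n e y x ∧ ∀ i, 1 ≤ i → i ≤ K → (y (n i)).1 = 0 := by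
  induction K with
  | zero =>
    obtain ⟨y, hy⟩ := hx.exists_solution he
    exact ⟨y, hy, fun i hi hi' => by omega⟩
  | succ K ih =>
    obtain ⟨y, hy, hyK⟩ := ih (by omega)
    obtain ⟨z, hz1, -, hz3, -⟩ := h.exists_solution (i := K + 1) (by omega) he
      (ρ := μ₀ - k - 1 + n (K + 1)) (by ring)
    have hz : ∀ m, (z m).2 = 0 := h.snd_eq_zero_of_one_le e (by omega) (by omega) z hz1
    -- The solution attached to the quotient of index K + 1 has no logarithm and starts at n (K +
    -- 1): subtracting a multiple cancels that coefficient without affecting the earlier ones or the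
    -- logarithmic term.
    set w : LogMod (μ₀ - k - 1) := LogMod.shift (n (K + 1)) rfl z with hw
    have hw0 : ∀ i < n (K + 1), w i = 0 := fun i hi => by
      rw [hw, LogMod.shift_apply, if_neg (by omega)]
    have hw1 : (w (n (K + 1))).1 ≠ 0 := by
      rwa [hw, LogMod.shift_apply, if_pos le_rfl, Nat.sub_self]
    have hw2 : ∀ i, (w i).2 = 0 := fun i => by
      rw [hw, LogMod.shift_apply]
      split_ifs
      · exact hz _
      · rfl
    have hpos : 0 < n (K + 1) := by
      have := h.strictMono (by omega : 0 < K + 1)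
      omega
    refine ⟨y - ((y (n (K + 1))).1 / (w (n (K + 1))).1) • w,
      ⟨fun u hu => ?_, ?_, fun m hm => ?_, ?_⟩, fun i hi hi' => ?_⟩
    · rw [smul_sub, hy.ann u hu, smul_comm, hw, ← map_smul,
        hz1 u (by rw [hu]; exact zero_mem _), map_zero, smul_zero, sub_zero]
    · rw [SeqMod.sub_apply, SeqMod.smul_apply, hw0 0 hpos, smul_zero, sub_zero, hy.lead]
    · rw [SeqMod.sub_apply, SeqMod.smul_apply, Prod.snd_sub, Prod.smul_snd, hw2, smul_zero,
        sub_zero, hy.vanish m hm]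
    · rw [SeqMod.sub_apply, SeqMod.smul_apply, Prod.snd_sub, Prod.smul_snd, hw2, smul_zero,
        sub_zero, hy.log]
    · rw [SeqMod.sub_apply, SeqMod.smul_apply, Prod.fst_sub, Prod.smul_fst]
      rcases hi'.lt_or_eq with hlt | rfl
      · rw [hw0 _ (h.strictMono hlt), Prod.fst_zero, smul_zero, sub_zero, hyK i hi (by omega)]
      · rw [smul_eq_mul, div_mul_cancel₀ _ hw1, sub_self]

end Leading

/-! ### The invariant is a polynomial in the coefficients of the presentation -/

section Presentation

variable {k : ℕ} (t : Invariants k)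

/-- The first coefficients of a normalized solution. -/
structure IsNormalized (s : Fin (k + 2) × ℕ → ℂ)
    (y : LogMod (((t.val 0 : ℚ) : ℂ) - k - 1)) : Prop where
  ann : presentation t.val s • y = 0
  lead : (y 0).1 = 1
  vanish : ∀ m < t.exponent (k + 1), (y m).2 = 0
  normalized : ∀ i, 1 ≤ i → i ≤ k → (y (t.exponent i)).1 = 0

/-- The indicial polynomial. -/
def indicial : ℂ[X] := ∏ j : Fin (k + 2), (X - C (t.exponent j : ℂ))

theorem presentation_smul_apply_of_vanish (s : Fin (k + 2) × ℕ → ℂ)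
    (y : LogMod (((t.val 0 : ℚ) : ℂ) - k - 1)) (m : ℕ) (hy : ∀ i < m, y i = 0) :
    (presentation t.val s • y) (m + (k + 2)) =
      ((indicial t).eval (m : ℂ) * (y m).1 + (derivative (indicial t)).eval (m : ℂ) * (y m).2,
        (indicial t).eval (m : ℂ) * (y m).2) := by
  refine (prod_smul_apply_of_vanish (fun j => ((t.val j : ℚ) : ℂ)) (fun j => (t.exponent j : ℂ))
    (fun j => ?_) (fun j => (unitSeries fun i => s (j, i))⁻¹) (fun j => ?_) y m hy).2
  · rw [t.val_eq_complex]
    push_cast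
    ring
  · rw [PowerSeries.constantCoeff_inv, constantCoeff_unitSeries, inv_one]

/-- The last exponent is a simple root, the exponents being strictly increasing. -/
theorem derivative_indicial_ne_zero :
    (derivative (indicial t)).eval (t.exponent (k + 1) : ℂ) ≠ 0 := by
  rw [indicial, Fin.prod_univ_castSucc]
  simp only [derivative_mul, eval_add, eval_mul, Fin.val_last, derivative_sub, derivative_X,
    derivative_C, eval_sub, eval_X, eval_C, sub_self, mul_zero, zero_add, sub_zero, mul_one,
    eval_prod, Fin.val_castSucc]
  rw [Finset.prod_ne_zero_iff]
  intro j _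
  rw [sub_ne_zero, ne_eq, Nat.cast_inj]
  exact (t.exponent_strictMono j.2).ne'

/-- The coefficients of the normalized solutions are polynomial functions. -/
theorem exists_isPolyFamily_truncation (m : ℕ) (hm : m ≤ t.exponent (k + 1)) :
    ∃ Y : (Fin (k + 2) × ℕ → ℂ) → LogMod (((t.val 0 : ℚ) : ℂ) - k - 1), IsPolyFamily Y ∧
      ∀ s y, IsNormalized t s y → ∀ i, Y s i = if i < m then y i else 0 := by
  induction m with
  | zero =>
    exact ⟨fun _ => 0, fun _ => ⟨const_mem_polyFun 0, const_mem_polyFun 0⟩, fun s y _ i => by simp⟩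
  | succ m ih =>
    obtain ⟨Y, hY, h⟩ := ih (by omega)
    have hPY := hY.presentation_smul t.val
    -- At a root of the indicial polynomial below the last exponent the coefficient is fixed by the
    -- normalisation: 1 at index 0, and 0 at the intermediate exponents.
    have key : ∃ g ∈ polyFun (Fin (k + 2) × ℕ), ∀ s y, IsNormalized t s y → (y m).1 = g s := by
      by_cases h0 : (indicial t).eval (m : ℂ) = 0
      · by_cases hm0 : m = 0
        · exact ⟨_, const_mem_polyFun 1, fun s y hy => hm0 ▸ hy.lead⟩
        · refine ⟨_, const_mem_polyFun 0, fun s y hy => ?_⟩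
          rw [indicial, eval_prod, Finset.prod_eq_zero_iff] at h0
          obtain ⟨j, -, hj⟩ := h0
          rw [eval_sub, eval_X, eval_C, sub_eq_zero, Nat.cast_inj] at hj
          have h1 : 1 ≤ (j : ℕ) := by
            by_contra hj0
            have : (j : ℕ) = 0 := by omega
            rw [this, t.exponent_zero] at hj
            exact hm0 hj
          have h2 : (j : ℕ) < k + 1 := t.exponent_strictMono.lt_iff_lt.mp (by omega)
          rw [hj]
          exact hy.normalized j h1 (by omega)
      · refine ⟨_, mul_mem (const_mem_polyFun (-((indicial t).eval (m : ℂ))⁻¹))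
          (hPY (m + (k + 2))).1, fun s y hy => ?_⟩
        -- y and Y agree below m, and the presentation kills y. The first coefficient of its value
        -- on y - Y therefore expresses y m by the known ones, up to the constant factor `indicial`
        -- at m.
        have h1 := presentation_smul_apply_of_vanish t s (y - Y s) m fun i hi => by
          rw [SeqMod.sub_apply, h s y hy, if_pos hi, sub_self]
        rw [smul_sub, hy.ann, zero_sub, SeqMod.sub_apply, h s y hy m, if_neg (lt_irrefl m),
          sub_zero, hy.vanish m (by omega)] at h1
        have h2 := congrArg Prod.fst h1
        simp only [mul_zero, add_zero] at h2
        change _ = -((indicial t).eval (m : ℂ))⁻¹ * ((presentation t.val s • Y s) (m + (k + 2))).1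
        have h3 : (-(presentation t.val s • Y s) (m + (k + 2))).1 =
          -((presentation t.val s • Y s) (m + (k + 2))).1 := rfl
        have h4 := h3.symm.trans h2
        rw [neg_mul, ← mul_neg, h4, inv_mul_cancel_left₀ h0]
    obtain ⟨g, hg, hgy⟩ := key
    refine ⟨fun s i => if i = m then (g s, 0) else Y s i, fun i => ?_, fun s y hy i => ?_⟩
    · by_cases hi : i = m
      · simp only [hi, if_true]
        exact ⟨hg, const_mem_polyFun 0⟩
      · simp only [hi, if_false]
        exact hY i
    · by_cases hi : i = m
      · subst hi
        simp only [if_true, Nat.lt_succ_self]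
        exact Prod.ext (hgy s y hy).symm (hy.vanish i (by omega)).symm
      · simp only [hi, if_false]
        rw [h s y hy]
        by_cases him : i < m
        · rw [if_pos him, if_pos (by omega)]
        · rw [if_neg him, if_neg (by omega)]

/-- One more step of the same recursion, at the last exponent: the indicial polynomial vanishes
there, and the remaining term is its derivative times the logarithmic coefficient. -/
theorem exists_polynomial_hasAlpha {lam : UnitRat} :
    ∃ Q : MvPolynomial (Fin (k + 2) × ℕ) ℂ, ∀ (s : Fin (k + 2) × ℕ → ℂ) (x : ℂ),
      isoClass (CyclicMod (presentation t.val s)) ∈ F₀ lam t →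
      HasAlpha k ((t.val 0 : ℚ) : ℂ) t.exponent (CyclicMod (presentation t.val s)) x →
      MvPolynomial.eval s Q = x := by
  set p := t.exponent (k + 1) with hp
  obtain ⟨Y, hY, h⟩ := exists_isPolyFamily_truncation t p le_rfl
  have hd : (derivative (indicial t)).eval (p : ℂ) ≠ 0 := derivative_indicial_ne_zero t
  obtain ⟨Q, hQ⟩ := mem_polyFun_iff.mp (mul_mem
    (const_mem_polyFun (-((alphaFactor k t.exponent)⁻¹ *
      ((derivative (indicial t)).eval (p : ℂ))⁻¹)))
    (hY.presentation_smul t.val (p + (k + 2))).1)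
  refine ⟨Q, fun s x hs hx => ?_⟩
  rw [hQ s]
  obtain ⟨-, -, F, hF, -⟩ := isoClass_mem_F₀_iff.mp hs
  have hN := hF.isNearlySemiSimple_of_mem hs
  have he : Submodule.span ATilde
      {(Submodule.Quotient.mk 1 : CyclicMod (presentation t.val s))} = ⊤ := by
    rw [eq_top_iff]
    rintro y -
    obtain ⟨u, rfl⟩ := Submodule.Quotient.mk_surjective _ y
    rw [Submodule.mem_span_singleton]
    exact ⟨u, by rw [← Submodule.Quotient.mk_smul, smul_eq_mul, mul_one]⟩
  obtain ⟨y, hy, hyn⟩ := hN.exists_normalized hx he k le_rfl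
  have hyN : IsNormalized t s y := by
    refine ⟨hy.ann _ ?_, hy.lead, hy.vanish, hyn⟩
    rw [← Submodule.Quotient.mk_smul, smul_eq_mul, mul_one, mem_cyclic_iff]
    exact ⟨1, (one_mul _).symm⟩
  have h1 := presentation_smul_apply_of_vanish t s (y - Y s) p fun i hi => by
    rw [SeqMod.sub_apply, h s y hyN, if_pos hi, sub_self]
  have h0 : (indicial t).eval (p : ℂ) = 0 := by
    rw [indicial, eval_prod]
    exact Finset.prod_eq_zero (Finset.mem_univ (Fin.last (k + 1))) (by simp [hp])
  rw [smul_sub, hyN.ann, zero_sub, SeqMod.sub_apply, h s y hyN p, if_neg (lt_irrefl p),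
    sub_zero, h0, hy.log, zero_mul, zero_add] at h1
  have h2 : -((presentation t.val s • Y s) (p + (k + 2))).1 = _ := congrArg Prod.fst h1
  change -((alphaFactor k t.exponent)⁻¹ * ((derivative (indicial t)).eval (p : ℂ))⁻¹) *
    ((presentation t.val s • Y s) (p + (k + 2))).1 = x
  rw [neg_mul, ← mul_neg, h2]
  have h3 : alphaFactor k t.exponent ≠ 0 := alphaFactor_ne_zero t.exponent_strictMono
  field_simp

end Presentation

/-! ### The invariant -/

section Invariant

variable {lam : UnitRat} {E : Type} [AddCommGroup E] [Module ATilde E]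

theorem exists_hasAlpha_of_mem {k : ℕ} {t : Invariants k} (hE : isoClass E ∈ F₀ lam t) :
    ∃ x, HasAlpha k ((t.val 0 : ℚ) : ℂ) t.exponent E x := by
  obtain ⟨-, -, F, hF, -⟩ := isoClass_mem_F₀_iff.mp hE
  exact (hF.isNearlySemiSimple_of_mem hE).exists_hasAlpha

/-- The invariant, as a function of the isomorphism class. -/
def alphaInvariant (lam : UnitRat) {k : ℕ} (t : Invariants k) (c : F₀ lam t) : ℂ :=
  (exists_hasAlpha_of_mem (E := c.2.choose) (c.2.choose_spec.1.symm ▸ c.2)).choose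

theorem hasAlpha_alphaInvariant {k : ℕ} {t : Invariants k} (hE : isoClass E ∈ F₀ lam t) :
    HasAlpha k ((t.val 0 : ℚ) : ℂ) t.exponent E (alphaInvariant lam t ⟨isoClass E, hE⟩) := by
  set c : F₀ lam t := ⟨isoClass E, hE⟩
  obtain ⟨f⟩ := isoClass_eq_iff.mp c.2.choose_spec.1
  exact (exists_hasAlpha_of_mem (E := c.2.choose) (c.2.choose_spec.1.symm ▸ c.2)).choose_spec.of_equiv
    f

theorem HasAlpha.eq_alphaInvariant {k : ℕ} {t : Invariants k} (hE : isoClass E ∈ F₀ lam t) {x : ℂ}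
    (hx : HasAlpha k ((t.val 0 : ℚ) : ℂ) t.exponent E x) :
    alphaInvariant lam t ⟨isoClass E, hE⟩ = x := by
  obtain ⟨-, -, F, hF, -⟩ := isoClass_mem_F₀_iff.mp hE
  exact (hF.isNearlySemiSimple_of_mem hE).alpha_unique (hasAlpha_alphaInvariant hE) hx

theorem dependsPolynomially_alphaInvariant {k : ℕ} (t : Invariants k) :
    DependsPolynomially (alphaInvariant lam t) := by
  obtain ⟨Q, hQ⟩ := exists_polynomial_hasAlpha t (lam := lam)
  exact ⟨Q, fun s h => hQ s _ h (hasAlpha_alphaInvariant h)⟩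

theorem alphaInvariant_eq_zero_iff {k : ℕ} {t : Invariants k} (hE : isoClass E ∈ F₀ lam t) :
    alphaInvariant lam t ⟨isoClass E, hE⟩ = 0 ↔ IsSemiSimpleAB E := by
  obtain ⟨-, -, F, hF, -⟩ := isoClass_mem_F₀_iff.mp hE
  exact (hF.isNearlySemiSimple_of_mem hE).alpha_eq_zero_iff (hasAlpha_alphaInvariant hE)

theorem alphaInvariant_submodule {k : ℕ} {t : Invariants (k + 1)} (hE : isoClass E ∈ F₀ lam t)
    {F : Fin (k + 4) → Submodule ATilde E} (hF : IsPrincipalJH t.val F) {e : E}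
    (he : Submodule.span ATilde {e} = ⊤)
    (h : (aSub ((t.val (Fin.last (k + 1)).castSucc : ℚ) : ℂ) *
      aSub ((t.val (Fin.last (k + 2)) : ℚ) : ℂ)) • e ∈ F (Fin.last (k + 1)).castSucc.castSucc) :
    ∃ hG : isoClass (Submodule.span ATilde
      {aSub ((t.val (Fin.last (k + 1)).castSucc - 1 : ℚ) : ℂ) • e} : Submodule ATilde E) ∈
        F₀ lam t.descend,
      alphaInvariant lam t ⟨isoClass E, hE⟩ = alphaInvariant lam t.descend ⟨_, hG⟩ := by
  have hG := isoClass_submodule_mem_F₀ hE hF he h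
  refine ⟨hG, (HasAlpha.eq_alphaInvariant hG ?_).symm⟩
  have h1 : ((t.val (Fin.last (k + 1)).castSucc - 1 : ℚ) : ℂ) =
      ((t.val 0 : ℚ) : ℂ) + t.exponent (k + 1) - (k + 1 : ℕ) - 1 := by
    rw [Rat.cast_sub, Rat.cast_one, t.val_eq_complex]
    rfl
  rw [h1, t.descend_val_zero]
  exact HasAlpha.submodule t.exponent_strictMono t.exponent_zero
    (fun j hj => t.descend_exponent_of_lt hj) t.descend_exponent_last
    (hasAlpha_alphaInvariant hE) he rfl

theorem alphaInvariant_of_equiv {t : Invariants 0} {p : ℕ} {x : ℂ} (hE : isoClass E ∈ F₀ lam t)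
    (hp : t.val 1 = t.val 0 + p - 1)
    (f : E ≃ₗ[ATilde] CyclicMod (aSub ((t.val 0 : ℚ) : ℂ) *
      ofB (1 + PowerSeries.C x * PowerSeries.X ^ p)⁻¹ * aSub ((t.val 1 : ℚ) : ℂ))) :
    alphaInvariant lam t ⟨isoClass E, hE⟩ = x := by
  have h1 : t.exponent 1 = p := t.exponent_eq_of_val_eq (j := 1) (by rw [hp]; simp)
  have h2 : ((t.val 1 : ℚ) : ℂ) = ((t.val 0 : ℚ) : ℂ) + t.exponent 1 - 1 := by
    rw [hp, h1]
    push_cast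
    ring
  rw [h2, ← h1] at f
  refine HasAlpha.eq_alphaInvariant hE (hasAlpha_of_equiv_rankTwo ?_ f)
  have := t.exponent_strictMono (by omega : 0 < 1)
  omega

/-- Two families of functions that are equal in rank two and that are compatible with the
submodules of corank one are equal. -/
theorem family_eq (α β : (k : ℕ) → (t : Invariants k) → F₀ lam t → ℂ)
    (hα : ∀ (k : ℕ) (t : Invariants (k + 1)) (E : Type) [AddCommGroup E] [Module ATilde E]
      (hE : isoClass E ∈ F₀ lam t) (F : Fin (k + 4) → Submodule ATilde E) (e : E),
      IsPrincipalJH t.val F → Submodule.span ATilde {e} = ⊤ →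
      (aSub (t.val (Fin.last (k + 1)).castSucc : ℚ) * aSub (t.val (Fin.last (k + 2)) : ℚ)) • e ∈
        F (Fin.last (k + 1)).castSucc.castSucc →
      ∃ hG : isoClass (Submodule.span ATilde
          {aSub ((t.val (Fin.last (k + 1)).castSucc - 1 : ℚ) : ℂ) • e} : Submodule ATilde E) ∈
            F₀ lam t.descend,
        α (k + 1) t ⟨isoClass E, hE⟩ = α k t.descend ⟨_, hG⟩)
    (hα' : ∀ (t : Invariants 0) (p : ℕ) (x : ℂ) (E : Type) [AddCommGroup E] [Module ATilde E]
      (hE : isoClass E ∈ F₀ lam t), t.val 1 = t.val 0 + p - 1 →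
      Nonempty (E ≃ₗ[ATilde] CyclicMod (aSub (t.val 0 : ℚ) *
        ATilde.ofB (1 + PowerSeries.C x * PowerSeries.X ^ p)⁻¹ * aSub (t.val 1 : ℚ))) →
      α 0 t ⟨isoClass E, hE⟩ = x)
    (hβ : ∀ (k : ℕ) (t : Invariants (k + 1)) (E : Type) [AddCommGroup E] [Module ATilde E]
      (hE : isoClass E ∈ F₀ lam t) (F : Fin (k + 4) → Submodule ATilde E) (e : E),
      IsPrincipalJH t.val F → Submodule.span ATilde {e} = ⊤ →
      (aSub (t.val (Fin.last (k + 1)).castSucc : ℚ) * aSub (t.val (Fin.last (k + 2)) : ℚ)) • e ∈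
        F (Fin.last (k + 1)).castSucc.castSucc →
      ∃ hG : isoClass (Submodule.span ATilde
          {aSub ((t.val (Fin.last (k + 1)).castSucc - 1 : ℚ) : ℂ) • e} : Submodule ATilde E) ∈
            F₀ lam t.descend,
        β (k + 1) t ⟨isoClass E, hE⟩ = β k t.descend ⟨_, hG⟩)
    (hβ' : ∀ (t : Invariants 0) (p : ℕ) (x : ℂ) (E : Type) [AddCommGroup E] [Module ATilde E]
      (hE : isoClass E ∈ F₀ lam t), t.val 1 = t.val 0 + p - 1 →
      Nonempty (E ≃ₗ[ATilde] CyclicMod (aSub (t.val 0 : ℚ) *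
        ATilde.ofB (1 + PowerSeries.C x * PowerSeries.X ^ p)⁻¹ * aSub (t.val 1 : ℚ))) →
      β 0 t ⟨isoClass E, hE⟩ = x) : α = β := by
  funext k
  induction k with
  | zero =>
    funext t c
    obtain ⟨c, E, rfl, hE⟩ := c
    have hc : isoClass E ∈ F₀ lam t := ⟨E, rfl, hE⟩
    obtain ⟨-, -, F, hF, -⟩ := hE
    have hN := hF.isNearlySemiSimple_of_mem hc
    obtain ⟨e, he⟩ := hN.cyclic
    -- Every class of rank two is of the form in which both families take the prescribed value x.
    obtain ⟨x, ⟨f⟩⟩ := hN.filtration.exists_equiv_rankTwo hN.strictMono hN.zero he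
    have h1 : t.val 1 = t.val 0 + t.exponent 1 - 1 := by
      have := t.val_eq 1
      simpa using this
    have h2 : ((t.val 1 : ℚ) : ℂ) = ((t.val 0 : ℚ) : ℂ) + t.exponent 1 - 1 := by
      rw [h1]
      push_cast
      ring
    rw [← h2] at f
    exact (hα' t _ x E hc h1 ⟨f⟩).trans (hβ' t _ x E hc h1 ⟨f⟩).symm
  | succ k ih =>
    funext t c
    obtain ⟨c, E, rfl, hE⟩ := c
    have hc : isoClass E ∈ F₀ lam t := ⟨E, rfl, hE⟩
    obtain ⟨-, -, F, hF, -⟩ := hE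
    have hN := hF.isNearlySemiSimple_of_mem hc
    -- Such a generator reduces both families to the same class of smaller rank, where the induction
    -- hypothesis applies.
    obtain ⟨e, he, h⟩ := hN.exists_split_generator
    have e1 : ((t.val (Fin.last (k + 1)).castSucc : ℚ) : ℂ) = ((t.val 0 : ℚ) : ℂ) +
        t.exponent (k + 1) - (k + 1 : ℕ) := t.val_eq_complex _
    have e2 : ((t.val (Fin.last (k + 2)) : ℚ) : ℂ) = ((t.val 0 : ℚ) : ℂ) +
        t.exponent (k + 2) - (k + 2 : ℕ) := t.val_eq_complex _
    rw [← e1, ← e2, extendFiltration_of_lt F (by omega : k + 1 < k + 1 + 3)] at h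
    obtain ⟨_, h1⟩ := hα k t E hc F e hF he h
    obtain ⟨_, h2⟩ := hβ k t E hc F e hF he h
    exact (h1.trans (congrFun (congrFun ih _) _)).trans h2.symm

end Invariant

end

theorem mainTheorem5 (lam : UnitRat) :
    ∃! α : (k : ℕ) → (t : Invariants k) → F₀ lam t → ℂ,
      (∀ (k : ℕ) (t : Invariants k), DependsPolynomially (α k t)) ∧
      (∀ (k : ℕ) (t : Invariants k) (E : Type) [AddCommGroup E] [Module ATilde E]
        (hE : isoClass E ∈ F₀ lam t), α k t ⟨isoClass E, hE⟩ = 0 ↔ IsSemiSimpleAB E) ∧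
      (∀ (k : ℕ) (t : Invariants (k + 1)) (E : Type) [AddCommGroup E] [Module ATilde E]
        (hE : isoClass E ∈ F₀ lam t) (F : Fin (k + 4) → Submodule ATilde E) (e : E),
        IsPrincipalJH t.val F → Submodule.span ATilde {e} = ⊤ →
        (aSub (t.val (Fin.last (k + 1)).castSucc : ℚ) * aSub (t.val (Fin.last (k + 2)) : ℚ)) • e ∈
          F (Fin.last (k + 1)).castSucc.castSucc →
        ∃ hG : isoClass (Submodule.span ATilde
            {aSub ((t.val (Fin.last (k + 1)).castSucc - 1 : ℚ) : ℂ) • e} : Submodule ATilde E) ∈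
              F₀ lam t.descend,
          α (k + 1) t ⟨isoClass E, hE⟩ = α k t.descend ⟨_, hG⟩) ∧
      (∀ (t : Invariants 0) (p : ℕ) (x : ℂ) (E : Type) [AddCommGroup E] [Module ATilde E]
        (hE : isoClass E ∈ F₀ lam t), t.val 1 = t.val 0 + p - 1 →
        Nonempty (E ≃ₗ[ATilde] CyclicMod (aSub (t.val 0 : ℚ) *
          ATilde.ofB (1 + PowerSeries.C x * PowerSeries.X ^ p)⁻¹ * aSub (t.val 1 : ℚ))) →
        α 0 t ⟨isoClass E, hE⟩ = x) := by
  refine ⟨fun k t => alphaInvariant lam t, ⟨fun k t => dependsPolynomially_alphaInvariant t,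
    fun k t E _ _ hE => alphaInvariant_eq_zero_iff hE,
    fun k t E _ _ hE F e hF he h => alphaInvariant_submodule hE hF he h,
    fun t p x E _ _ hE hp ⟨f⟩ => alphaInvariant_of_equiv hE hp f⟩, ?_⟩
  rintro β ⟨-, -, h2, h3⟩
  exact family_eq _ _ h2 h3 (fun k t E _ _ hE F e hF he h => alphaInvariant_submodule hE hF he h)
    fun t p x E _ _ hE hp ⟨f⟩ => alphaInvariant_of_equiv hE hp f
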